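/- **Setting.** Fix a quantile level $\tau\in(0,1)$ and a kernel $K:\mathbb R\to\mathbb R$ that is symmetric, non-negative, bounded, integrates to one, has $\int u^2K(u)\,du<\infty$ and $\min_{|u|\le1}K(u)>0$, and is differentiable with bounded derivative; put $K_h(u)=K(u/h)/h$. Consider a sequence of experiments with $m$ machines and $n$ observations per machine, $N=mn\to\infty$. In each experiment $(X_i,Y_i)$, $i=1,\dots,N$, are i.i.d. copies of $(X,Y)\in\mathbb R^{p+1}\times\mathbb R$, where $X=(x_0,\dots,x_p)^{\mathrm T}$, $x_0\equiv1$; those with $i\le n$ are on the first machine, $\mathcal M_1$. The conditional $\tau$-quantile of $Y$ given $X$ is $X^{\mathrm T}\beta^*$. Let $\bar S=\{j\in\{0,\dots,p\}:\beta^*_j\ne0\}$, $s=|\bar S|$, $S=\bar S\cap\{1,\dots,p\}$ (so $\bar S=S$ when the intercept $\beta_0^*$ is $0$). All quantities ($m,n,p,s$, the law of $(X,Y)$, $\beta^*$, $h$, $b$) may vary along the sequence; the following constants may not. **Assumptions.** (i) $\varepsilon=Y-X^{\mathrm T}\beta^*$ has a conditional density $f_{\varepsilon|X}$ given $X$ with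 $0<f_1\le f_{\varepsilon|X}(0)\le f_2$ and $|f_{\varepsilon|X}(u)-f_{\varepsilon|X}(v)|\le l_0|u-v|$ for all $u,v$, almost surely. (ii) $\Sigma=\mathbb E(XX^{\mathrm T})$ is finite and $\mathbb P(|X^{\mathrm T}\Sigma^{-1/2}\delta|\ge c_1t)\le2e^{-t^2/2}$ for all unit vectors $\delta$ and $t>0$. (iii) $I=\mathbb E\{f_{\varepsilon|X}(0)XX^{\mathrm T}\}$ satisfies $\|I_{\bar S^c\times\bar S}I_{\bar S\times\bar S}^{-1}\|_\infty\le1-\alpha$ with $0<\alpha<1$, and its eigenvalues lie in $[\lambda_-,\lambda_+]$, $0<\lambda_-\le\lambda_+$. Here $\|A\|_\infty=\max_i\sum_j|a_{ij}|$. (iv) $p=O(N^\nu)$ with $\nu>0$, $n\ge N^c$ with $0<c<1$, $s=O(n^r)$ with $0\le r<1/3$. (v) The bandwidths are positive, with $h\asymp(s\log N/N)^{1/3}$ and $b\asymp(s\log n/n)^{1/3}$. (vi) The initial estimator $\hat\beta_0$ satisfies $\mathbb P(|\hat\beta_0-\beta^*|_2\le M\sqrt{s\log N/n})\to1$ for a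 constant $M$, and $\mathbb P(\operatorname{supp}(\hat\beta_0)\subseteq\bar S)\to1$. **Iterates.** Let $$\kappa(a,b,g)=\max\Big\{s^a\Big(\frac{\log n}n\Big)^{\frac{2g+3}6},\;s^b\Big(\frac{\log N}n\Big)^{\frac{g+1}2}\Big\},\qquad \lambda_{N,g}=C_g\Big(\sqrt{\tfrac{\log N}N}+\kappa(\tfrac{5g}6,g,g)\Big).$$ For $g=1,\dots,t$, with $e_i=Y_i-X_i^{\mathrm T}\hat\beta_{g-1}$, $$\hat D_h=\frac1N\sum_{i=1}^NK_h(e_i)X_iX_i^{\mathrm T},\quad \hat D_{1,b}=\frac1n\sum_{i\in\mathcal M_1}K_b(e_i)X_iX_i^{\mathrm T},\quad z_N=\hat D_h\hat\beta_{g-1}-\frac1N\sum_{i=1}^N\{\mathbf 1(e_i\le0)-\tau\}X_i,$$ $\hat\beta_g$ is a (measurable) minimizer of $\frac12\beta^{\mathrm T}\hat D_{1,b}\beta-\beta^{\mathrm T}\{z_N+(\hat D_{1,b}-\hat D_h)\hat\beta_{g-1}\}+\lambda_{N,g}|\beta|_1$ over $\beta\in\mathbb R^{p+1}$ whenever a minimizer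 exists. Put $\hat S_t=\{j\in\{1,\dots,p\}:\hat\beta_{t,j}\ne0\}$. **Theorem.** Let $t\ge1$ be fixed, let $C_1$ be sufficiently large, and for $1\le g<t$ let $C_{g+1}$ be sufficiently large given $C_g$. Then: 1. $\mathbb P(\operatorname{supp}(\hat\beta_t)\subseteq\bar S)\to1$; in particular $\mathbb P(\hat S_t\subseteq S)\to1$. 2. There is a constant $C>0$ such that, if eventually $$\min_{j\in S}|\beta^*_j|\ge C\,\|I_{\bar S\times\bar S}^{-1}\|_\infty\Big(\sqrt{\tfrac{\log N}N}+\kappa(\tfrac{5t}6,t,t)\Big),$$ then $\mathbb P(\hat S_t=S)\to1$. 3. If eventually $$t\ge\frac{3\log\big(m\log(N/m)/\log N\big)}{\log\big(N^2/(m^2s^5\log^2(N/m))\big)}\quad\text{and}\quad t\ge\frac{\log m}{\log\big(N/(ms^2\log N)\big)},\qquad(*)$$ then the condition $\min_{j\in S}|\beta_j^*|\ge C\,\|I_{\bar S\times\bar S}^{-1}\|_\infty\sqrt{\log N/N}$ (eventually) is enough for $\mathbb P(\hat S_t=S)\to1$. A constant number of iterations suffices for this: there is a constant $T$ such that, for every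 fixed $t\ge T$, $(*)$ holds eventually. All thresholds and constants ($T$, those for $C_1$ and for $C_{g+1}$ given $C_g$, and $C$, which may also depend on $t$ and $C_1,\dots,C_t$) depend only on $K$, $\tau$ and the constants of the assumptions. -/

import Mathlib

open MeasureTheory ProbabilityTheory Filter Topology Matrix

noncomputable section

namespace DHSQR

/-! ### Vectors and matrices -/

/-- Vectors of `ℝ^{p+1}`, with coordinates `0, 1, …, p`; coordinate `0` is the intercept. -/
abbrev Vec (p : ℕ) := Fin (p + 1) → ℝ

/-- The `ℓ₁` norm. -/
def l1 {p : ℕ} (v : Vec p) : ℝ := ∑ j, |v j|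

/-- The `ℓ₂` norm. -/
def l2 {p : ℕ} (v : Vec p) : ℝ := √(∑ j, v j ^ 2)

open Classical in
/-- The support of a vector, a set of coordinates in `{0, …, p}`. -/
def supp {p : ℕ} (v : Vec p) : Finset (Fin (p + 1)) := Finset.univ.filter fun j => v j ≠ 0

/-- The slope support of a vector: the support without the intercept coordinate,
a subset of `{1, …, p}`. -/
def slopeSupp {p : ℕ} (v : Vec p) : Finset (Fin (p + 1)) := (supp v).erase 0

/-- The matrix norm `‖A‖_∞`, the maximal `ℓ₁` norm of a row (`0` if there is no row). -/
def maxRowSum {ι κ : Type*} [Fintype κ] (A : Matrix ι κ ℝ) : ℝ := ⨆ i, ∑ j, |A i j|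

/-- The block `A_{S × S}`. -/
def blockSS {p : ℕ} (A : Matrix (Fin (p + 1)) (Fin (p + 1)) ℝ) (S : Finset (Fin (p + 1))) :
    Matrix {j // j ∈ S} {j // j ∈ S} ℝ :=
  A.submatrix (fun j => j.1) (fun j => j.1)

/-- The block `A_{Sᶜ × S}`. -/
def blockScS {p : ℕ} (A : Matrix (Fin (p + 1)) (Fin (p + 1)) ℝ) (S : Finset (Fin (p + 1))) :
    Matrix {j // j ∉ S} {j // j ∈ S} ℝ :=
  A.submatrix (fun j => j.1) (fun j => j.1)

/-! ### Kernel -/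

/-- The conditions on the smoothing kernel. -/
structure IsSmoothingKernel (K : ℝ → ℝ) : Prop where
  symm : ∀ u, K (-u) = K u
  nonneg : ∀ u, 0 ≤ K u
  bounded : ∃ B, ∀ u, K u ≤ B
  integrable : Integrable K
  integral_eq_one : ∫ u, K u = 1
  second_moment : Integrable fun u => u ^ 2 * K u
  pos_near_zero : ∃ c > 0, ∀ u, |u| ≤ 1 → c ≤ K u
  differentiable : Differentiable ℝ K
  deriv_bounded : ∃ B, ∀ u, |deriv K u| ≤ B

/-- The rescaled kernel `K_h(u) = K(u / h) / h`. -/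
def Kh (K : ℝ → ℝ) (h u : ℝ) : ℝ := K (u / h) / h

/-! ### The fixed constants -/

/-- The constants of the assumptions, which do not vary with the sample size:
the quantile level `τ`; the bounds `f₁, f₂` on the conditional density of the error at `0` and its
Lipschitz constant `l₀`; the sub-Gaussian constant `c₁`; the irrepresentability constant `α`;
the spectral bounds `lamLo, lamHi`; the constants in `p ≤ Cp N ^ ν`, `N ^ c ≤ n`, `s ≤ Cs n ^ r`;
the constants in the orders of the two bandwidths; and the constant `M` in the rate of the
initial estimator. -/
structure Constants where
  (τ f₁ f₂ l₀ c₁ α lamLo lamHi ν Cp c r Cs hLo hHi bLo bHi M : ℝ)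
  τ_pos : 0 < τ
  τ_lt : τ < 1
  f₁_pos : 0 < f₁
  f₁_le : f₁ ≤ f₂
  c₁_pos : 0 < c₁
  α_pos : 0 < α
  α_lt : α < 1
  lamLo_pos : 0 < lamLo
  lamHi_pos : 0 < lamHi
  ν_pos : 0 < ν
  c_pos : 0 < c
  c_lt : c < 1
  r_nonneg : 0 ≤ r
  r_lt : r < 1 / 3
  hLo_pos : 0 < hLo
  bLo_pos : 0 < bLo

/-! ### The population -/

/-- A population: the law of `(X, Y)` on `ℝ^{p+1} × ℝ`, a coefficient vector `β*`, and a
function `(x, u) ↦ f_{ε|X=x}(u)`. -/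
structure Population (p : ℕ) where
  law : Measure (Vec p × ℝ)
  isProb : IsProbabilityMeasure law
  beta : Vec p
  dens : Vec p → ℝ → ℝ

attribute [instance] Population.isProb

namespace Population

variable {p : ℕ} (D : Population p)

/-- The conditional `τ`-quantile of `Y` given `X = x`. -/
def condQuantile (τ : ℝ) (x : Vec p) : ℝ :=
  sInf {q : ℝ | τ ≤ (D.law.condKernel x).real (Set.Iic q)}

/-- `Σ = E[X Xᵀ]`. -/
def Sigma : Matrix (Fin (p + 1)) (Fin (p + 1)) ℝ :=
  Matrix.of fun i j => ∫ z, z.1 i * z.1 j ∂D.law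

/-- `I = E[f_{ε|X}(0) X Xᵀ]`. -/
def Info : Matrix (Fin (p + 1)) (Fin (p + 1)) ℝ :=
  Matrix.of fun i j => ∫ z, D.dens z.1 0 * (z.1 i * z.1 j) ∂D.law

/-- The support of `β*`. -/
def S : Finset (Fin (p + 1)) := supp D.beta

/-- The sparsity level `s`. -/
def s : ℕ := D.S.card

/-- The linear quantile model together with the conditions on the conditional density, the
covariates and the matrix `I`. -/
structure Regular (Q : Constants) : Prop where
  /-- The covariate `x₀` is identically one. -/
  intercept : ∀ᵐ x ∂D.law.fst, x 0 = 1
  /-- The conditional `τ`-quantile of `Y` given `X` is `Xᵀ β*`. -/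
  quantile : ∀ᵐ x ∂D.law.fst, D.condQuantile Q.τ x = x ⬝ᵥ D.beta
  dens_measurable : Measurable (Function.uncurry D.dens)
  dens_nonneg : ∀ x u, 0 ≤ D.dens x u
  /-- `dens x` is the conditional density of `ε = Y - Xᵀ β*` given `X = x`. -/
  dens_spec : ∀ᵐ x ∂D.law.fst, D.law.condKernel x =
    volume.withDensity fun y => ENNReal.ofReal (D.dens x (y - x ⬝ᵥ D.beta))
  dens_zero : ∀ᵐ x ∂D.law.fst, Q.f₁ ≤ D.dens x 0 ∧ D.dens x 0 ≤ Q.f₂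
  dens_lipschitz : ∀ᵐ x ∂D.law.fst, ∀ u v, |D.dens x u - D.dens x v| ≤ Q.l₀ * |u - v|
  second_moment : ∀ j, Integrable (fun z : Vec p × ℝ => z.1 j ^ 2) D.law
  /-- Sub-Gaussian covariates. The vectors `v` with `vᵀ Σ v = 1` are the vectors
  `Σ^{-1/2} δ` with `δ` a unit vector. -/
  subgaussian : ∀ v : Vec p, v ⬝ᵥ (D.Sigma *ᵥ v) = 1 → ∀ t : ℝ, 0 < t →
    D.law.real {z | Q.c₁ * t ≤ |z.1 ⬝ᵥ v|} ≤ 2 * Real.exp (-t ^ 2 / 2)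
  /-- The irrepresentable condition. -/
  irrepresentable : maxRowSum (blockScS D.Info D.S * (blockSS D.Info D.S)⁻¹) ≤ 1 - Q.α
  /-- `lamLo ≤ Λ_min(I) ≤ Λ_max(I) ≤ lamHi`. -/
  eigen_lower : ∀ v : Vec p, Q.lamLo * (v ⬝ᵥ v) ≤ v ⬝ᵥ (D.Info *ᵥ v)
  eigen_upper : ∀ v : Vec p, v ⬝ᵥ (D.Info *ᵥ v) ≤ Q.lamHi * (v ⬝ᵥ v)

end Population

/-! ### One step of the algorithm, on given data -/

section Algorithm

variable {p N : ℕ}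

/-- The residual `e = y - xᵀ β`. -/
def resid (β x : Vec p) (y : ℝ) : ℝ := y - x ⬝ᵥ β

/-- `I(e ≤ 0)`. -/
def indNonpos (e : ℝ) : ℝ := if e ≤ 0 then 1 else 0

/-- The pseudo covariate `√(K_h(e)) x`, where `e` is the residual at the current iterate `β`. -/
def pseudoX (K : ℝ → ℝ) (h : ℝ) (β x : Vec p) (y : ℝ) : Vec p :=
  √(Kh K h (resid β x y)) • x

/-- The pseudo response. -/
def pseudoY (K : ℝ → ℝ) (τ h : ℝ) (β x : Vec p) (y : ℝ) : ℝ :=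
  pseudoX K h β x y ⬝ᵥ β - 1 / √(Kh K h (resid β x y)) * (indNonpos (resid β x y) - τ)

/-- The product of the pseudo covariate and the pseudo response, multiplied out: the two factors
`√(K_h(e))` and `1 / √(K_h(e))` cancel, so that the product makes sense
where the kernel vanishes, too. -/
def pseudoXY (K : ℝ → ℝ) (τ h : ℝ) (β x : Vec p) (y : ℝ) : Vec p :=
  (Kh K h (resid β x y) * (x ⬝ᵥ β)) • x - (indNonpos (resid β x y) - τ) • x

theorem pseudoXY_eq (K : ℝ → ℝ) (τ h : ℝ) (β x : Vec p) (y : ℝ)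
    (hK : 0 < Kh K h (resid β x y)) :
    pseudoXY K τ h β x y = pseudoY K τ h β x y • pseudoX K h β x y := by
  have h1 : √(Kh K h (resid β x y)) * √(Kh K h (resid β x y)) = Kh K h (resid β x y) :=
    Real.mul_self_sqrt hK.le
  have h2 : √(Kh K h (resid β x y)) ≠ 0 := (Real.sqrt_pos.2 hK).ne'
  ext j
  simp only [pseudoXY, pseudoY, pseudoX, Pi.sub_apply, Pi.smul_apply, smul_eq_mul,
    smul_dotProduct]
  conv_lhs => rw [← h1]
  field_simp

/-- The indices of the observations on the first (central) machine. -/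
def machineOne (n : ℕ) : Finset (Fin N) := Finset.univ.filter fun i => (i : ℕ) < n

/-- `z_N = N⁻¹ ∑_{i ≤ N} X̃_{i,h} Ỹ_{i,h}`, at the current iterate `β`. -/
def zN (K : ℝ → ℝ) (τ h : ℝ) (x : Fin N → Vec p) (y : Fin N → ℝ) (β : Vec p) : Vec p :=
  (N : ℝ)⁻¹ • ∑ i, pseudoXY K τ h β (x i) (y i)

/-- `D̂_h = N⁻¹ ∑_{i ≤ N} X̃_{i,h} X̃_{i,h}ᵀ`. -/
def Dglobal (K : ℝ → ℝ) (h : ℝ) (x : Fin N → Vec p) (y : Fin N → ℝ) (β : Vec p) :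
    Matrix (Fin (p + 1)) (Fin (p + 1)) ℝ :=
  (N : ℝ)⁻¹ • ∑ i, vecMulVec (pseudoX K h β (x i) (y i)) (pseudoX K h β (x i) (y i))

/-- `D̂_{1,b} = n⁻¹ ∑_{i ∈ M₁} X̃_{i,b} X̃_{i,b}ᵀ`. -/
def Dlocal (K : ℝ → ℝ) (n : ℕ) (b : ℝ) (x : Fin N → Vec p) (y : Fin N → ℝ) (β : Vec p) :
    Matrix (Fin (p + 1)) (Fin (p + 1)) ℝ :=
  (n : ℝ)⁻¹ • ∑ i ∈ machineOne n,
    vecMulVec (pseudoX K b β (x i) (y i)) (pseudoX K b β (x i) (y i))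

/-- The penalized shifted loss, as a function of `θ`, when the current iterate is `β`. -/
def objective (K : ℝ → ℝ) (τ : ℝ) (n : ℕ) (h b lam : ℝ) (x : Fin N → Vec p) (y : Fin N → ℝ)
    (β θ : Vec p) : ℝ :=
  1 / (2 * (n : ℝ)) * ∑ i ∈ machineOne n, (pseudoX K b β (x i) (y i) ⬝ᵥ θ) ^ 2
    - θ ⬝ᵥ (zN K τ h x y β + (Dlocal K n b x y β - Dglobal K h x y β) *ᵥ β)
    + lam * l1 θ

/-- `θ` is an output of one step of the algorithm started from `β`: it minimizes the penalized
shifted loss (no condition in the case where that loss has no minimizer). -/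
def IsStep (K : ℝ → ℝ) (τ : ℝ) (n : ℕ) (h b lam : ℝ) (x : Fin N → Vec p) (y : Fin N → ℝ)
    (β θ : Vec p) : Prop :=
  (∃ θ₀, ∀ θ', objective K τ n h b lam x y β θ₀ ≤ objective K τ n h b lam x y β θ') →
    ∀ θ', objective K τ n h b lam x y β θ ≤ objective K τ n h b lam x y β θ'

end Algorithm

/-! ### Experiments -/

/-- One experiment: `m` machines with `n` observations each, an independent sample of size
`N = m n` from a population, defined on some probability space, and the two bandwidths. -/
structure Experiment.{u} where
  Ω : Type u
  mΩ : MeasurableSpace Ω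
  P : Measure Ω
  isProb : IsProbabilityMeasure P
  (m n p : ℕ)
  pop : Population p
  X : Fin (m * n) → Ω → Vec p
  Y : Fin (m * n) → Ω → ℝ
  measurable_X : ∀ i, Measurable (X i)
  measurable_Y : ∀ i, Measurable (Y i)
  indep : iIndepFun (fun i ω => (X i ω, Y i ω)) P
  law_eq : ∀ i, P.map (fun ω => (X i ω, Y i ω)) = pop.law
  /-- the global bandwidth -/
  h : ℝ
  /-- the local bandwidth -/
  b : ℝ
  h_pos : 0 < h
  b_pos : 0 < b

attribute [instance] Experiment.mΩ Experiment.isProb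

namespace Experiment

variable (E : Experiment)

/-- The total sample size. -/
def N : ℕ := E.m * E.n

/-- `√(log N / N)`. -/
def rate : ℝ := √(Real.log E.N / E.N)

/-- `a_N = √(s log N / n)`. -/
def aN : ℝ := √(E.pop.s * Real.log E.N / E.n)

/-- `κ(a, b, g) = max {s^a (log n / n)^((2g+3)/6), s^b (log N / n)^((g+1)/2)}`. -/
def kappa (a b : ℝ) (g : ℕ) : ℝ :=
  max ((E.pop.s : ℝ) ^ a * (Real.log E.n / E.n) ^ ((2 * (g : ℝ) + 3) / 6))
    ((E.pop.s : ℝ) ^ b * (Real.log E.N / E.n) ^ (((g : ℝ) + 1) / 2))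

/-- `√(log N / N) + κ(5g/6, g, g)`. -/
def rateIter (g : ℕ) : ℝ := E.rate + E.kappa (5 * (g : ℝ) / 6) g g

/-- `‖I_{S×S}⁻¹‖_∞`. -/
def invInfoNorm : ℝ := maxRowSum (blockSS E.pop.Info E.pop.S)⁻¹

/-- The number `t` of iterations satisfies
`t ≥ 3 log(m log(N/m) / log N) / log(N² / (m² s⁵ log²(N/m)))` and
`t ≥ log m / log(N / (m s² log N))`. -/
def EnoughIterations (t : ℕ) : Prop :=
  3 * Real.log (E.m * Real.log ((E.N : ℝ) / E.m) / Real.log E.N) /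
      Real.log ((E.N : ℝ) ^ 2 /
        ((E.m : ℝ) ^ 2 * (E.pop.s : ℝ) ^ 5 * Real.log ((E.N : ℝ) / E.m) ^ 2)) ≤ t ∧
  Real.log E.m / Real.log ((E.N : ℝ) / (E.m * (E.pop.s : ℝ) ^ 2 * Real.log E.N)) ≤ t

/-- `β̂₀, β̂₁, …, β̂_t` are iterates of the algorithm with kernel `K`, quantile level `τ` and
regularization parameters `lam 1, …, lam t`, started from the random vector `β̂₀`. -/
structure IsIterates (K : ℝ → ℝ) (τ : ℝ) (lam : ℕ → ℝ) (t : ℕ) (βhat : ℕ → E.Ω → Vec E.p) :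
    Prop where
  measurable : ∀ g ≤ t, Measurable (βhat g)
  step : ∀ g < t, ∀ ω, IsStep K τ E.n E.h E.b (lam (g + 1)) (fun i => E.X i ω) (fun i => E.Y i ω)
    (βhat g ω) (βhat (g + 1) ω)

end Experiment

/-- The assumptions on a sequence of experiments: the total sample size tends to infinity, the
populations are regular with the same constants, `p = O(N^ν)`, `n ≥ N^c`, `s = O(n^r)`,
`h ≍ (s log N / N)^{1/3}` and `b ≍ (s log n / n)^{1/3}`. -/
structure IsAdmissible (Q : Constants) (E : ℕ → Experiment) : Prop where
  N_tendsto : Tendsto (fun k => (E k).N) atTop atTop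
  regular : ∀ k, (E k).pop.Regular Q
  dim : ∀ᶠ k in atTop, ((E k).p : ℝ) ≤ Q.Cp * ((E k).N : ℝ) ^ Q.ν
  local_size : ∀ᶠ k in atTop, ((E k).N : ℝ) ^ Q.c ≤ (E k).n
  sparsity : ∀ᶠ k in atTop, ((E k).pop.s : ℝ) ≤ Q.Cs * ((E k).n : ℝ) ^ Q.r
  global_bandwidth : ∀ᶠ k in atTop,
    Q.hLo * ((E k).pop.s * Real.log (E k).N / (E k).N) ^ (1 / 3 : ℝ) ≤ (E k).h ∧
    (E k).h ≤ Q.hHi * ((E k).pop.s * Real.log (E k).N / (E k).N) ^ (1 / 3 : ℝ)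
  local_bandwidth : ∀ᶠ k in atTop,
    Q.bLo * ((E k).pop.s * Real.log (E k).n / (E k).n) ^ (1 / 3 : ℝ) ≤ (E k).b ∧
    (E k).b ≤ Q.bHi * ((E k).pop.s * Real.log (E k).n / (E k).n) ^ (1 / 3 : ℝ)

/-- The assumption on the initial estimators: with probability tending to one, the `ℓ₂` error is at
most `M a_N`, and the support is contained in that of `β*`. -/
structure IsGoodStart (Q : Constants) (E : ℕ → Experiment)
    (β₀ : ∀ k, (E k).Ω → Vec (E k).p) : Prop where
  error : Tendsto (fun k => (E k).P {ω | l2 (β₀ k ω - (E k).pop.beta) ≤ Q.M * (E k).aN})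
    atTop (𝓝 1)
  support : Tendsto (fun k => (E k).P {ω | supp (β₀ k ω) ⊆ (E k).pop.S}) atTop (𝓝 1)

end DHSQR

end

/-!
The matrix `D̂_h` cancels in the loss of one iteration (`objective_eq_quadLoss`): the output is the
minimizer of `½ θᵀ D θ - θᵀ (D β - G) + λ |θ|₁`, where `β` is the current iterate, `D = D̂_{1,b}`,
and `G` is the empirical score of the quantile loss at `β`, over the data of all machines. If, in
the sup norm and on vectors supported on `S = supp β*`, `D` is `ρ`-close to `I` and `G` is `q`-close
to `I (β - β*)`, with `ρ |β - β*|₂ + q` at most a small multiple of `λ`, then the primal-dual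
witness construction applies. The minimizer over the vectors supported on `S` satisfies the strict
dual feasibility condition, by the irrepresentable condition, hence it is the only minimizer; its
`ℓ₂` error is `O(√s λ)`, and its error in each coordinate is at most `2 λ ‖I_{S×S}⁻¹‖_∞`
(`primal_dual_witness`, `step_bounds`).

These closeness conditions hold uniformly over all `β` supported on `S` in a ball of radius `O(a_N)`
about `β*`, outside an event of probability `10 / N` (`Experiment.goodSample_prob`), with `ρ = O(b)`
and `q = O(√(log N / N) + |β - β*|₂²)`. The bias is computed from the Lipschitz property of the
conditional density (`Population.kernel_bias`, `Population.score_bias`); the deviations are bounded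
by Bernstein's inequality (`Experiment.empMean_tail_union`) on a grid of mesh `N⁻⁸` in the
coordinate subspace of `S`. The logarithm of the size of the grid is `O(s log N)`. It is compensated
by `n b³ ≍ s log n` for the matrix; for the score, it enters only through the increments from `β*`
to `β`, whose variance is `O(a_N)`, where `s a_N → 0`. Uniformity in `β` makes the dependence
between the iterates and the data harmless.

As `|β - β*|₂ = O(b)`, an error of order `√s rateIter g` calls for `λ` of order `√(log N / N) + b √s
rateIter g`, and this is at most a constant times `rateIter (g + 1)`, because both terms of `κ` are
geometric in `g` (`Experiment.kappa_eq`, `Experiment.AsymptoticScale.b_mul_rateIter_le`). The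
constant does not depend on `g`, so that `C₁` and the function `Φ` depend on the fixed constants
only, and an induction over the iterations gives the support and error bounds
(`Experiment.GoodSample.iterates`). The condition `s = O(n^r)` with `r < 1/3` enters through `s³ log
N / n → 0`, which makes all the required quantities small. Finally, the conditions on the number of
iterations say exactly that `κ ≤ √(log N / N)`, and they hold after `18 / c` iterations
(`Experiment.AsymptoticScale.rateIter_le_rate`, `IsAdmissible.eventually_enoughIterations`).
-/

namespace DHSQR

/-! ### Norms of vectors with a given support -/

section Norms

variable {p : ℕ}

lemma l2_nonneg (v : Vec p) : 0 ≤ l2 v := Real.sqrt_nonneg _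

lemma l2_sq (v : Vec p) : l2 v ^ 2 = v ⬝ᵥ v := by
  unfold l2
  rw [Real.sq_sqrt (Finset.sum_nonneg fun j _ => sq_nonneg _)]
  simp [dotProduct, sq]

lemma abs_le_l2 (v : Vec p) (j : Fin (p + 1)) : |v j| ≤ l2 v := by
  unfold l2
  rw [← Real.sqrt_sq_eq_abs]
  exact Real.sqrt_le_sqrt (Finset.single_le_sum (f := fun j => v j ^ 2)
    (fun _ _ => sq_nonneg _) (Finset.mem_univ j))

lemma l2_eq_norm (v : Vec p) : l2 v = ‖WithLp.toLp 2 v‖ := by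
  simp [l2, EuclideanSpace.norm_eq]

lemma l2_smul (c : ℝ) (v : Vec p) : l2 (c • v) = |c| * l2 v := by
  simp only [l2_eq_norm, WithLp.toLp_smul, norm_smul, Real.norm_eq_abs]

lemma eq_zero_of_l2_eq_zero {v : Vec p} (h : l2 v = 0) : v = 0 := by
  ext j
  have := abs_le_l2 v j
  rw [h] at this
  simpa using le_antisymm this (abs_nonneg _)

lemma l2_single (j : Fin (p + 1)) : l2 (Pi.single j (1 : ℝ) : Vec p) = 1 := by
  simp [l2_eq_norm]

lemma l1_nonneg (v : Vec p) : 0 ≤ l1 v := Finset.sum_nonneg fun _ _ => abs_nonneg _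

lemma l1_add_le (v w : Vec p) : l1 (v + w) ≤ l1 v + l1 w := by
  unfold l1
  rw [← Finset.sum_add_distrib]
  exact Finset.sum_le_sum fun j _ => abs_add_le _ _

lemma l1_smul (c : ℝ) (v : Vec p) : l1 (c • v) = |c| * l1 v := by
  simp [l1, Finset.mul_sum, abs_mul]

lemma supp_subset_iff {v : Vec p} {S : Finset (Fin (p + 1))} :
    supp v ⊆ S ↔ ∀ j ∉ S, v j = 0 := by
  simp only [supp, Finset.subset_iff, Finset.mem_filter, Finset.mem_univ, true_and]
  exact forall_congr' fun j => not_imp_comm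

lemma mem_supp {v : Vec p} {j : Fin (p + 1)} : j ∈ supp v ↔ v j ≠ 0 := by
  simp [supp]

lemma l1_le_sqrt_card_mul_l2 {v : Vec p} {S : Finset (Fin (p + 1))} (hv : ∀ j ∉ S, v j = 0) :
    l1 v ≤ √(S.card : ℝ) * l2 v := by
  have h1 : l1 v = ∑ j ∈ S, |v j| := by
    unfold l1
    exact (Finset.sum_subset (Finset.subset_univ S) fun j _ hj => by simp [hv j hj]).symm
  have h2 : ∑ j ∈ S, |v j| ^ 2 ≤ l2 v ^ 2 := by
    rw [l2_sq, dotProduct]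
    calc ∑ j ∈ S, |v j| ^ 2 ≤ ∑ j, |v j| ^ 2 :=
          Finset.sum_le_sum_of_subset_of_nonneg (Finset.subset_univ S) fun _ _ _ => sq_nonneg _
      _ = _ := by simp [sq]
  rw [h1]
  refine abs_le_of_sq_le_sq' ?_ (mul_nonneg (Real.sqrt_nonneg _) (l2_nonneg v)) |>.2
  rw [mul_pow, Real.sq_sqrt (Nat.cast_nonneg _)]
  exact (sq_sum_le_card_mul_sum_sq).trans (mul_le_mul_of_nonneg_left h2 (Nat.cast_nonneg _))

lemma l2_le_sqrt_card_mul {v : Vec p} {S : Finset (Fin (p + 1))} (hv : ∀ j ∉ S, v j = 0)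
    {c : ℝ} (hc : 0 ≤ c) (h : ∀ j, |v j| ≤ c) : l2 v ≤ √(S.card : ℝ) * c := by
  refine abs_le_of_sq_le_sq' ?_ (mul_nonneg (Real.sqrt_nonneg _) hc) |>.2
  rw [mul_pow, Real.sq_sqrt (Nat.cast_nonneg _), l2_sq, dotProduct,
    ← Finset.sum_subset (Finset.subset_univ S) fun j _ hj => by simp [hv j hj], ← nsmul_eq_mul]
  refine Finset.sum_le_card_nsmul _ _ _ fun j _ => ?_
  rw [← sq, ← sq_abs]
  exact pow_le_pow_left₀ (abs_nonneg _) (h j) 2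

/-- Hölder's inequality on the support of `v`. -/
lemma abs_dotProduct_le {v w : Vec p} {S : Finset (Fin (p + 1))} (hv : ∀ j ∉ S, v j = 0)
    {c : ℝ} (h : ∀ j ∈ S, |w j| ≤ c) : |v ⬝ᵥ w| ≤ c * l1 v := by
  unfold dotProduct l1
  rw [Finset.mul_sum]
  refine (Finset.abs_sum_le_sum_abs _ _).trans (Finset.sum_le_sum fun j _ => ?_)
  by_cases hj : j ∈ S
  · rw [abs_mul, mul_comm]
    exact mul_le_mul_of_nonneg_right (h j hj) (abs_nonneg _)
  · simp [hv j hj]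

end Norms

/-! ### The `ℓ₁`-penalized quadratic loss and the primal-dual witness -/

section Quadratic

variable {p : ℕ}

/-- The penalized quadratic loss `½ θᵀ D θ - θᵀ w + λ |θ|₁`. -/
noncomputable def quadLoss (D : Matrix (Fin (p + 1)) (Fin (p + 1)) ℝ) (w : Vec p) (lam : ℝ)
    (θ : Vec p) : ℝ :=
  1 / 2 * (θ ⬝ᵥ (D *ᵥ θ)) - θ ⬝ᵥ w + lam * l1 θ

variable {D : Matrix (Fin (p + 1)) (Fin (p + 1)) ℝ} {w : Vec p} {lam : ℝ}
  {S : Finset (Fin (p + 1))}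

lemma quadLoss_add (hD : Dᵀ = D) (θ v : Vec p) :
    quadLoss D w lam (θ + v) = quadLoss D w lam θ + v ⬝ᵥ (D *ᵥ θ - w)
      + 1 / 2 * (v ⬝ᵥ (D *ᵥ v)) + lam * (l1 (θ + v) - l1 θ) := by
  have h : θ ⬝ᵥ (D *ᵥ v) = v ⬝ᵥ (D *ᵥ θ) := by
    conv_lhs => rw [dotProduct_mulVec, ← mulVec_transpose, hD, dotProduct_comm]
  unfold quadLoss
  rw [mulVec_add, add_dotProduct, add_dotProduct, dotProduct_add, dotProduct_add, dotProduct_sub,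
    h]
  ring

/-- A minimizer among the vectors supported on `S` exists, because the loss is continuous and, by
the restricted strong convexity `hco`, larger than its value at `0` outside a ball. -/
lemma exists_restricted_minimizer {c : ℝ} (hc : 0 < c) (hlam : 0 ≤ lam)
    (hco : ∀ v : Vec p, (∀ j ∉ S, v j = 0) → c * l2 v ^ 2 ≤ v ⬝ᵥ (D *ᵥ v)) :
    ∃ θ : Vec p, (∀ j ∉ S, θ j = 0) ∧
      ∀ θ' : Vec p, (∀ j ∉ S, θ' j = 0) → quadLoss D w lam θ ≤ quadLoss D w lam θ' := by
  have hcont : Continuous (quadLoss D w lam) := by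
    unfold quadLoss l1
    fun_prop
  have hclosed : IsClosed {θ : Vec p | ∀ j ∉ S, θ j = 0} := by
    simp only [Set.ofPred_forall]
    exact isClosed_iInter fun j => isClosed_iInter fun _ =>
      isClosed_eq (continuous_apply j) continuous_const
  obtain ⟨θ, hθ, hmin⟩ := hcont.continuousOn.exists_isMinOn' (s := {θ : Vec p | ∀ j ∉ S, θ j = 0})
    hclosed (x₀ := 0) (by simp) (by
      have hn : Tendsto (fun x : Vec p => ‖x‖) (cocompact (Vec p)) atTop :=
        tendsto_norm_cocompact_atTop
      set B := √(S.card : ℝ) * ∑ j, |w j|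
      have h0 : quadLoss D w lam (0 : Vec p) = 0 := by simp [quadLoss, l1]
      filter_upwards [(hn.eventually_ge_atTop (2 * B / c)).filter_mono inf_le_left,
        (eventually_principal.2 fun x hx => hx : ∀ᶠ x in 𝓟 {θ : Vec p | ∀ j ∉ S, θ j = 0},
          x ∈ {θ : Vec p | ∀ j ∉ S, θ j = 0}).filter_mono inf_le_right] with x hx hxS
      have hxn : ‖x‖ ≤ l2 x := (pi_norm_le_iff_of_nonneg (l2_nonneg x)).2 fun j => abs_le_l2 x j
      have h1 : |x ⬝ᵥ w| ≤ B * l2 x := by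
        have h2 := abs_dotProduct_le (w := w) (c := ∑ j, |w j|) hxS fun j _ =>
          Finset.single_le_sum (f := fun j => |w j|) (fun j _ => abs_nonneg _) (Finset.mem_univ j)
        refine h2.trans ?_
        calc _ ≤ (∑ j, |w j|) * (√(S.card : ℝ) * l2 x) :=
              mul_le_mul_of_nonneg_left (l1_le_sqrt_card_mul_l2 hxS)
                (Finset.sum_nonneg fun j _ => abs_nonneg _)
          _ = _ := by simp only [B]; ring
      have h3 := hco x hxS
      have h4 : 2 * B ≤ c * l2 x := by
        rw [div_le_iff₀ hc] at hx
        nlinarith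
      have h5 := (abs_le.1 h1).2
      rw [h0]
      unfold quadLoss
      nlinarith [mul_nonneg hlam (l1_nonneg x), l2_nonneg x,
        mul_le_mul_of_nonneg_right h4 (l2_nonneg x)])
  exact ⟨θ, hθ, fun θ' hθ' => hmin hθ'⟩

/-- The variational inequality of a restricted minimizer, from convexity of the `ℓ₁` norm. -/
lemma variation_of_minimizer (hD : Dᵀ = D) (hlam : 0 ≤ lam) {θ : Vec p} (hθ : ∀ j ∉ S, θ j = 0)
    (hmin : ∀ θ' : Vec p, (∀ j ∉ S, θ' j = 0) → quadLoss D w lam θ ≤ quadLoss D w lam θ')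
    {v : Vec p} (hv : ∀ j ∉ S, v j = 0) :
    0 ≤ v ⬝ᵥ (D *ᵥ θ - w) + lam * (l1 (θ + v) - l1 θ) := by
  -- compare `θ` with `θ + t v`, divide by `t` and let `t` tend to zero
  set q := v ⬝ᵥ (D *ᵥ v)
  have key : ∀ t : ℝ, 0 < t → t ≤ 1 →
      0 ≤ v ⬝ᵥ (D *ᵥ θ - w) + lam * (l1 (θ + v) - l1 θ) + t * (1 / 2 * q) := by
    intro t ht ht1
    have h1 := hmin (θ + t • v) fun j hj => by simp [hθ j hj, hv j hj]
    rw [quadLoss_add hD] at h1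
    have h2 : l1 (θ + t • v) ≤ (1 - t) * l1 θ + t * l1 (θ + v) := by
      have : θ + t • v = (1 - t) • θ + t • (θ + v) := by module
      rw [this]
      refine (l1_add_le _ _).trans (le_of_eq ?_)
      rw [l1_smul, l1_smul, abs_of_nonneg (by linarith : 0 ≤ 1 - t), abs_of_pos ht]
    have h3 : (t • v) ⬝ᵥ (D *ᵥ (t • v)) = t ^ 2 * q := by
      simp only [mulVec_smul, smul_dotProduct, dotProduct_smul, smul_eq_mul, q]; ring
    have h4 := mul_le_mul_of_nonneg_left h2 hlam
    rw [h3, smul_dotProduct, smul_eq_mul] at h1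
    refine nonneg_of_mul_nonneg_right (a := t) ?_ ht
    nlinarith
  have hlim : Tendsto (fun t : ℝ => v ⬝ᵥ (D *ᵥ θ - w) + lam * (l1 (θ + v) - l1 θ)
      + t * (1 / 2 * q)) (𝓝[>] 0) (𝓝 (v ⬝ᵥ (D *ᵥ θ - w) + lam * (l1 (θ + v) - l1 θ)
      + 0 * (1 / 2 * q))) :=
    ((continuous_const.add (continuous_id.mul continuous_const)).tendsto 0).mono_left
      nhdsWithin_le_nhds
  rw [zero_mul, add_zero] at hlim
  refine ge_of_tendsto hlim ?_
  filter_upwards [Ioc_mem_nhdsGT (zero_lt_one' ℝ)] with t ht using key t ht.1 ht.2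

/-- The stationarity condition of a restricted minimizer in the coordinates of the support. -/
lemma abs_gradient_le_of_minimizer (hD : Dᵀ = D) (hlam : 0 ≤ lam) {θ : Vec p}
    (hθ : ∀ j ∉ S, θ j = 0)
    (hmin : ∀ θ' : Vec p, (∀ j ∉ S, θ' j = 0) → quadLoss D w lam θ ≤ quadLoss D w lam θ')
    {j : Fin (p + 1)} (hj : j ∈ S) : |(D *ᵥ θ - w) j| ≤ lam := by
  have key : ∀ c : ℝ, |c| = 1 → 0 ≤ c * (D *ᵥ θ - w) j + lam := by
    intro c hc
    have h := variation_of_minimizer (w := w) hD hlam hθ hmin (v := Pi.single j c) fun i hi => by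
      rw [Pi.single_eq_of_ne]; rintro rfl; exact hi hj
    have h1 : l1 (Pi.single j c : Vec p) = 1 := by
      unfold l1
      rw [Finset.sum_eq_single j]
      · simpa using hc
      · intro i _ hi; simp [hi]
      · simp
    rw [single_dotProduct] at h
    nlinarith [l1_add_le θ (Pi.single j c : Vec p)]
  have h1 := key 1 (by simp)
  have h2 := key (-1) (by simp)
  rw [abs_le]
  constructor <;> linarith

/-- Strict dual feasibility of the restricted minimizer: it minimizes the loss over all vectors,
and it is the only minimizer. -/
lemma restricted_minimizer_unique (hD : Dᵀ = D) (hlam : 0 ≤ lam)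
    (hpsd : ∀ v : Vec p, 0 ≤ v ⬝ᵥ (D *ᵥ v))
    {c : ℝ} (hc : 0 < c) (hco : ∀ v : Vec p, (∀ j ∉ S, v j = 0) → c * l2 v ^ 2 ≤ v ⬝ᵥ (D *ᵥ v))
    {θ : Vec p} (hθ : ∀ j ∉ S, θ j = 0)
    (hmin : ∀ θ' : Vec p, (∀ j ∉ S, θ' j = 0) → quadLoss D w lam θ ≤ quadLoss D w lam θ')
    (hdual : ∀ j ∉ S, |(D *ᵥ θ - w) j| < lam) :
    (∀ θ' : Vec p, quadLoss D w lam θ ≤ quadLoss D w lam θ') ∧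
      ∀ θ' : Vec p, quadLoss D w lam θ' ≤ quadLoss D w lam θ → θ' = θ := by
  classical
  set g := D *ᵥ θ - w
  have key : ∀ θ' : Vec p, quadLoss D w lam θ + ∑ j ∈ Sᶜ, (lam - |g j|) * |θ' j|
      + 1 / 2 * ((θ' - θ) ⬝ᵥ (D *ᵥ (θ' - θ))) ≤ quadLoss D w lam θ' := by
    intro θ'
    have h1 := quadLoss_add (w := w) (lam := lam) hD θ (θ' - θ)
    rw [add_sub_cancel] at h1
    let v : Vec p := fun j => if j ∈ S then θ' j - θ j else 0
    have h2 := variation_of_minimizer (w := w) hD hlam hθ hmin (v := v)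
      fun j hj => by simp [v, hj]
    have h3 : l1 θ' = l1 (θ + v) + ∑ j ∈ Sᶜ, |θ' j| := by
      unfold l1
      rw [← Finset.sum_add_sum_compl S fun j => |θ' j|,
        ← Finset.sum_add_sum_compl S fun j => |(θ + v) j|]
      have e1 : ∑ j ∈ S, |θ' j| = ∑ j ∈ S, |(θ + v) j| :=
        Finset.sum_congr rfl fun j hj => by simp [v, hj]
      have e2 : ∑ j ∈ Sᶜ, |(θ + v) j| = 0 :=
        Finset.sum_eq_zero fun j hj => by
          have : j ∉ S := by simpa using hj
          simp [v, this, hθ j this]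
      rw [e1, e2]; ring
    have h4 : (θ' - θ) ⬝ᵥ g = v ⬝ᵥ g + ∑ j ∈ Sᶜ, θ' j * g j := by
      unfold dotProduct
      rw [← Finset.sum_add_sum_compl S fun j => (θ' - θ) j * g j,
        ← Finset.sum_add_sum_compl S fun j => v j * g j]
      have e1 : ∑ j ∈ S, (θ' - θ) j * g j = ∑ j ∈ S, v j * g j :=
        Finset.sum_congr rfl fun j hj => by simp [v, hj]
      have e2 : ∑ j ∈ Sᶜ, v j * g j = 0 :=
        Finset.sum_eq_zero fun j hj => by
          have : j ∉ S := by simpa using hj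
          simp [v, this]
      have e3 : ∑ j ∈ Sᶜ, (θ' - θ) j * g j = ∑ j ∈ Sᶜ, θ' j * g j :=
        Finset.sum_congr rfl fun j hj => by
          have : j ∉ S := by simpa using hj
          simp [hθ j this]
      rw [e1, e2, e3]; ring
    have h5 : ∑ j ∈ Sᶜ, (lam - |g j|) * |θ' j| ≤ ∑ j ∈ Sᶜ, θ' j * g j
        + lam * ∑ j ∈ Sᶜ, |θ' j| := by
      rw [Finset.mul_sum, ← Finset.sum_add_distrib]
      refine Finset.sum_le_sum fun j _ => ?_
      have := neg_abs_le (θ' j * g j)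
      rw [abs_mul] at this
      nlinarith
    rw [h1, h3]
    nlinarith
  have hnn : ∀ θ' : Vec p, ∀ j ∈ Sᶜ, 0 ≤ (lam - |g j|) * |θ' j| := fun θ' j hj =>
    mul_nonneg (sub_nonneg.2 (hdual j (by simpa using hj)).le) (abs_nonneg _)
  refine ⟨fun θ' => ?_, fun θ' hθ' => ?_⟩
  · have := key θ'
    have := Finset.sum_nonneg (hnn θ')
    have := hpsd (θ' - θ)
    linarith
  · have h1 := key θ'
    have h2 := Finset.sum_nonneg (hnn θ')
    have h3 := hpsd (θ' - θ)
    have h4 : ∑ j ∈ Sᶜ, (lam - |g j|) * |θ' j| = 0 := by linarith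
    rw [Finset.sum_eq_zero_iff_of_nonneg (hnn θ')] at h4
    have h5 : ∀ j ∉ S, θ' j = 0 := fun j hj => by
      rcases mul_eq_zero.1 (h4 j (by simpa using hj)) with h | h
      · have := hdual j hj; linarith
      · simpa using h
    have h6 := hco (θ' - θ) fun j hj => by simp [h5 j hj, hθ j hj]
    have h7 : l2 (θ' - θ) = 0 := by
      have : l2 (θ' - θ) ^ 2 ≤ 0 := by nlinarith
      exact pow_eq_zero_iff two_ne_zero |>.1 (le_antisymm this (sq_nonneg _))
    exact sub_eq_zero.1 (eq_zero_of_l2_eq_zero h7)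

end Quadratic

section Blocks

variable {p : ℕ} {A : Matrix (Fin (p + 1)) (Fin (p + 1)) ℝ} {S : Finset (Fin (p + 1))}

lemma row_sum_le_maxRowSum {ι κ : Type*} [Finite ι] [Fintype κ] (B : Matrix ι κ ℝ) (i : ι) :
    ∑ j, |B i j| ≤ maxRowSum B :=
  le_ciSup (f := fun i => ∑ j, |B i j|) (Set.finite_range _).bddAbove i

lemma maxRowSum_nonneg {ι κ : Type*} [Fintype κ] (B : Matrix ι κ ℝ) : 0 ≤ maxRowSum B :=
  Real.iSup_nonneg fun _ => Finset.sum_nonneg fun _ _ => abs_nonneg _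

lemma abs_mulVec_le_maxRowSum {ι κ : Type*} [Finite ι] [Fintype κ] (B : Matrix ι κ ℝ) (u : κ → ℝ)
    {c : ℝ} (hc : 0 ≤ c) (hu : ∀ j, |u j| ≤ c) (i : ι) : |(B *ᵥ u) i| ≤ maxRowSum B * c := by
  calc |(B *ᵥ u) i| ≤ ∑ j, |B i j * u j| := Finset.abs_sum_le_sum_abs _ _
    _ ≤ ∑ j, |B i j| * c := Finset.sum_le_sum fun j _ => by
        rw [abs_mul]; exact mul_le_mul_of_nonneg_left (hu j) (abs_nonneg _)
    _ ≤ _ := by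
        rw [← Finset.sum_mul]
        exact mul_le_mul_of_nonneg_right (row_sum_le_maxRowSum B i) hc

lemma mulVec_restrict {v : Vec p} (hv : ∀ j ∉ S, v j = 0) (i : Fin (p + 1)) :
    (A *ᵥ v) i = ∑ j : {j // j ∈ S}, A i j.1 * v j.1 := by
  rw [mulVec, dotProduct, ← Finset.sum_subset (Finset.subset_univ S) fun j _ hj => by
    simp [hv j hj]]
  exact (Finset.sum_coe_sort S fun j => A i j * v j).symm

lemma isUnit_det_blockSS {c : ℝ} (hc : 0 < c) (hA : ∀ v : Vec p, c * (v ⬝ᵥ v) ≤ v ⬝ᵥ (A *ᵥ v)) :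
    IsUnit (blockSS A S).det := by
  classical
  rw [← Matrix.isUnit_iff_isUnit_det, ← Matrix.mulVec_injective_iff_isUnit]
  intro u₁ u₂ h
  rw [← sub_eq_zero]
  have h0 : blockSS A S *ᵥ (u₁ - u₂) = 0 := by rw [mulVec_sub]; exact sub_eq_zero.2 h
  set u := u₁ - u₂
  let v : Vec p := fun j => if hj : j ∈ S then u ⟨j, hj⟩ else 0
  have hv : ∀ j ∉ S, v j = 0 := fun j hj => by simp [v, hj]
  have h1 : ∀ i ∈ S, (A *ᵥ v) i = 0 := fun i hi => by
    rw [mulVec_restrict hv]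
    have := congrFun h0 ⟨i, hi⟩
    simp only [mulVec, dotProduct, blockSS, submatrix_apply, Pi.zero_apply] at this
    rw [← this]
    exact Finset.sum_congr rfl fun j _ => by simp [v, j.2]
  have h2 : v ⬝ᵥ (A *ᵥ v) = 0 := Finset.sum_eq_zero fun j _ => by
    by_cases hj : j ∈ S
    · simp [h1 j hj]
    · simp [hv j hj]
  have h3 := hA v
  rw [h2, ← l2_sq] at h3
  have h4 : l2 v = 0 := by
    have : l2 v ^ 2 ≤ 0 := by nlinarith
    exact pow_eq_zero_iff two_ne_zero |>.1 (le_antisymm this (sq_nonneg _))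
  ext j
  have := congrFun (eq_zero_of_l2_eq_zero h4) j.1
  simpa [v, j.2] using this

lemma blockSS_mulVec {v : Vec p} (hv : ∀ j ∉ S, v j = 0) (i : {j // j ∈ S}) :
    (blockSS A S *ᵥ fun j => v j.1) i = (A *ᵥ v) i.1 := by
  rw [mulVec_restrict hv]; rfl

/-- A vector supported on `S` is recovered from the `S`-coordinates of its image. -/
lemma abs_apply_le_of_blockSS (hdet : IsUnit (blockSS A S).det) {v : Vec p}
    (hv : ∀ j ∉ S, v j = 0) {c : ℝ} (hc : 0 ≤ c) (h : ∀ i ∈ S, |(A *ᵥ v) i| ≤ c)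
    {j : Fin (p + 1)} (hj : j ∈ S) : |v j| ≤ maxRowSum (blockSS A S)⁻¹ * c := by
  have h1 : (fun j : {j // j ∈ S} => v j.1) =
      (blockSS A S)⁻¹ *ᵥ (blockSS A S *ᵥ fun j => v j.1) := by
    rw [mulVec_mulVec, nonsing_inv_mul _ hdet, one_mulVec]
  have h2 : v j = _ := congrFun h1 ⟨j, hj⟩
  rw [h2]
  exact abs_mulVec_le_maxRowSum _ _ hc (fun i => by
    rw [blockSS_mulVec hv]; exact h i.1 i.2) _

/-- The irrepresentable matrix transfers a bound on the `S`-coordinates of `A v` to the others. -/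
lemma abs_mulVec_compl_le (hdet : IsUnit (blockSS A S).det) {v : Vec p}
    (hv : ∀ j ∉ S, v j = 0) {c : ℝ} (hc : 0 ≤ c) (h : ∀ i ∈ S, |(A *ᵥ v) i| ≤ c)
    {j : Fin (p + 1)} (hj : j ∉ S) :
    |(A *ᵥ v) j| ≤ maxRowSum (blockScS A S * (blockSS A S)⁻¹) * c := by
  have h1 : (blockScS A S *ᵥ fun j => v j.1) =
      (blockScS A S * (blockSS A S)⁻¹) *ᵥ (blockSS A S *ᵥ fun j => v j.1) := by
    rw [mulVec_mulVec, Matrix.mul_assoc, nonsing_inv_mul _ hdet, Matrix.mul_one]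
  have h2 : (A *ᵥ v) j = (blockScS A S *ᵥ fun j => v j.1) ⟨j, hj⟩ := by
    rw [mulVec_restrict hv]; rfl
  rw [h2, h1]
  exact abs_mulVec_le_maxRowSum _ _ hc (fun i => by
    rw [blockSS_mulVec hv]; exact h i.1 i.2) _

end Blocks

/-- The primal-dual witness. `A` is the population matrix, `D` the empirical one, `G` the empirical
score at the current iterate `β`, and `D β - G` the linear coefficient of the shifted loss. -/
lemma primal_dual_witness {p : ℕ} {A D : Matrix (Fin (p + 1)) (Fin (p + 1)) ℝ}
    {S : Finset (Fin (p + 1))} {βs β G : Vec p} {cmin α ρ q lam : ℝ}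
    (hcmin : 0 < cmin) (hA : ∀ v : Vec p, cmin * (v ⬝ᵥ v) ≤ v ⬝ᵥ (A *ᵥ v))
    (hα : 0 < α) (hα1 : α < 1)
    (hirr : maxRowSum (blockScS A S * (blockSS A S)⁻¹) ≤ 1 - α)
    (hD : Dᵀ = D) (hpsd : ∀ v : Vec p, 0 ≤ v ⬝ᵥ (D *ᵥ v)) (hlam : 0 < lam) (hρ0 : 0 ≤ ρ)
    (hβs : ∀ j ∉ S, βs j = 0) (hβ : ∀ j ∉ S, β j = 0)
    (hρ : ∀ v : Vec p, (∀ j ∉ S, v j = 0) → ∀ j, |(D *ᵥ v) j - (A *ᵥ v) j| ≤ ρ * l2 v)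
    (hq : ∀ j, |G j - (A *ᵥ (β - βs)) j| ≤ q)
    (hlam1 : ρ * l2 (β - βs) + q ≤ α / 8 * lam)
    (hs1 : √(S.card : ℝ) * ρ ≤ cmin / 2) (hs2 : √(S.card : ℝ) * ρ * (4 / cmin) ≤ α / 8) :
    ∃ θ : Vec p, (∀ θ', quadLoss D (D *ᵥ β - G) lam θ ≤ quadLoss D (D *ᵥ β - G) lam θ') ∧
      (∀ θ', quadLoss D (D *ᵥ β - G) lam θ' ≤ quadLoss D (D *ᵥ β - G) lam θ → θ' = θ) ∧
      (∀ j ∉ S, θ j = 0) ∧ l2 (θ - βs) ≤ 4 / cmin * √(S.card : ℝ) * lam ∧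
      ∀ j ∈ S, |θ j - βs j| ≤ maxRowSum (blockSS A S)⁻¹ * (2 * lam) := by
  -- restricted strong convexity is inherited from `A`, since `|vᵀ(D - A)v| ≤ √s ρ |v|₂²`
  have hco : ∀ v : Vec p, (∀ j ∉ S, v j = 0) → cmin / 2 * l2 v ^ 2 ≤ v ⬝ᵥ (D *ᵥ v) := by
    intro v hv
    have h1 := hA v
    rw [← l2_sq] at h1
    have h2 := abs_dotProduct_le (w := D *ᵥ v - A *ᵥ v) hv fun j _ => hρ v hv j
    rw [dotProduct_sub] at h2
    have h3 : ρ * l2 v * l1 v ≤ cmin / 2 * l2 v ^ 2 := by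
      calc ρ * l2 v * l1 v ≤ ρ * l2 v * (√(S.card : ℝ) * l2 v) :=
            mul_le_mul_of_nonneg_left (l1_le_sqrt_card_mul_l2 hv) (mul_nonneg hρ0 (l2_nonneg v))
        _ = √(S.card : ℝ) * ρ * l2 v ^ 2 := by ring
        _ ≤ _ := mul_le_mul_of_nonneg_right hs1 (sq_nonneg _)
    have h4 := (abs_le.1 h2).1
    linarith
  set w := D *ᵥ β - G
  obtain ⟨θ, hθ, hmin⟩ := exists_restricted_minimizer (w := w) (half_pos hcmin) hlam.le hco
  have hg := fun j (hj : j ∈ S) => abs_gradient_le_of_minimizer (w := w) hD hlam.le hθ hmin hj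
  set δ := θ - βs
  have hδ : ∀ j ∉ S, δ j = 0 := fun j hj => by simp [δ, hθ j hj, hβs j hj]
  have hq0 : 0 ≤ q := (abs_nonneg _).trans (hq 0)
  -- `D δ` differs from the gradient `D θ - w` by `(D - A)(β - β*)` and the error of the score
  have hR : ∀ j, |(D *ᵥ δ) j - (D *ᵥ θ - w) j| ≤ α / 8 * lam := by
    intro j
    have e : (D *ᵥ δ) j - (D *ᵥ θ - w) j =
        ((D *ᵥ (β - βs)) j - (A *ᵥ (β - βs)) j) - (G j - (A *ᵥ (β - βs)) j) := by
      simp only [δ, w, mulVec_sub, Pi.sub_apply]; ring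
    rw [e]
    have h1 := hρ (β - βs) (fun j hj => by simp [hβ j hj, hβs j hj]) j
    have h2 := hq j
    exact (abs_sub _ _).trans (by linarith)
  have hl2 : l2 δ ≤ 4 / cmin * √(S.card : ℝ) * lam := by
    have h1 : δ ⬝ᵥ (D *ᵥ δ) ≤ 2 * lam * (√(S.card : ℝ) * l2 δ) := by
      have h2 : ∀ j ∈ S, |(D *ᵥ δ) j| ≤ 2 * lam := fun j hj => by
        have := hR j
        have := hg j hj
        have e : (D *ᵥ δ) j = ((D *ᵥ δ) j - (D *ᵥ θ - w) j) + (D *ᵥ θ - w) j := by ring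
        rw [e]
        refine (abs_add_le _ _).trans ?_
        nlinarith
      have h3 := (le_abs_self _).trans (abs_dotProduct_le hδ h2)
      exact h3.trans (mul_le_mul_of_nonneg_left (l1_le_sqrt_card_mul_l2 hδ) (by linarith))
    have h2 := (hco δ hδ).trans h1
    rcases (l2_nonneg δ).eq_or_lt with h0 | h0
    · rw [← h0]; positivity
    · have h3 : cmin / 2 * l2 δ ≤ 2 * lam * √(S.card : ℝ) := by
        refine le_of_mul_le_mul_right ?_ h0
        nlinarith
      rw [show 4 / cmin * √(S.card : ℝ) * lam = (2 * lam * √(S.card : ℝ)) / (cmin / 2) by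
        field_simp; ring, le_div_iff₀ (half_pos hcmin)]
      linarith
  have hρδ : ρ * l2 δ ≤ α / 8 * lam := by
    calc ρ * l2 δ ≤ ρ * (4 / cmin * √(S.card : ℝ) * lam) := mul_le_mul_of_nonneg_left hl2 hρ0
      _ = (√(S.card : ℝ) * ρ * (4 / cmin)) * lam := by ring
      _ ≤ _ := mul_le_mul_of_nonneg_right hs2 hlam.le
  have hdet := isUnit_det_blockSS (S := S) hcmin hA
  have hAS : ∀ j ∈ S, |(A *ᵥ δ) j| ≤ (1 + α / 4) * lam := fun j hj => by
    have h1 := hR j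
    have h2 := hg j hj
    have h3 := hρ δ hδ j
    have e : (A *ᵥ δ) j = ((D *ᵥ δ) j - (D *ᵥ θ - w) j) + (D *ᵥ θ - w) j
      - ((D *ᵥ δ) j - (A *ᵥ δ) j) := by ring
    rw [e]
    refine (abs_sub _ _).trans ((add_le_add_left (abs_add_le _ _) _).trans ?_)
    linarith
  -- strict dual feasibility: `(1 - α)(1 + α/4) + α/4 < 1`
  have hdual : ∀ j ∉ S, |(D *ᵥ θ - w) j| < lam := fun j hj => by
    have h1 := hR j
    have h3 := hρ δ hδ j
    have h4 := abs_mulVec_compl_le hdet hδ (by positivity) hAS hj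
    have h5 : maxRowSum (blockScS A S * (blockSS A S)⁻¹) * ((1 + α / 4) * lam)
        ≤ (1 - α) * ((1 + α / 4) * lam) := mul_le_mul_of_nonneg_right hirr (by positivity)
    have e : (D *ᵥ θ - w) j = (A *ᵥ δ) j + ((D *ᵥ δ) j - (A *ᵥ δ) j)
      - ((D *ᵥ δ) j - (D *ᵥ θ - w) j) := by ring
    rw [e]
    refine ((abs_sub _ _).trans (add_le_add_left (abs_add_le _ _) _)).trans_lt ?_
    nlinarith [mul_pos hα hlam]
  obtain ⟨hglob, huniq⟩ := restricted_minimizer_unique (w := w) hD hlam.le hpsd (half_pos hcmin)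
    hco hθ hmin hdual
  refine ⟨θ, hglob, huniq, hθ, hl2, fun j hj => ?_⟩
  exact abs_apply_le_of_blockSS hdet hδ (by positivity)
    (fun i hi => (hAS i hi).trans (by nlinarith)) hj

/-! ### One step of the algorithm as a penalized quadratic problem -/

section Step

variable {p N : ℕ} {K : ℝ → ℝ}

/-- The empirical score `N⁻¹ ∑ (1(e_i ≤ 0) - τ) x_i` of the quantile loss. -/
noncomputable def score (τ : ℝ) (x : Fin N → Vec p) (y : Fin N → ℝ) (β : Vec p) : Vec p :=
  (N : ℝ)⁻¹ • ∑ i, (indNonpos (resid β (x i) (y i)) - τ) • x i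

lemma vecMulVec_pseudoX (hK : ∀ u, 0 ≤ K u) {h : ℝ} (hh : 0 < h) (β x : Vec p) (y : ℝ) :
    vecMulVec (pseudoX K h β x y) (pseudoX K h β x y) =
      Kh K h (resid β x y) • vecMulVec x x := by
  have h0 : 0 ≤ Kh K h (resid β x y) := div_nonneg (hK _) hh.le
  rw [pseudoX, smul_vecMulVec, vecMulVec_smul, smul_smul, Real.mul_self_sqrt h0]

lemma Dlocal_mulVec_apply (hK : ∀ u, 0 ≤ K u) {b : ℝ} (hb : 0 < b) (n : ℕ) (x : Fin N → Vec p)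
    (y : Fin N → ℝ) (β v : Vec p) (j : Fin (p + 1)) :
    (Dlocal K n b x y β *ᵥ v) j = (n : ℝ)⁻¹ * ∑ i ∈ machineOne n,
      Kh K b (resid β (x i) (y i)) * (x i j * (x i ⬝ᵥ v)) := by
  simp only [Dlocal, vecMulVec_pseudoX hK hb, smul_mulVec, Pi.smul_apply, smul_eq_mul, sum_mulVec,
    Finset.sum_apply, vecMulVec_mulVec, MulOpposite.smul_eq_mul_unop, MulOpposite.unop_op]

lemma Dlocal_transpose (n : ℕ) (b : ℝ) (x : Fin N → Vec p) (y : Fin N → ℝ) (β : Vec p) :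
    (Dlocal K n b x y β)ᵀ = Dlocal K n b x y β := by
  simp only [Dlocal, transpose_smul, transpose_sum, transpose_vecMulVec]

lemma dotProduct_Dlocal (n : ℕ) (b : ℝ) (x : Fin N → Vec p) (y : Fin N → ℝ) (β v : Vec p) :
    v ⬝ᵥ (Dlocal K n b x y β *ᵥ v) =
      (n : ℝ)⁻¹ * ∑ i ∈ machineOne n, (pseudoX K b β (x i) (y i) ⬝ᵥ v) ^ 2 := by
  simp only [Dlocal, smul_mulVec, dotProduct_smul, smul_eq_mul, sum_mulVec, dotProduct_sum,
    vecMulVec_mulVec]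
  congr 1
  refine Finset.sum_congr rfl fun i _ => ?_
  simp [sq, dotProduct_comm v]

lemma zN_eq (hK : ∀ u, 0 ≤ K u) (τ : ℝ) {h : ℝ} (hh : 0 < h) (x : Fin N → Vec p)
    (y : Fin N → ℝ) (β : Vec p) :
    zN K τ h x y β = Dglobal K h x y β *ᵥ β - score τ x y β := by
  ext j
  simp only [zN, Dglobal, score, pseudoXY, vecMulVec_pseudoX hK hh, smul_mulVec, sum_mulVec,
    Pi.smul_apply, Pi.sub_apply, Finset.sum_apply, smul_eq_mul, vecMulVec_mulVec,
    MulOpposite.smul_eq_mul_unop, MulOpposite.unop_op, Finset.sum_sub_distrib, mul_sub]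
  congr 2
  exact Finset.sum_congr rfl fun i _ => by ring

/-- The matrix `D̂_h` cancels: the shifted loss depends on the data of all machines through the
score only. -/
lemma objective_eq_quadLoss (hK : ∀ u, 0 ≤ K u) (τ : ℝ) (n : ℕ) {h : ℝ} (hh : 0 < h) (b lam : ℝ)
    (x : Fin N → Vec p) (y : Fin N → ℝ) (β θ : Vec p) :
    objective K τ n h b lam x y β θ = quadLoss (Dlocal K n b x y β)
      (Dlocal K n b x y β *ᵥ β - score τ x y β) lam θ := by
  unfold objective quadLoss
  rw [dotProduct_Dlocal, zN_eq hK τ hh, sub_mulVec]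
  congr 2
  · rw [one_div, mul_inv, one_div]; ring
  · congr 1; abel

/-- One step of the algorithm, on data where the local matrix `D̂_{1,b}` and the score behave
as in the population: support, `ℓ₂` error and coordinatewise error of the new iterate. -/
lemma step_bounds (hK : ∀ u, 0 ≤ K u) {τ : ℝ} {n : ℕ} {h b lam : ℝ} (hh : 0 < h)
    {x : Fin N → Vec p} {y : Fin N → ℝ} {β θ : Vec p}
    (hstep : IsStep K τ n h b lam x y β θ)
    {A : Matrix (Fin (p + 1)) (Fin (p + 1)) ℝ}
    {S : Finset (Fin (p + 1))} {βs : Vec p} {cmin α ρ q : ℝ}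
    (hcmin : 0 < cmin) (hA : ∀ v : Vec p, cmin * (v ⬝ᵥ v) ≤ v ⬝ᵥ (A *ᵥ v))
    (hα : 0 < α) (hα1 : α < 1)
    (hirr : maxRowSum (blockScS A S * (blockSS A S)⁻¹) ≤ 1 - α)
    (hlam : 0 < lam) (hρ0 : 0 ≤ ρ)
    (hβs : ∀ j ∉ S, βs j = 0) (hβ : ∀ j ∉ S, β j = 0)
    (hρ : ∀ v : Vec p, (∀ j ∉ S, v j = 0) → ∀ j,
      |(Dlocal K n b x y β *ᵥ v) j - (A *ᵥ v) j| ≤ ρ * l2 v)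
    (hq : ∀ j, |score τ x y β j - (A *ᵥ (β - βs)) j| ≤ q)
    (hlam1 : ρ * l2 (β - βs) + q ≤ α / 8 * lam)
    (hs1 : √(S.card : ℝ) * ρ ≤ cmin / 2) (hs2 : √(S.card : ℝ) * ρ * (4 / cmin) ≤ α / 8) :
    (∀ j ∉ S, θ j = 0) ∧ l2 (θ - βs) ≤ 4 / cmin * √(S.card : ℝ) * lam ∧
      ∀ j ∈ S, |θ j - βs j| ≤ maxRowSum (blockSS A S)⁻¹ * (2 * lam) := by
  obtain ⟨θ₀, h1, h2, h3⟩ := primal_dual_witness hcmin hA hα hα1 hirr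
    (Dlocal_transpose n b x y β) (fun v => by rw [dotProduct_Dlocal]; positivity)
    hlam hρ0 hβs hβ hρ hq hlam1 hs1 hs2
  unfold IsStep at hstep
  simp only [objective_eq_quadLoss hK τ n hh] at hstep
  -- the minimizer is unique, hence equal to the output of the step
  have := h2 θ (hstep ⟨θ₀, h1⟩ θ₀)
  rw [this]
  exact h3

end Step

end DHSQR

namespace DHSQR

/-! ### The law of an observation -/

/-- A bound for the conditional densities: a density that is `l₀`-Lipschitz is at most
`1 + l₀`, since it stays above its value minus `l₀` on an interval of length one. -/
noncomputable def densBound (Q : Constants) : ℝ := 1 + max Q.l₀ 0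

lemma one_le_densBound (Q : Constants) : 1 ≤ densBound Q := by
  unfold densBound; linarith [le_max_right Q.l₀ 0]

lemma le_of_lipschitz_of_lintegral_le_one {g : ℝ → ℝ} {l : ℝ}
    (hl : ∀ u v, |g u - g v| ≤ l * |u - v|) (h1 : ∫⁻ u, ENNReal.ofReal (g u) ≤ 1) (u : ℝ) :
    g u ≤ 1 + max l 0 := by
  by_contra! hlt
  have h2 : ∀ v ∈ Set.Icc u (u + 1), g u - max l 0 ≤ g v := by
    intro v hv
    have h3 := (abs_le.1 (hl u v)).2
    have h4 : |u - v| ≤ 1 := by rw [abs_le]; constructor <;> linarith [hv.1, hv.2]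
    have h5 : l * |u - v| ≤ max l 0 * 1 :=
      mul_le_mul (le_max_left _ _) h4 (abs_nonneg _) (le_max_right _ _)
    linarith
  have h6 : ENNReal.ofReal (g u - max l 0) ≤ 1 := by
    calc ENNReal.ofReal (g u - max l 0)
        = ∫⁻ _ in Set.Icc u (u + 1), ENNReal.ofReal (g u - max l 0) := by simp
      _ ≤ ∫⁻ v in Set.Icc u (u + 1), ENNReal.ofReal (g v) :=
          setLIntegral_mono' measurableSet_Icc fun v hv => ENNReal.ofReal_le_ofReal (h2 v hv)
      _ ≤ ∫⁻ v, ENNReal.ofReal (g v) := setLIntegral_le_lintegral _ _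
      _ ≤ 1 := h1
  rw [ENNReal.ofReal_le_one] at h6
  linarith

namespace Population

variable {p : ℕ} {D : Population p} {Q : Constants}

lemma ae_law_of_ae_fst {P : Vec p → Prop} (h : ∀ᵐ x ∂D.law.fst, P x) : ∀ᵐ z ∂D.law, P z.1 :=
  ae_of_ae_map measurable_fst.aemeasurable h

lemma measurable_dens (hD : D.Regular Q) (x : Vec p) (c : ℝ) :
    Measurable fun y => D.dens x (y - c) := by
  have := hD.dens_measurable.comp
    (measurable_const.prodMk (measurable_id.sub_const c) : Measurable fun y : ℝ => (x, y - c))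
  exact this

lemma dens_le (hD : D.Regular Q) : ∀ᵐ x ∂D.law.fst, ∀ u, D.dens x u ≤ densBound Q := by
  filter_upwards [hD.dens_spec, hD.dens_lipschitz] with x h1 h2
  refine le_of_lipschitz_of_lintegral_le_one h2 (le_of_eq ?_)
  have h3 : D.law.condKernel x Set.univ = 1 := measure_univ
  rw [h1, withDensity_apply _ MeasurableSet.univ, Measure.restrict_univ,
    lintegral_sub_right_eq_self (fun u => ENNReal.ofReal (D.dens x u))] at h3
  exact h3

/-- The bound on the conditional densities, integrated over the covariate. -/
lemma lintegral_law_le (hD : D.Regular Q) {F : Vec p × ℝ → ENNReal} (hF : Measurable F) :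
    ∫⁻ z, F z ∂D.law ≤
      ENNReal.ofReal (densBound Q) * ∫⁻ z, (∫⁻ y, F (z.1, y)) ∂D.law := by
  have hm : Measurable fun x => ∫⁻ y, F (x, y) := hF.lintegral_prod_right'
  rw [← lintegral_map (f := fun x => ∫⁻ y, F (x, y)) hm measurable_fst,
    ← Measure.lintegral_condKernel hF, ← lintegral_const_mul _ hm]
  change _ ≤ ∫⁻ x, _ ∂D.law.fst
  refine lintegral_mono_ae ?_
  filter_upwards [hD.dens_spec, dens_le hD] with x h1 h2
  have hFx : Measurable fun y => F (x, y) := hF.comp measurable_prodMk_left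
  rw [h1, lintegral_withDensity_eq_lintegral_mul _ (measurable_dens hD x _).ennreal_ofReal hFx,
    ← lintegral_const_mul _ hFx]
  exact lintegral_mono fun y => by
    simp only [Pi.mul_apply]
    gcongr
    exact h2 _

/-- The law is dominated by `densBound Q` times (law of the covariate) × (Lebesgue measure). -/
lemma integrable_and_integral_le (hD : D.Regular Q) {k : Vec p × ℝ → ℝ} {W : Vec p → ℝ}
    (hk : Measurable k) (hk0 : ∀ z, 0 ≤ k z) (hW0 : ∀ x, 0 ≤ W x)
    (hkW : ∀ x, ∫⁻ y, ENNReal.ofReal (k (x, y)) ≤ ENNReal.ofReal (W x))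
    (hW : Integrable (fun z : Vec p × ℝ => W z.1) D.law) :
    Integrable k D.law ∧ ∫ z, k z ∂D.law ≤ densBound Q * ∫ z, W z.1 ∂D.law := by
  have hB : 0 ≤ densBound Q := zero_le_one.trans (one_le_densBound Q)
  have h1 : ∫⁻ z, ENNReal.ofReal (k z) ∂D.law ≤
      ENNReal.ofReal (densBound Q * ∫ z, W z.1 ∂D.law) := by
    rw [ENNReal.ofReal_mul hB, ofReal_integral_eq_lintegral_ofReal hW (ae_of_all _ fun z => hW0 _)]
    refine (lintegral_law_le hD hk.ennreal_ofReal).trans ?_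
    gcongr with z
    exact hkW z.1
  have h2 : Integrable k D.law :=
    ⟨hk.aestronglyMeasurable, (hasFiniteIntegral_iff_ofReal (ae_of_all _ hk0)).2
      (h1.trans_lt ENNReal.ofReal_lt_top)⟩
  refine ⟨h2, ?_⟩
  rw [← ofReal_integral_eq_lintegral_ofReal h2 (ae_of_all _ hk0)] at h1
  exact (ENNReal.ofReal_le_ofReal_iff (mul_nonneg hB (integral_nonneg fun z => hW0 _))).1 h1

/-- Comparison of an expectation with the expectation in which the factor `k(x, y)` has been
replaced by an approximation `g(x)` of its conditional mean. -/
lemma abs_integral_sub_integral_le {k : Vec p × ℝ → ℝ} {w g e : Vec p → ℝ}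
    (hkw : Integrable (fun z => k z * w z.1) D.law)
    (hgw : Integrable (fun z => g z.1 * w z.1) D.law)
    (he : Integrable (fun z => e z.1 * |w z.1|) D.law)
    (he_meas : Measurable fun x => e x * |w x|) (hg_meas : Measurable fun x => g x * w x)
    (h : ∀ᵐ x ∂D.law.fst, |∫ y, k (x, y) ∂D.law.condKernel x - g x| ≤ e x) :
    |∫ z, k z * w z.1 ∂D.law - ∫ z, g z.1 * w z.1 ∂D.law| ≤ ∫ z, e z.1 * |w z.1| ∂D.law := by
  have hmap : ∀ F : Vec p → ℝ, Measurable F → ∫ z, F z.1 ∂D.law = ∫ x, F x ∂D.law.fst :=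
    fun F hF => (integral_map measurable_fst.aemeasurable hF.aestronglyMeasurable).symm
  have hint : ∀ F : Vec p → ℝ, Measurable F → Integrable (fun z => F z.1) D.law →
      Integrable F D.law.fst := fun F hF hFi =>
    (integrable_map_measure hF.aestronglyMeasurable measurable_fst.aemeasurable).2 hFi
  have h1 : Integrable (fun x => ∫ y, k (x, y) * w x ∂D.law.condKernel x) D.law.fst := by
    have h2 := hkw
    rw [← D.law.disintegrate D.law.condKernel] at h2
    exact h2.integral_compProd
  rw [← Measure.integral_condKernel hkw, hmap _ hg_meas, hmap _ he_meas,
    ← integral_sub h1 (hint _ hg_meas hgw)]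
  refine (abs_integral_le_integral_abs).trans (integral_mono_ae
    (h1.sub (hint _ hg_meas hgw)).abs (hint _ he_meas he) ?_)
  filter_upwards [h] with x hx
  simp only [integral_mul_const]
  rw [← sub_mul, abs_mul]
  exact mul_le_mul_of_nonneg_right hx (abs_nonneg _)

/-! ### Moments of the covariates -/

/-- The rate `A` in the bound `E exp(A (xᵀu)²) ≤ 3`, for `|u|₂ ≤ 1`. -/
noncomputable def _root_.DHSQR.expRate (Q : Constants) : ℝ := Q.f₁ / (4 * Q.c₁ ^ 2 * Q.lamHi)

lemma _root_.DHSQR.expRate_pos (Q : Constants) : 0 < expRate Q :=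
  div_pos Q.f₁_pos (mul_pos (mul_pos four_pos (pow_pos Q.c₁_pos 2)) Q.lamHi_pos)

lemma integrable_mul (hD : D.Regular Q) (i j : Fin (p + 1)) :
    Integrable (fun z : Vec p × ℝ => z.1 i * z.1 j) D.law := by
  refine ((hD.second_moment i).add (hD.second_moment j)).mono'
    (by fun_prop) (ae_of_all _ fun z => ?_)
  simp only [Pi.add_apply, Real.norm_eq_abs, abs_mul]
  nlinarith [sq_nonneg (|z.1 i| - |z.1 j|), sq_abs (z.1 i), sq_abs (z.1 j), sq_nonneg (z.1 i),
    sq_nonneg (z.1 j)]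

lemma measurable_dens_zero (hD : D.Regular Q) : Measurable fun x => D.dens x 0 :=
  hD.dens_measurable.comp (measurable_id.prodMk measurable_const)

lemma integrable_dens_mul (hD : D.Regular Q) (i j : Fin (p + 1)) :
    Integrable (fun z : Vec p × ℝ => D.dens z.1 0 * (z.1 i * z.1 j)) D.law := by
  refine (integrable_mul hD i j).bdd_mul (c := Q.f₂)
    ((measurable_dens_zero hD).comp measurable_fst).aestronglyMeasurable ?_
  filter_upwards [ae_law_of_ae_fst hD.dens_zero] with z hz
  rw [Real.norm_eq_abs, abs_of_nonneg (hD.dens_nonneg _ _)]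
  exact hz.2

lemma dotProduct_eq_sum_mul (v x : Vec p) (w : ℝ) (j : Fin (p + 1)) :
    w * (x j * (x ⬝ᵥ v)) = ∑ k, w * (x j * x k) * v k := by
  rw [dotProduct, Finset.mul_sum, Finset.mul_sum]
  exact Finset.sum_congr rfl fun k _ => by ring

lemma Info_mulVec (hD : D.Regular Q) (v : Vec p) (j : Fin (p + 1)) :
    (D.Info *ᵥ v) j = ∫ z, D.dens z.1 0 * (z.1 j * (z.1 ⬝ᵥ v)) ∂D.law := by
  simp only [dotProduct_eq_sum_mul]
  rw [integral_finsetSum _ fun k _ => (integrable_dens_mul hD j k).mul_const _]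
  simp only [mulVec, dotProduct, Info, of_apply, integral_mul_const]

lemma dotProduct_sq_eq (v x : Vec p) (w : ℝ) :
    w * (x ⬝ᵥ v) ^ 2 = ∑ j, v j * (w * (x j * (x ⬝ᵥ v))) := by
  have h : (x ⬝ᵥ v) ^ 2 = (∑ j, v j * x j) * (x ⬝ᵥ v) := by
    rw [sq, dotProduct_comm x v]; rfl
  rw [h, Finset.sum_mul, Finset.mul_sum]
  exact Finset.sum_congr rfl fun j _ => by ring

lemma integrable_dens_mul_dot (hD : D.Regular Q) (v : Vec p) (j : Fin (p + 1)) :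
    Integrable (fun z : Vec p × ℝ => D.dens z.1 0 * (z.1 j * (z.1 ⬝ᵥ v))) D.law := by
  simp only [dotProduct_eq_sum_mul]
  exact integrable_finsetSum _ fun k _ => (integrable_dens_mul hD j k).mul_const _

lemma integrable_mul_dot (hD : D.Regular Q) (v : Vec p) (j : Fin (p + 1)) :
    Integrable (fun z : Vec p × ℝ => 1 * (z.1 j * (z.1 ⬝ᵥ v))) D.law := by
  simp only [dotProduct_eq_sum_mul]
  exact integrable_finsetSum _ fun k _ => ((integrable_mul hD j k).const_mul _).mul_const _

lemma integrable_dot_sq (hD : D.Regular Q) (v : Vec p) :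
    Integrable (fun z : Vec p × ℝ => 1 * (z.1 ⬝ᵥ v) ^ 2) D.law := by
  simp only [dotProduct_sq_eq]
  exact integrable_finsetSum _ fun k _ => (integrable_mul_dot hD v k).const_mul _

lemma integrable_dens_dot_sq (hD : D.Regular Q) (v : Vec p) :
    Integrable (fun z : Vec p × ℝ => D.dens z.1 0 * (z.1 ⬝ᵥ v) ^ 2) D.law := by
  simp only [dotProduct_sq_eq]
  exact integrable_finsetSum _ fun k _ => (integrable_dens_mul_dot hD v k).const_mul _

lemma dotProduct_Info (hD : D.Regular Q) (v : Vec p) :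
    v ⬝ᵥ (D.Info *ᵥ v) = ∫ z, D.dens z.1 0 * (z.1 ⬝ᵥ v) ^ 2 ∂D.law := by
  simp only [dotProduct_sq_eq]
  rw [integral_finsetSum _ fun k _ => (integrable_dens_mul_dot hD v k).const_mul _]
  rw [dotProduct]
  refine Finset.sum_congr rfl fun j _ => ?_
  rw [integral_const_mul, Info_mulVec hD]

lemma dotProduct_Sigma (hD : D.Regular Q) (v : Vec p) :
    v ⬝ᵥ (D.Sigma *ᵥ v) = ∫ z, 1 * (z.1 ⬝ᵥ v) ^ 2 ∂D.law := by
  simp only [dotProduct_sq_eq]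
  rw [integral_finsetSum _ fun k _ => (integrable_mul_dot hD v k).const_mul _]
  rw [dotProduct]
  refine Finset.sum_congr rfl fun j _ => ?_
  rw [integral_const_mul]
  congr 1
  simp only [dotProduct_eq_sum_mul]
  rw [integral_finsetSum _ fun k _ => ((integrable_mul hD j k).const_mul _).mul_const _]
  simp only [mulVec, dotProduct, Sigma, of_apply, integral_mul_const, one_mul]

lemma dotProduct_Sigma_le (hD : D.Regular Q) (v : Vec p) :
    v ⬝ᵥ (D.Sigma *ᵥ v) ≤ Q.lamHi / Q.f₁ * l2 v ^ 2 := by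
  have h1 : Q.f₁ * (v ⬝ᵥ (D.Sigma *ᵥ v)) ≤ v ⬝ᵥ (D.Info *ᵥ v) := by
    rw [dotProduct_Sigma hD, dotProduct_Info hD, ← integral_const_mul]
    refine integral_mono_ae ((integrable_dot_sq hD v).const_mul _) (integrable_dens_dot_sq hD v) ?_
    filter_upwards [ae_law_of_ae_fst hD.dens_zero] with z hz
    rw [one_mul]
    exact mul_le_mul_of_nonneg_right hz.1 (sq_nonneg _)
  have h2 := hD.eigen_upper v
  rw [← l2_sq] at h2
  rw [div_mul_eq_mul_div, le_div_iff₀ Q.f₁_pos]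
  linarith

/-- The sub-Gaussian tail of the normalized projections `√A xᵀu`. -/
lemma tail_le (hD : D.Regular Q) {u : Vec p} (hu : l2 u ≤ 1) {t : ℝ} (ht : 0 < t) :
    D.law {z | t ≤ 2 * √(expRate Q) * |z.1 ⬝ᵥ u|} ≤
      ENNReal.ofReal (2 * Real.exp (-t ^ 2 / 2)) := by
  set q := u ⬝ᵥ (D.Sigma *ᵥ u)
  have hq : q = ∫ z, 1 * (z.1 ⬝ᵥ u) ^ 2 ∂D.law := dotProduct_Sigma hD u
  have hq0 : 0 ≤ q := by rw [hq]; exact integral_nonneg fun z => by positivity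
  have hq1 : q ≤ Q.lamHi / Q.f₁ :=
    (dotProduct_Sigma_le hD u).trans (mul_le_of_le_one_right
      (div_pos Q.lamHi_pos Q.f₁_pos).le (pow_le_one₀ (l2_nonneg u) hu))
  rcases hq0.eq_or_lt with h0 | h0
  · have h1 : ∀ᵐ z ∂D.law, z.1 ⬝ᵥ u = 0 := by
      have h2 := (integral_eq_zero_iff_of_nonneg (f := fun z : Vec p × ℝ => 1 * (z.1 ⬝ᵥ u) ^ 2)
        (fun z => by positivity) (integrable_dot_sq hD u)).1 (hq ▸ h0.symm)
      filter_upwards [h2] with z hz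
      simpa using hz
    have h2 : D.law {z | t ≤ 2 * √(expRate Q) * |z.1 ⬝ᵥ u|} = 0 := by
      refine measure_mono_null (t := {z | ¬ z.1 ⬝ᵥ u = 0}) ?_ (ae_iff.1 h1)
      intro z hz
      simp only [Set.mem_ofPred_eq] at hz ⊢
      intro h3
      rw [h3] at hz
      simp at hz
      linarith
    rw [h2]; exact zero_le
  · have hsq : 0 < √q := Real.sqrt_pos.2 h0
    have h1 := hD.subgaussian ((√q)⁻¹ • u) (by
      rw [mulVec_smul, smul_dotProduct, dotProduct_smul, smul_eq_mul, smul_eq_mul]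
      change (√q)⁻¹ * ((√q)⁻¹ * q) = 1
      rw [← mul_assoc, ← mul_inv, Real.mul_self_sqrt hq0, inv_mul_cancel₀ h0.ne']) t ht
    refine (measure_mono fun z hz => ?_).trans
      ((ENNReal.le_ofReal_iff_toReal_le (measure_ne_top _ _) (by positivity)).2 h1)
    simp only [Set.mem_ofPred_eq, dotProduct_smul, smul_eq_mul, abs_mul, abs_inv,
      abs_of_pos hsq] at hz ⊢
    rw [inv_mul_eq_div, le_div_iff₀ hsq]
    have h2 : Q.c₁ * (2 * √(expRate Q)) * √q ≤ 1 := by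
      have h3 : Q.c₁ * (2 * √(expRate Q)) * √q = √(4 * Q.c₁ ^ 2 * expRate Q * q) := by
        rw [Real.sqrt_mul' _ hq0, Real.sqrt_mul' _ (expRate_pos Q).le,
          show 4 * Q.c₁ ^ 2 = (2 * Q.c₁) ^ 2 by ring,
          Real.sqrt_sq (by have := Q.c₁_pos; positivity)]
        ring
      rw [h3, Real.sqrt_le_one]
      have h4 : 4 * Q.c₁ ^ 2 * expRate Q * (Q.lamHi / Q.f₁) = 1 := by
        unfold expRate
        have := Q.c₁_pos.ne'
        have := Q.f₁_pos.ne'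
        have := Q.lamHi_pos.ne'
        field_simp
      rw [← h4]
      exact mul_le_mul_of_nonneg_left hq1 (by have := expRate_pos Q; positivity)
    have hc := Q.c₁_pos
    calc Q.c₁ * t * √q ≤ Q.c₁ * (2 * √(expRate Q) * |z.1 ⬝ᵥ u|) * √q := by gcongr
      _ = (Q.c₁ * (2 * √(expRate Q)) * √q) * |z.1 ⬝ᵥ u| := by ring
      _ ≤ 1 * |z.1 ⬝ᵥ u| := by gcongr
      _ = _ := one_mul _

/-- The sub-Gaussian exponential moment of a projection. -/
noncomputable def _root_.DHSQR.expSq (Q : Constants) (u x : Vec p) : ℝ :=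
  Real.exp (expRate Q * (x ⬝ᵥ u) ^ 2)

lemma lintegral_expSq_le (hD : D.Regular Q) {u : Vec p} (hu : l2 u ≤ 1) :
    ∫⁻ z, ENNReal.ofReal (expSq Q u z.1) ∂D.law ≤ ENNReal.ofReal 3 := by
  -- layer-cake formula for `exp(f² / 4)`, with the tail bound `2 exp(-t² / 2)` for `f`
  set f : Vec p × ℝ → ℝ := fun z => 2 * √(expRate Q) * |z.1 ⬝ᵥ u|
  have hf : Measurable f := by fun_prop
  have hf0 : ∀ z, 0 ≤ f z := fun z => by positivity
  set g : ℝ → ℝ := fun t => t / 2 * Real.exp (t ^ 2 / 4)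
  have hg : Continuous g := by fun_prop
  have hder : ∀ t : ℝ, HasDerivAt (fun t => Real.exp (t ^ 2 / 4)) (g t) t := fun t => by
    have := ((hasDerivAt_pow 2 t).div_const 4).exp
    convert this using 1
    simp only [g]; push_cast; ring
  have hprim : ∀ a : ℝ, ∫ t in (0 : ℝ)..a, g t = Real.exp (a ^ 2 / 4) - 1 := fun a => by
    rw [intervalIntegral.integral_eq_sub_of_hasDerivAt (fun t _ => hder t)
      (hg.intervalIntegrable _ _)]
    simp
  have hlayer := lintegral_comp_eq_lintegral_meas_le_mul (g := g) D.law (ae_of_all _ hf0)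
    hf.aemeasurable (fun t _ => hg.intervalIntegrable _ _)
    (by filter_upwards [ae_restrict_mem measurableSet_Ioi] with t ht
        exact mul_nonneg (half_pos ht).le (Real.exp_pos _).le)
  have hE : ∀ z : Vec p × ℝ, expSq Q u z.1 = 1 + ∫ t in (0 : ℝ)..f z, g t := fun z => by
    rw [hprim, expSq]
    simp only [f, mul_pow, Real.sq_sqrt (expRate_pos Q).le, sq_abs]
    rw [add_sub_cancel]
    congr 1; ring
  have hder2 : ∀ t ∈ Set.Ici (0 : ℝ),
      HasDerivAt (fun t => -2 * Real.exp (-(t ^ 2 / 4))) (t * Real.exp (-(t ^ 2 / 4))) t :=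
    fun t _ => by
    refine (((hasDerivAt_pow 2 t).div_const 4).fun_neg.exp.const_mul (-2)).congr_deriv ?_
    push_cast; ring
  have hlim : Tendsto (fun t : ℝ => -2 * Real.exp (-(t ^ 2 / 4))) atTop (𝓝 0) := by
    have : Tendsto (fun t : ℝ => Real.exp (-(t ^ 2 / 4))) atTop (𝓝 0) :=
      Real.tendsto_exp_neg_atTop_nhds_zero.comp
        ((tendsto_pow_atTop two_ne_zero).atTop_div_const four_pos)
    simpa using this.const_mul (-2)
  have hpos : ∀ t ∈ Set.Ioi (0 : ℝ), 0 ≤ t * Real.exp (-(t ^ 2 / 4)) := fun t ht =>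
    mul_nonneg (le_of_lt ht) (Real.exp_pos _).le
  have hval : ∫⁻ t in Set.Ioi (0 : ℝ), ENNReal.ofReal (t * Real.exp (-(t ^ 2 / 4)))
      = ENNReal.ofReal 2 := by
    rw [← ofReal_integral_eq_lintegral_ofReal (integrableOn_Ioi_deriv_of_nonneg' hder2 hpos hlim)
      ((ae_restrict_mem measurableSet_Ioi).mono hpos),
      integral_Ioi_of_hasDerivAt_of_nonneg' hder2 hpos hlim]
    simp
  calc ∫⁻ z, ENNReal.ofReal (expSq Q u z.1) ∂D.law
      = ∫⁻ z, (1 + ENNReal.ofReal (∫ t in (0 : ℝ)..f z, g t)) ∂D.law :=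
        lintegral_congr fun z => by
          rw [hE, ENNReal.ofReal_add zero_le_one, ENNReal.ofReal_one]
          rw [hprim, sub_nonneg]
          exact Real.one_le_exp (by positivity)
    _ = 1 + ∫⁻ t in Set.Ioi 0, D.law {z | t ≤ f z} * ENNReal.ofReal (g t) := by
        rw [lintegral_add_left measurable_const, hlayer]; simp
    _ ≤ 1 + ∫⁻ t in Set.Ioi (0 : ℝ), ENNReal.ofReal (t * Real.exp (-(t ^ 2 / 4))) := by
        gcongr 1 + ?_
        refine setLIntegral_mono' measurableSet_Ioi fun t ht => ?_
        calc D.law {z | t ≤ f z} * ENNReal.ofReal (g t)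
            ≤ ENNReal.ofReal (2 * Real.exp (-t ^ 2 / 2)) * ENNReal.ofReal (g t) := by
              gcongr; exact tail_le hD hu ht
          _ = _ := by
              rw [← ENNReal.ofReal_mul (by positivity)]
              congr 1
              simp only [g]
              rw [show 2 * Real.exp (-t ^ 2 / 2) * (t / 2 * Real.exp (t ^ 2 / 4))
                = t * (Real.exp (-t ^ 2 / 2) * Real.exp (t ^ 2 / 4)) by ring, ← Real.exp_add]
              congr 2; ring
    _ = ENNReal.ofReal 3 := by
        rw [hval, ← ENNReal.ofReal_one, ← ENNReal.ofReal_add zero_le_one zero_le_two]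
        norm_num

lemma _root_.DHSQR.measurable_expSq (Q : Constants) (u : Vec p) : Measurable (expSq Q u) := by
  unfold expSq; fun_prop

lemma integrable_expSq (hD : D.Regular Q) {u : Vec p} (hu : l2 u ≤ 1) :
    Integrable (fun z : Vec p × ℝ => expSq Q u z.1) D.law :=
  ⟨((measurable_expSq Q u).comp measurable_fst).aestronglyMeasurable,
    (hasFiniteIntegral_iff_ofReal (ae_of_all _ fun _ => (Real.exp_pos _).le)).2
      ((lintegral_expSq_le hD hu).trans_lt ENNReal.ofReal_lt_top)⟩

lemma integral_expSq_le (hD : D.Regular Q) {u : Vec p} (hu : l2 u ≤ 1) :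
    ∫ z, expSq Q u z.1 ∂D.law ≤ 3 := by
  have h := lintegral_expSq_le hD hu
  rw [← ofReal_integral_eq_lintegral_ofReal (integrable_expSq hD hu)
    (ae_of_all _ fun _ => (Real.exp_pos _).le)] at h
  exact (ENNReal.ofReal_le_ofReal_iff (by norm_num)).1 h

end Population

end DHSQR

namespace DHSQR

/-! ### Elementary inequalities for sub-Gaussian moments -/

section Pointwise

variable {A : ℝ}

lemma sq_mul_exp_le (hA : 0 < A) {m : ℝ} (hm : 0 ≤ m) :
    m ^ 2 * Real.exp (A / 2 * m) ≤ 8 / A ^ 2 * Real.exp (A * m) := by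
  have h1 := Real.quadratic_le_exp_of_nonneg (x := A / 2 * m) (by positivity)
  have h2 : m ^ 2 ≤ 8 / A ^ 2 * Real.exp (A / 2 * m) := by
    rw [div_mul_eq_mul_div, le_div_iff₀ (by positivity)]
    nlinarith [mul_nonneg hA.le hm]
  calc m ^ 2 * Real.exp (A / 2 * m)
      ≤ 8 / A ^ 2 * Real.exp (A / 2 * m) * Real.exp (A / 2 * m) := by gcongr
    _ = _ := by rw [mul_assoc, ← Real.exp_add]; ring_nf

lemma exp_half_add_le (s t : ℝ) : Real.exp ((s + t) / 2) ≤ (Real.exp s + Real.exp t) / 2 := by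
  have h1 : Real.exp ((s + t) / 2) = Real.exp (s / 2) * Real.exp (t / 2) := by
    rw [← Real.exp_add]; ring_nf
  have h2 : ∀ r : ℝ, Real.exp r = Real.exp (r / 2) ^ 2 := fun r => by
    rw [sq, ← Real.exp_add]; ring_nf
  rw [h1, h2 s, h2 t]
  nlinarith [sq_nonneg (Real.exp (s / 2) - Real.exp (t / 2))]

/-- The constant in the bounds of polynomials, and of polynomials times `exp(A |w| / 2)`, by the
sub-Gaussian moments `exp(A w²)`. -/
noncomputable def momentConst (A : ℝ) : ℝ := 32 / A ^ 2 * Real.exp (A / 2)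

lemma momentConst_pos (hA : 0 < A) : 0 < momentConst A := by unfold momentConst; positivity

lemma sq_mul_exp_le_pair (hA : 0 < A) {m s t : ℝ} (hm : m = (1 + s + t) / 2) (hm0 : 0 ≤ m) :
    4 * m ^ 2 * Real.exp (A / 2 * m) ≤
      momentConst A * ((Real.exp (A * s) + Real.exp (A * t)) / 2) := by
  calc 4 * m ^ 2 * Real.exp (A / 2 * m) = 4 * (m ^ 2 * Real.exp (A / 2 * m)) := by ring
    _ ≤ 4 * (8 / A ^ 2 * Real.exp (A * m)) :=
        mul_le_mul_of_nonneg_left (sq_mul_exp_le hA hm0) four_pos.le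
    _ = momentConst A * Real.exp ((A * s + A * t) / 2) := by
        unfold momentConst
        rw [mul_assoc (32 / A ^ 2), ← Real.exp_add, hm]; ring_nf
    _ ≤ _ := by
        gcongr
        · exact (momentConst_pos hA).le
        · exact exp_half_add_le _ _

lemma mul_sq_mul_exp_le (hA : 0 < A) (w₁ w₂ : ℝ) :
    w₁ * (w₂ ^ 2 * Real.exp (A / 2 * w₂)) ≤
      momentConst A * ((Real.exp (A * w₁ ^ 2) + Real.exp (A * w₂ ^ 2)) / 2) := by
  refine le_trans ?_ (sq_mul_exp_le_pair hA (m := (1 + w₁ ^ 2 + w₂ ^ 2) / 2) rfl (by positivity))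
  set m := (1 + w₁ ^ 2 + w₂ ^ 2) / 2
  have e1 : w₁ ≤ m := by simp only [m]; nlinarith [sq_nonneg (w₁ - 1)]
  have e2 : w₂ ≤ m := by simp only [m]; nlinarith [sq_nonneg (w₂ - 1)]
  have e3 : w₂ ^ 2 ≤ 2 * m := by simp only [m]; nlinarith
  calc w₁ * (w₂ ^ 2 * Real.exp (A / 2 * w₂)) ≤ m * (2 * m * Real.exp (A / 2 * m)) := by gcongr
    _ = 2 * m ^ 2 * Real.exp (A / 2 * m) := by ring
    _ ≤ _ := by gcongr; norm_num

lemma sq_mul_exp_le_expSq (hA : 0 < A) (w : ℝ) :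
    w ^ 2 * Real.exp (A / 2 * w) ≤ momentConst A * Real.exp (A * w ^ 2) := by
  have h2 := sq_mul_exp_le_pair hA (m := (1 + w ^ 2 + 0) / 2) rfl (by positivity)
  set m := (1 + w ^ 2 + 0) / 2 with hm
  have e2 : w ≤ m := by simp only [m]; nlinarith [sq_nonneg (w - 1)]
  have e3 : w ^ 2 ≤ 4 * m ^ 2 := by simp only [m]; nlinarith [sq_nonneg (w ^ 2)]
  have e4 : Real.exp (A * 0) ≤ Real.exp (A * w ^ 2) := by gcongr; positivity
  calc w ^ 2 * Real.exp (A / 2 * w) ≤ 4 * m ^ 2 * Real.exp (A / 2 * m) := by gcongr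
    _ ≤ _ := h2
    _ ≤ _ := by
        gcongr
        · exact (momentConst_pos hA).le
        · linarith

lemma prod_sq_mul_exp_le (hA : 0 < A) {w₁ w₂ : ℝ} (h₁ : 0 ≤ w₁) (h₂ : 0 ≤ w₂) :
    (w₁ * w₂) ^ 2 * Real.exp (A / 2 * (w₁ * w₂)) ≤
      momentConst A * ((Real.exp (A * w₁ ^ 2) + Real.exp (A * w₂ ^ 2)) / 2) := by
  refine le_trans ?_ (sq_mul_exp_le_pair hA (m := (1 + w₁ ^ 2 + w₂ ^ 2) / 2) rfl (by positivity))
  set m := (1 + w₁ ^ 2 + w₂ ^ 2) / 2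
  have e1 : w₁ * w₂ ≤ m := by simp only [m]; nlinarith [sq_nonneg (w₁ - w₂)]
  have e0 : 0 ≤ w₁ * w₂ := mul_nonneg h₁ h₂
  calc _ ≤ m ^ 2 * Real.exp (A / 2 * m) := by gcongr
    _ ≤ _ := by gcongr; nlinarith [sq_nonneg m]

lemma abs_le_expSq (hA : 0 < A) (w : ℝ) : |w| ≤ momentConst A * Real.exp (A * w ^ 2) := by
  have h2 := sq_mul_exp_le_pair hA (m := (1 + w ^ 2 + 0) / 2) rfl (by positivity)
  set m := (1 + w ^ 2 + 0) / 2 with hm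
  have e2 : |w| ≤ m := by
    simp only [m]; rw [← sq_abs w]; nlinarith [sq_nonneg (|w| - 1)]
  have e0 : 1 / 2 ≤ m := by simp only [m]; nlinarith [sq_nonneg w]
  have e1 : (1 : ℝ) ≤ Real.exp (A / 2 * m) := Real.one_le_exp (by positivity)
  have e3 : m ≤ 4 * m ^ 2 * Real.exp (A / 2 * m) := by
    calc m ≤ 4 * m ^ 2 * 1 := by nlinarith
      _ ≤ _ := by gcongr
  have e4 : Real.exp (A * 0) ≤ Real.exp (A * w ^ 2) := by gcongr; positivity
  refine e2.trans (e3.trans (h2.trans ?_))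
  gcongr
  · exact (momentConst_pos hA).le
  · linarith

lemma abs_mul_le_expSq (hA : 0 < A) (w₁ w₂ : ℝ) :
    |w₁ * w₂| ≤ momentConst A * (Real.exp (A * w₁ ^ 2) + Real.exp (A * w₂ ^ 2)) := by
  have h : ∀ w : ℝ, w ^ 2 ≤ momentConst A * Real.exp (A * w ^ 2) := fun w => by
    have := sq_mul_exp_le_expSq hA |w|
    rw [sq_abs] at this
    refine le_trans (le_mul_of_one_le_right (sq_nonneg w) (Real.one_le_exp (by positivity))) this
  have h1 := h w₁
  have h2 := h w₂
  rw [abs_mul]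
  nlinarith [sq_nonneg (|w₁| - |w₂|), sq_abs w₁, sq_abs w₂, sq_nonneg w₁, sq_nonneg w₂]

lemma abs_mul_mul_le_expSq (hA : 0 < A) (w₁ w₂ w₃ : ℝ) :
    |w₁| * |w₂ * w₃| ≤ momentConst A *
      (Real.exp (A * w₁ ^ 2) + Real.exp (A * w₂ ^ 2) + Real.exp (A * w₃ ^ 2)) := by
  have h : ∀ u v : ℝ, |u| * v ^ 2 ≤
      momentConst A * ((Real.exp (A * u ^ 2) + Real.exp (A * v ^ 2)) / 2) := fun u v => by
    have := mul_sq_mul_exp_le hA |u| |v|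
    rw [sq_abs, sq_abs] at this
    refine le_trans ?_ this
    exact mul_le_mul_of_nonneg_left (le_mul_of_one_le_right (sq_nonneg v)
      (Real.one_le_exp (by positivity))) (abs_nonneg u)
  have h2 := h w₁ w₂
  have h3 := h w₁ w₃
  have h4 : |w₂ * w₃| ≤ (w₂ ^ 2 + w₃ ^ 2) / 2 := by
    rw [abs_mul]; nlinarith [sq_nonneg (|w₂| - |w₃|), sq_abs w₂, sq_abs w₃]
  have h5 := mul_le_mul_of_nonneg_left h4 (abs_nonneg w₁)
  have h6 := momentConst_pos hA
  have := Real.exp_pos (A * w₂ ^ 2)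
  have := Real.exp_pos (A * w₃ ^ 2)
  nlinarith [mul_pos h6 (Real.exp_pos (A * w₂ ^ 2)), mul_pos h6 (Real.exp_pos (A * w₃ ^ 2)),
    mul_pos h6 (Real.exp_pos (A * w₁ ^ 2))]

end Pointwise

/-- Polar decomposition; the direction of the zero vector is taken to be zero. -/
lemma exists_unit {p : ℕ} (v : Vec p) : ∃ u : Vec p, l2 u ≤ 1 ∧ v = l2 v • u := by
  rcases (l2_nonneg v).eq_or_lt with h | h
  · exact ⟨0, by simp [l2], by rw [← h, zero_smul]; exact eq_zero_of_l2_eq_zero h.symm⟩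
  · refine ⟨(l2 v)⁻¹ • v, ?_, ?_⟩
    · rw [l2_smul, abs_of_pos (inv_pos.2 h), inv_mul_cancel₀ h.ne']
    · rw [smul_smul, mul_inv_cancel₀ h.ne', one_smul]

/-! ### The rescaled kernel -/

section Kernel

variable {K : ℝ → ℝ}

lemma IsSmoothingKernel.continuous (hK : IsSmoothingKernel K) : Continuous K :=
  hK.differentiable.continuous

lemma IsSmoothingKernel.measurable (hK : IsSmoothingKernel K) : Measurable K :=
  hK.continuous.measurable

lemma IsSmoothingKernel.integrable_abs_mul (hK : IsSmoothingKernel K) :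
    Integrable fun u => |u| * K u := by
  refine (hK.integrable.add hK.second_moment).mono'
    (continuous_abs.mul hK.continuous).aestronglyMeasurable (ae_of_all _ fun u => ?_)
  rw [Real.norm_eq_abs, abs_of_nonneg (mul_nonneg (abs_nonneg u) (hK.nonneg u))]
  have := hK.nonneg u
  simp only [Pi.add_apply]
  nlinarith [sq_nonneg (|u| - 1), sq_abs u]

lemma Kh_nonneg (hK : IsSmoothingKernel K) {b : ℝ} (hb : 0 < b) (u : ℝ) : 0 ≤ Kh K b u :=
  div_nonneg (hK.nonneg _) hb.le

lemma measurable_Kh (hK : IsSmoothingKernel K) (b : ℝ) : Measurable (Kh K b) :=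
  (hK.measurable.comp (measurable_id.div_const b)).div_const b

lemma integrable_Kh (hK : IsSmoothingKernel K) {b : ℝ} (hb : 0 < b) (c : ℝ) :
    Integrable fun y => Kh K b (y - c) :=
  ((hK.integrable.comp_div hb.ne').div_const b).comp_sub_right c

lemma integral_Kh (hK : IsSmoothingKernel K) {b : ℝ} (hb : 0 < b) (c : ℝ) :
    ∫ y, Kh K b (y - c) = 1 := by
  rw [integral_sub_right_eq_self (fun y => Kh K b y)]
  unfold Kh
  rw [integral_div, Measure.integral_comp_div, hK.integral_eq_one, abs_of_pos hb, smul_eq_mul,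
    mul_one, div_self hb.ne']

lemma abs_mul_Kh {b : ℝ} (hb : 0 < b) (u : ℝ) : |u| * Kh K b u = |u / b| * K (u / b) := by
  unfold Kh
  rw [abs_div, abs_of_pos hb]
  ring

lemma integrable_abs_mul_Kh (hK : IsSmoothingKernel K) {b : ℝ} (hb : 0 < b) (c : ℝ) :
    Integrable fun y => |y - c| * Kh K b (y - c) := by
  simp only [abs_mul_Kh hb]
  exact (hK.integrable_abs_mul.comp_div hb.ne').comp_sub_right c

lemma integral_abs_mul_Kh {b : ℝ} (hb : 0 < b) (c : ℝ) :
    ∫ y, |y - c| * Kh K b (y - c) = b * ∫ u, |u| * K u := by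
  simp only [abs_mul_Kh hb]
  rw [integral_sub_right_eq_self (fun y => |y / b| * K (y / b)),
    Measure.integral_comp_div (fun u => |u| * K u), abs_of_pos hb, smul_eq_mul]

lemma lintegral_Kh_mul (hK : IsSmoothingKernel K) {b : ℝ} (hb : 0 < b) (c : ℝ) {w : ℝ}
    (hw : 0 ≤ w) : ∫⁻ y, ENNReal.ofReal (w * Kh K b (y - c)) = ENNReal.ofReal w := by
  rw [← ofReal_integral_eq_lintegral_ofReal ((integrable_Kh hK hb c).const_mul w)
    (ae_of_all _ fun y => mul_nonneg hw (Kh_nonneg hK hb _)), integral_const_mul,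
    integral_Kh hK hb, mul_one]

/-- A common constant for the bound and for the Lipschitz bound of the kernel. -/
lemma exists_kernel_bound (hK : IsSmoothingKernel K) : ∃ B : ℝ, 0 < B ∧ (∀ u, K u ≤ B) ∧
    ∀ u v, |K u - K v| ≤ B * |u - v| := by
  obtain ⟨B₁, h1⟩ := hK.bounded
  obtain ⟨B₂, h2⟩ := hK.deriv_bounded
  refine ⟨max 1 (max B₁ B₂), by positivity, fun u => (h1 u).trans (by simp), fun u v => ?_⟩
  have h3 := convex_univ.norm_image_sub_le_of_norm_deriv_le (f := K) (C := B₂)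
    (fun x _ => hK.differentiable x) (fun x _ => h2 x) (Set.mem_univ v) (Set.mem_univ u)
  exact h3.trans (by simp only [Real.norm_eq_abs]; gcongr; simp)

end Kernel

namespace Population

variable {p : ℕ} {D : Population p} {Q : Constants}

/-- Conditional expectations as integrals against the density. -/
lemma condKernel_integral (hD : D.Regular Q) : ∀ᵐ x ∂D.law.fst, ∀ g : ℝ → ℝ,
    ∫ y, g y ∂D.law.condKernel x = ∫ y, D.dens x (y - x ⬝ᵥ D.beta) * g y := by
  filter_upwards [hD.dens_spec] with x hx g
  rw [hx, integral_withDensity_eq_integral_toReal_smul (measurable_dens hD x _).ennreal_ofReal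
    (ae_of_all _ fun _ => ENNReal.ofReal_lt_top)]
  exact integral_congr_ae (ae_of_all _ fun y => by
    simp only [ENNReal.toReal_ofReal (hD.dens_nonneg _ _), smul_eq_mul])

lemma integrable_dens (hD : D.Regular Q) : ∀ᵐ x ∂D.law.fst, ∀ c : ℝ,
    Integrable fun y => D.dens x (y - c) := by
  filter_upwards [hD.dens_spec] with x hx c
  have h3 : D.law.condKernel x Set.univ = 1 := measure_univ
  rw [hx, withDensity_apply _ MeasurableSet.univ, Measure.restrict_univ,
    lintegral_sub_right_eq_self (fun u => ENNReal.ofReal (D.dens x u)),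
    ← lintegral_sub_right_eq_self (fun u => ENNReal.ofReal (D.dens x u)) c] at h3
  exact ⟨(measurable_dens hD x c).aestronglyMeasurable,
    (hasFiniteIntegral_iff_ofReal (ae_of_all _ fun y => hD.dens_nonneg _ _)).2 (by simp [h3])⟩

/-! ### Bias of the kernel and of the score -/

/-- Conditional bias of the kernel smoother: the density is Lipschitz and is evaluated at distance
`O(b)` from `xᵀ(β - β*)` instead of at `0`. -/
lemma kernel_bias_pointwise {K : ℝ → ℝ} (hK : IsSmoothingKernel K) (hD : D.Regular Q) {b : ℝ}
    (hb : 0 < b) (β : Vec p) : ∀ᵐ x ∂D.law.fst,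
    |∫ y, Kh K b (resid β x y) ∂D.law.condKernel x - D.dens x 0| ≤
      densBound Q * (b * (∫ u, |u| * K u) + |x ⬝ᵥ (β - D.beta)|) := by
  filter_upwards [condKernel_integral hD, dens_le hD, hD.dens_lipschitz] with x h1 h2 h3
  rw [h1]
  unfold resid
  set c := x ⬝ᵥ β
  set d := x ⬝ᵥ D.beta
  have hc : x ⬝ᵥ (β - D.beta) = c - d := dotProduct_sub _ _ _
  have hi1 : Integrable fun y => D.dens x (y - d) * Kh K b (y - c) :=
    (integrable_Kh hK hb c).bdd_mul (c := densBound Q) (measurable_dens hD x d).aestronglyMeasurable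
      (ae_of_all _ fun y => by
        rw [Real.norm_eq_abs, abs_of_nonneg (hD.dens_nonneg _ _)]; exact h2 _)
  have hi2 := (integrable_Kh hK hb c).const_mul (D.dens x 0)
  have h0 : D.dens x 0 = ∫ y, D.dens x 0 * Kh K b (y - c) := by
    rw [integral_const_mul, integral_Kh hK hb, mul_one]
  have hB : Q.l₀ ≤ densBound Q := by
    unfold densBound; linarith [le_max_left Q.l₀ 0]
  have hB1 := one_le_densBound Q
  have hi3 : Integrable fun y =>
      densBound Q * (|y - c| * Kh K b (y - c) + |c - d| * Kh K b (y - c)) :=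
    ((integrable_abs_mul_Kh hK hb c).add ((integrable_Kh hK hb c).const_mul _)).const_mul _
  conv_lhs => rw [h0]
  rw [← integral_sub hi1 hi2]
  calc _ ≤ ∫ y, |D.dens x (y - d) * Kh K b (y - c) - D.dens x 0 * Kh K b (y - c)| :=
        abs_integral_le_integral_abs
    _ ≤ ∫ y, densBound Q * (|y - c| * Kh K b (y - c) + |c - d| * Kh K b (y - c)) := by
        refine integral_mono (hi1.sub hi2).abs hi3 fun y => ?_
        have hk := Kh_nonneg hK hb (y - c)
        simp only
        rw [← sub_mul, abs_mul, abs_of_nonneg hk, ← add_mul, ← mul_assoc]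
        refine mul_le_mul_of_nonneg_right ((h3 _ _).trans ?_) hk
        rw [sub_zero]
        calc Q.l₀ * |y - d| ≤ densBound Q * |y - d| := by gcongr
          _ ≤ _ := by
            gcongr
            calc |y - d| = |(y - c) + (c - d)| := by ring_nf
              _ ≤ _ := abs_add_le _ _
    _ = _ := by
        rw [integral_const_mul, integral_add (integrable_abs_mul_Kh hK hb c)
          ((integrable_Kh hK hb c).const_mul _), integral_abs_mul_Kh hb, integral_const_mul,
          integral_Kh hK hb, mul_one, hc]

/-- The conditional quantile is a point where the conditional distribution function, which is
continuous, equals `τ`. -/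
lemma real_Iic_eq (hD : D.Regular Q) : ∀ᵐ x ∂D.law.fst,
    (D.law.condKernel x).real (Set.Iic (x ⬝ᵥ D.beta)) = Q.τ := by
  filter_upwards [hD.quantile, hD.dens_spec] with x h1 h2
  set μ := D.law.condKernel x
  have hF : ∀ q, μ.real (Set.Iic q) = cdf μ q := fun q => (cdf_eq_real μ q).symm
  have hac : ∀ a : ℝ, μ {a} = 0 := fun a => by
    rw [h2]
    exact withDensity_absolutelyContinuous _ _ (by simp)
  have hset : {q : ℝ | Q.τ ≤ μ.real (Set.Iic q)} = {q : ℝ | Q.τ ≤ cdf μ q} := by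
    simp only [hF]
  have hmono := monotone_cdf μ
  have hcont : Continuous (cdf μ) := by
    rw [continuous_iff_continuousAt]
    intro a
    rw [hmono.continuousAt_iff_leftLim_eq_rightLim, StieltjesFunction.rightLim_eq]
    have h3 : (cdf μ).measure {a} = ENNReal.ofReal (cdf μ a - Function.leftLim (cdf μ) a) :=
      StieltjesFunction.measure_singleton _ _
    rw [measure_cdf, hac] at h3
    have h4 := ENNReal.ofReal_eq_zero.1 h3.symm
    have h5 := hmono.leftLim_le (le_refl a)
    linarith
  have hne : ∃ q, Q.τ ≤ cdf μ q :=
    ((tendsto_cdf_atTop μ).eventually (eventually_ge_nhds Q.τ_lt)).exists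
  obtain ⟨q₀, hq₀⟩ := ((tendsto_cdf_atBot μ).eventually (eventually_lt_nhds Q.τ_pos)).exists
  have hbdd : BddBelow {q : ℝ | Q.τ ≤ cdf μ q} := ⟨q₀, fun q hq => by
    by_contra! h
    have := hmono h.le
    simp only [Set.mem_ofPred_eq] at hq
    linarith⟩
  have hclosed : IsClosed {q : ℝ | Q.τ ≤ cdf μ q} := isClosed_le continuous_const hcont
  have hmem := hclosed.csInf_mem hne hbdd
  unfold condQuantile at h1
  rw [hset] at h1
  rw [h1] at hmem
  rw [hF]
  refine le_antisymm ?_ hmem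
  refine le_of_tendsto (x := 𝓝[<] (x ⬝ᵥ D.beta))
    (hcont.continuousAt.continuousWithinAt.tendsto) ?_ |>.trans le_rfl
  filter_upwards [self_mem_nhdsWithin] with q hq
  by_contra! h
  have h6 := csInf_le hbdd (a := q) h.le
  rw [h1] at h6
  exact absurd hq (not_lt.2 h6)

lemma _root_.DHSQR.measurable_indNonpos : Measurable indNonpos :=
  Measurable.ite measurableSet_Iic measurable_const measurable_const

/-- Conditional bias of the score: the conditional distribution function at `xᵀβ`, minus its value
`τ` at `xᵀβ*`, is linear up to a quadratic remainder. -/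
lemma score_bias_pointwise (hD : D.Regular Q) (β : Vec p) : ∀ᵐ x ∂D.law.fst,
    |∫ y, (indNonpos (resid β x y) - Q.τ) ∂D.law.condKernel x
      - D.dens x 0 * (x ⬝ᵥ (β - D.beta))| ≤ densBound Q * (x ⬝ᵥ (β - D.beta)) ^ 2 := by
  filter_upwards [real_Iic_eq hD, hD.dens_spec, hD.dens_lipschitz, integrable_dens hD] with
    x h1 h2 h3 h4
  set c := x ⬝ᵥ β
  set d := x ⬝ᵥ D.beta
  have hc : x ⬝ᵥ (β - D.beta) = c - d := dotProduct_sub _ _ _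
  have hIic : ∀ q, (D.law.condKernel x).real (Set.Iic q) = ∫ y in Set.Iic q, D.dens x (y - d) := by
    intro q
    rw [h2, measureReal_def, withDensity_apply _ measurableSet_Iic,
      ← ofReal_integral_eq_lintegral_ofReal (h4 d).integrableOn
        (ae_of_all _ fun y => hD.dens_nonneg _ _), ENNReal.toReal_ofReal
        (integral_nonneg fun y => hD.dens_nonneg _ _)]
  have hind : (fun y => indNonpos (resid β x y)) = Set.indicator (Set.Iic c) 1 := by
    ext y
    simp only [indNonpos, resid, Set.indicator, Set.mem_Iic, Pi.one_apply, sub_nonpos]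
    rfl
  have hint : ∫ y, (indNonpos (resid β x y) - Q.τ) ∂D.law.condKernel x
      = ∫ u in (0 : ℝ)..(c - d), D.dens x u := by
    rw [integral_sub _ (integrable_const _), hind, integral_indicator_one measurableSet_Iic,
      integral_const, probReal_univ, one_smul, ← h1, hIic, hIic,
      intervalIntegral.integral_Iic_sub_Iic (h4 d).integrableOn (h4 d).integrableOn,
      intervalIntegral.integral_comp_sub_right (fun u => D.dens x u), sub_self]
    rw [hind]
    exact (integrable_const (1 : ℝ)).indicator measurableSet_Iic
  have hB : Q.l₀ ≤ densBound Q := by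
    unfold densBound; linarith [le_max_left Q.l₀ 0]
  have hB1 := one_le_densBound Q
  have hint2 : Integrable fun y => D.dens x y := by simpa using h4 0
  rw [hint, hc]
  have h5 : (∫ u in (0 : ℝ)..(c - d), D.dens x u) - D.dens x 0 * (c - d) =
      ∫ u in (0 : ℝ)..(c - d), (D.dens x u - D.dens x 0) := by
    rw [intervalIntegral.integral_sub hint2.intervalIntegrable
      intervalIntegrable_const, intervalIntegral.integral_const, sub_zero, smul_eq_mul, mul_comm]
  rw [h5, ← Real.norm_eq_abs]
  refine (intervalIntegral.norm_integral_le_of_norm_le_const (C := densBound Q * |c - d|)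
    fun u hu => ?_).trans (le_of_eq ?_)
  · rw [Real.norm_eq_abs]
    refine (h3 u 0).trans ?_
    rw [sub_zero]
    have h6 : |u| ≤ |c - d| := by
      rcases le_total 0 (c - d) with h | h
      · rw [Set.uIoc_of_le h] at hu
        rw [abs_of_pos hu.1, abs_of_nonneg h]; exact hu.2
      · rw [Set.uIoc_of_ge h] at hu
        rw [abs_of_nonpos hu.2, abs_of_nonpos h]; linarith [hu.1]
    calc Q.l₀ * |u| ≤ densBound Q * |u| := by gcongr
      _ ≤ _ := by gcongr
  · rw [sub_zero, mul_assoc, ← sq, sq_abs]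

end Population

end DHSQR

namespace DHSQR

/-- The moment constant at the rate of the sub-Gaussian moments. -/
noncomputable abbrev momC (Q : Constants) : ℝ := momentConst (expRate Q)

lemma momC_pos (Q : Constants) : 0 < momC Q := momentConst_pos (expRate_pos Q)

lemma dotProduct_single_one {p : ℕ} (x : Vec p) (j : Fin (p + 1)) :
    x ⬝ᵥ (Pi.single j (1 : ℝ) : Vec p) = x j := by simp

namespace Population

variable {p : ℕ} {D : Population p} {Q : Constants}

/-! ### Integrated bias bounds -/

/-- The expectation of `D̂_{1,b} v` is `I v` up to `O(b + |β - β*|₂) |v|₂`. -/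
lemma kernel_bias {K : ℝ → ℝ} (hK : IsSmoothingKernel K) (hD : D.Regular Q) {b : ℝ}
    (hb : 0 < b) (β v : Vec p) (j : Fin (p + 1))
    (hint : Integrable (fun z => Kh K b (resid β z.1 z.2) * (z.1 j * (z.1 ⬝ᵥ v))) D.law) :
    |∫ z, Kh K b (resid β z.1 z.2) * (z.1 j * (z.1 ⬝ᵥ v)) ∂D.law - (D.Info *ᵥ v) j| ≤
      9 * densBound Q * momC Q * (b * (∫ u, |u| * K u) + l2 (β - D.beta)) * l2 v := by
  obtain ⟨u, hu, huv⟩ := exists_unit v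
  obtain ⟨d, hd, hdv⟩ := exists_unit (β - D.beta)
  have hA := expRate_pos Q
  have hM := momC_pos Q
  have hB := one_le_densBound Q
  set k1 := ∫ u, |u| * K u
  have hk1 : 0 ≤ k1 := integral_nonneg fun u => mul_nonneg (abs_nonneg _) (hK.nonneg _)
  set W : Vec p → ℝ := fun x => densBound Q * momC Q * (b * k1 + l2 (β - D.beta)) * l2 v *
    (expSq Q (Pi.single j 1) x + expSq Q u x + expSq Q d x)
  have hj1 : l2 (Pi.single j 1 : Vec p) ≤ 1 := (l2_single j).le
  have hWint : Integrable (fun z : Vec p × ℝ => W z.1) D.law :=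
    (((integrable_expSq hD hj1).add (integrable_expSq hD hu)).add
      (integrable_expSq hD hd)).const_mul _
  set e : Vec p → ℝ := fun x => densBound Q * (b * k1 + |x ⬝ᵥ (β - D.beta)|)
  have hle : ∀ x : Vec p, e x * |x j * (x ⬝ᵥ v)| ≤ W x := by
    intro x
    have h1 := abs_mul_mul_le_expSq hA (x ⬝ᵥ d) (x j) (x ⬝ᵥ u)
    have h2 := abs_mul_le_expSq hA (x j) (x ⬝ᵥ u)
    have h3 : |x j * (x ⬝ᵥ v)| = l2 v * |x j * (x ⬝ᵥ u)| := by
      conv_lhs => rw [huv, dotProduct_smul, smul_eq_mul]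
      rw [mul_left_comm, abs_mul, abs_of_nonneg (l2_nonneg v)]
    have h4 : |x ⬝ᵥ (β - D.beta)| = l2 (β - D.beta) * |x ⬝ᵥ d| := by
      conv_lhs => rw [hdv, dotProduct_smul, smul_eq_mul]
      rw [abs_mul, abs_of_nonneg (l2_nonneg _)]
    simp only [e, W, expSq, dotProduct_single_one]
    rw [h3, h4]
    have h5 : |x j * (x ⬝ᵥ u)| ≤ momentConst (expRate Q) *
        (Real.exp (expRate Q * x j ^ 2) + Real.exp (expRate Q * (x ⬝ᵥ u) ^ 2) +
          Real.exp (expRate Q * (x ⬝ᵥ d) ^ 2)) :=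
      h2.trans (mul_le_mul_of_nonneg_left (le_add_of_nonneg_right (Real.exp_pos _).le) hM.le)
    have h6 := l2_nonneg (β - D.beta)
    have h7 := l2_nonneg v
    calc densBound Q * (b * k1 + l2 (β - D.beta) * |x ⬝ᵥ d|) * (l2 v * |x j * (x ⬝ᵥ u)|)
        = densBound Q * l2 v * (b * k1 * |x j * (x ⬝ᵥ u)| +
            l2 (β - D.beta) * (|x ⬝ᵥ d| * |x j * (x ⬝ᵥ u)|)) := by ring
      _ ≤ densBound Q * l2 v * (b * k1 * (momentConst (expRate Q) *
        (Real.exp (expRate Q * x j ^ 2) + Real.exp (expRate Q * (x ⬝ᵥ u) ^ 2) +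
          Real.exp (expRate Q * (x ⬝ᵥ d) ^ 2))) + l2 (β - D.beta) * (momentConst (expRate Q) *
        (Real.exp (expRate Q * (x ⬝ᵥ d) ^ 2) + Real.exp (expRate Q * x j ^ 2) +
          Real.exp (expRate Q * (x ⬝ᵥ u) ^ 2)))) := by gcongr
      _ = _ := by simp only [momC]; ring
  have he_meas : Measurable fun x : Vec p => e x * |x j * (x ⬝ᵥ v)| := by
    simp only [e]; fun_prop
  have heint : Integrable (fun z : Vec p × ℝ => e z.1 * |z.1 j * (z.1 ⬝ᵥ v)|) D.law := by
    refine hWint.mono' (he_meas.comp measurable_fst).aestronglyMeasurable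
      (ae_of_all _ fun z => ?_)
    rw [Real.norm_eq_abs, abs_of_nonneg]
    · exact hle z.1
    · simp only [e]; positivity
  rw [Info_mulVec hD]
  refine (abs_integral_sub_integral_le (k := fun z => Kh K b (resid β z.1 z.2))
    (w := fun x => x j * (x ⬝ᵥ v)) (g := fun x => D.dens x 0) (e := e) hint
    (integrable_dens_mul_dot hD v j) heint he_meas ?_
    (kernel_bias_pointwise hK hD hb β)).trans ?_
  · exact (measurable_dens_zero hD).mul (by fun_prop)
  · refine (integral_mono heint hWint fun z => hle z.1).trans ?_
    simp only [W]
    have hadd : Integrable (fun z : Vec p × ℝ => expSq Q (Pi.single j 1) z.1 + expSq Q u z.1)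
        D.law := (integrable_expSq hD hj1).add (integrable_expSq hD hu)
    rw [integral_const_mul, integral_add hadd (integrable_expSq hD hd),
      integral_add (integrable_expSq hD hj1) (integrable_expSq hD hu)]
    have h1 := integral_expSq_le hD hj1
    have h2 := integral_expSq_le hD hu
    have h3 := integral_expSq_le hD hd
    have h0 : 0 ≤ densBound Q * momC Q * (b * k1 + l2 (β - D.beta)) * l2 v := by
      have h6 := l2_nonneg (β - D.beta)
      have h7 := l2_nonneg v
      positivity
    calc _ ≤ densBound Q * momC Q * (b * k1 + l2 (β - D.beta)) * l2 v * 9 :=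
          mul_le_mul_of_nonneg_left (by linarith) h0
      _ = _ := by ring

lemma integrable_score (hD : D.Regular Q) (β : Vec p) (j : Fin (p + 1)) :
    Integrable (fun z : Vec p × ℝ => (indNonpos (resid β z.1 z.2) - Q.τ) * z.1 j) D.law := by
  have hj1 : l2 (Pi.single j 1 : Vec p) ≤ 1 := (l2_single j).le
  refine ((integrable_expSq hD hj1).const_mul (momC Q)).mono' ?_ (ae_of_all _ fun z => ?_)
  · refine (((measurable_indNonpos.comp (?_ : Measurable fun z : Vec p × ℝ =>
      resid β z.1 z.2)).sub_const _).mul (by fun_prop)).aestronglyMeasurable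
    unfold resid; fun_prop
  · have h1 : |indNonpos (resid β z.1 z.2) - Q.τ| ≤ 1 := by
      have := Q.τ_pos
      have := Q.τ_lt
      unfold indNonpos
      split_ifs <;> rw [abs_le] <;> constructor <;> linarith
    have h2 := abs_le_expSq (expRate_pos Q) (z.1 j)
    rw [Real.norm_eq_abs, abs_mul]
    refine (mul_le_of_le_one_left (abs_nonneg _) h1).trans ?_
    simpa only [expSq, dotProduct_single_one] using h2

/-- The expectation of the score at `β` is `I (β - β*)` up to `O(|β - β*|₂²)`. -/
lemma score_bias (hD : D.Regular Q) (β : Vec p) (j : Fin (p + 1)) :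
    |∫ z, (indNonpos (resid β z.1 z.2) - Q.τ) * z.1 j ∂D.law - (D.Info *ᵥ (β - D.beta)) j| ≤
      6 * densBound Q * momC Q * l2 (β - D.beta) ^ 2 := by
  obtain ⟨d, hd, hdv⟩ := exists_unit (β - D.beta)
  have hA := expRate_pos Q
  have hM := momC_pos Q
  have hB := one_le_densBound Q
  set W : Vec p → ℝ := fun x => densBound Q * momC Q * l2 (β - D.beta) ^ 2 *
    (expSq Q (Pi.single j 1) x + expSq Q d x)
  have hj1 : l2 (Pi.single j 1 : Vec p) ≤ 1 := (l2_single j).le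
  have hWint : Integrable (fun z : Vec p × ℝ => W z.1) D.law :=
    ((integrable_expSq hD hj1).add (integrable_expSq hD hd)).const_mul _
  set e : Vec p → ℝ := fun x => densBound Q * (x ⬝ᵥ (β - D.beta)) ^ 2
  have hle : ∀ x : Vec p, e x * |x j| ≤ W x := by
    intro x
    have h1 := mul_sq_mul_exp_le hA |x j| |x ⬝ᵥ d|
    have h4 : (x ⬝ᵥ (β - D.beta)) ^ 2 = l2 (β - D.beta) ^ 2 * |x ⬝ᵥ d| ^ 2 := by
      conv_lhs => rw [hdv, dotProduct_smul, smul_eq_mul]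
      rw [mul_pow, sq_abs]
    simp only [e, W, expSq, dotProduct_single_one]
    rw [h4]
    have h5 : |x j| * |x ⬝ᵥ d| ^ 2 ≤ momC Q * (Real.exp (expRate Q * x j ^ 2) +
        Real.exp (expRate Q * (x ⬝ᵥ d) ^ 2)) := by
      calc |x j| * |x ⬝ᵥ d| ^ 2
          ≤ |x j| * (|x ⬝ᵥ d| ^ 2 * Real.exp (expRate Q / 2 * |x ⬝ᵥ d|)) := by
            gcongr
            exact le_mul_of_one_le_right (sq_nonneg _) (Real.one_le_exp (by positivity))
        _ ≤ _ := h1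
        _ ≤ _ := by
            rw [sq_abs, sq_abs]
            refine mul_le_mul_of_nonneg_left ?_ hM.le
            have := Real.exp_pos (expRate Q * x j ^ 2)
            have := Real.exp_pos (expRate Q * (x ⬝ᵥ d) ^ 2)
            linarith
    calc densBound Q * (l2 (β - D.beta) ^ 2 * |x ⬝ᵥ d| ^ 2) * |x j|
        = densBound Q * l2 (β - D.beta) ^ 2 * (|x j| * |x ⬝ᵥ d| ^ 2) := by ring
      _ ≤ densBound Q * l2 (β - D.beta) ^ 2 * (momC Q * (Real.exp (expRate Q * x j ^ 2) +
        Real.exp (expRate Q * (x ⬝ᵥ d) ^ 2))) := by gcongr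
      _ = _ := by ring
  have he_meas : Measurable fun x : Vec p => e x * |x j| := by
    simp only [e]; fun_prop
  have heint : Integrable (fun z : Vec p × ℝ => e z.1 * |z.1 j|) D.law := by
    refine hWint.mono' (he_meas.comp measurable_fst).aestronglyMeasurable
      (ae_of_all _ fun z => ?_)
    rw [Real.norm_eq_abs, abs_of_nonneg]
    · exact hle z.1
    · simp only [e]; positivity
  have hInfo : (D.Info *ᵥ (β - D.beta)) j =
      ∫ z, D.dens z.1 0 * (z.1 ⬝ᵥ (β - D.beta)) * z.1 j ∂D.law := by
    rw [Info_mulVec hD]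
    exact integral_congr_ae (ae_of_all _ fun z => by simp only; ring)
  have hgint : Integrable (fun z : Vec p × ℝ =>
      D.dens z.1 0 * (z.1 ⬝ᵥ (β - D.beta)) * z.1 j) D.law := by
    refine (integrable_dens_mul_dot hD (β - D.beta) j).congr (ae_of_all _ fun z => ?_)
    simp only; ring
  rw [hInfo]
  refine (abs_integral_sub_integral_le (k := fun z => indNonpos (resid β z.1 z.2) - Q.τ)
    (w := fun x => x j) (g := fun x => D.dens x 0 * (x ⬝ᵥ (β - D.beta))) (e := e)
    (integrable_score hD β j) hgint heint he_meas ?_ (score_bias_pointwise hD β)).trans ?_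
  · exact ((measurable_dens_zero hD).mul (by fun_prop)).mul (by fun_prop)
  · refine (integral_mono heint hWint fun z => hle z.1).trans ?_
    simp only [W]
    rw [integral_const_mul, integral_add (integrable_expSq hD hj1) (integrable_expSq hD hd)]
    have h1 := integral_expSq_le hD hj1
    have h3 := integral_expSq_le hD hd
    calc _ ≤ densBound Q * momC Q * l2 (β - D.beta) ^ 2 * 6 :=
          mul_le_mul_of_nonneg_left (by linarith) (by positivity)
      _ = _ := by ring

lemma abs_Info_mulVec_le (hD : D.Regular Q) (v : Vec p) (j : Fin (p + 1)) :
    |(D.Info *ᵥ v) j| ≤ 6 * densBound Q * momC Q * l2 v := by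
  obtain ⟨u, hu, huv⟩ := exists_unit v
  have hA := expRate_pos Q
  have hM := momC_pos Q
  have hB := one_le_densBound Q
  have hj1 : l2 (Pi.single j 1 : Vec p) ≤ 1 := (l2_single j).le
  have hWint : Integrable (fun z : Vec p × ℝ => densBound Q * momC Q * l2 v *
      (expSq Q (Pi.single j 1) z.1 + expSq Q u z.1)) D.law :=
    ((integrable_expSq hD hj1).add (integrable_expSq hD hu)).const_mul _
  rw [Info_mulVec hD]
  refine abs_integral_le_integral_abs.trans ((integral_mono_ae
    (integrable_dens_mul_dot hD v j).abs hWint ?_).trans ?_)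
  · filter_upwards [ae_law_of_ae_fst (dens_le hD)] with z hz
    have h2 := abs_mul_le_expSq hA (z.1 j) (z.1 ⬝ᵥ u)
    have h3 : |z.1 j * (z.1 ⬝ᵥ v)| = l2 v * |z.1 j * (z.1 ⬝ᵥ u)| := by
      conv_lhs => rw [huv, dotProduct_smul, smul_eq_mul]
      rw [mul_left_comm, abs_mul, abs_of_nonneg (l2_nonneg v)]
    have h4 := l2_nonneg v
    rw [abs_mul, abs_of_nonneg (hD.dens_nonneg _ _), h3]
    simp only [expSq, dotProduct_single_one]
    calc D.dens z.1 0 * (l2 v * |z.1 j * (z.1 ⬝ᵥ u)|)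
        ≤ densBound Q * (l2 v * (momC Q * (Real.exp (expRate Q * z.1 j ^ 2) +
          Real.exp (expRate Q * (z.1 ⬝ᵥ u) ^ 2)))) := by
          gcongr
          exact hz 0
      _ = _ := by ring
  · rw [integral_const_mul, integral_add (integrable_expSq hD hj1) (integrable_expSq hD hu)]
    have h1 := integral_expSq_le hD hj1
    have h3 := integral_expSq_le hD hu
    have h4 := l2_nonneg v
    calc _ ≤ densBound Q * momC Q * l2 v * 6 :=
          mul_le_mul_of_nonneg_left (by linarith) (by positivity)
      _ = _ := by ring

/-! ### Variance proxies -/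

/-- The variance proxy of a summand of `D̂_{1,b} v` is of order `1 / b`: its square is at most `B /
b` times a factor that integrates to a bounded one. -/
lemma kernel_variance {K : ℝ → ℝ} (hK : IsSmoothingKernel K) (hD : D.Regular Q) {B : ℝ}
    (hB : 0 < B) (hKB : ∀ u, K u ≤ B) {b : ℝ} (hb : 0 < b) (β : Vec p) {v : Vec p} (hv : l2 v ≤ 1)
    (j : Fin (p + 1)) {φ : Vec p × ℝ → ℝ}
    (hφ : φ = fun z => Kh K b (resid β z.1 z.2) * (z.1 j * (z.1 ⬝ᵥ v))) :
    Integrable (fun z => φ z ^ 2 * Real.exp (b * (expRate Q / (2 * B)) * |φ z|)) D.law ∧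
      ∫ z, φ z ^ 2 * Real.exp (b * (expRate Q / (2 * B)) * |φ z|) ∂D.law ≤
        3 * densBound Q * momC Q * B / b := by
  have hA := expRate_pos Q
  have hM := momC_pos Q
  have hB1 := one_le_densBound Q
  have hj1 : l2 (Pi.single j 1 : Vec p) ≤ 1 := (l2_single j).le
  have hφm : Measurable φ := by
    rw [hφ]
    exact ((measurable_Kh hK b).comp (by unfold resid; fun_prop)).mul (by fun_prop)
  set W : Vec p → ℝ := fun x => B / b * (momC Q *
    ((expSq Q (Pi.single j 1) x + expSq Q v x) / 2)) with hWdef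
  have hW0 : ∀ x, 0 ≤ W x := fun x => by simp only [W, expSq]; positivity
  have hWint : Integrable (fun z : Vec p × ℝ => W z.1) D.law :=
    ((((integrable_expSq hD hj1).add (integrable_expSq hD hv)).div_const 2).const_mul
      (momC Q)).const_mul (B / b)
  have hpt : ∀ z, φ z ^ 2 * Real.exp (b * (expRate Q / (2 * B)) * |φ z|) ≤
      W z.1 * Kh K b (z.2 - z.1 ⬝ᵥ β) := by
    intro z
    have hk0 : 0 ≤ Kh K b (z.2 - z.1 ⬝ᵥ β) := Kh_nonneg hK hb _
    have hk1 : Kh K b (z.2 - z.1 ⬝ᵥ β) ≤ B / b :=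
      div_le_div_of_nonneg_right (hKB _) hb.le
    have h1 := prod_sq_mul_exp_le hA (abs_nonneg (z.1 j)) (abs_nonneg (z.1 ⬝ᵥ v))
    simp only [sq_abs] at h1
    rw [hφ]
    simp only [resid]
    set k := Kh K b (z.2 - z.1 ⬝ᵥ β)
    set P := |z.1 j| * |z.1 ⬝ᵥ v| with hP
    have hP0 : 0 ≤ P := by positivity
    have e1 : |k * (z.1 j * (z.1 ⬝ᵥ v))| = k * P := by
      rw [abs_mul, abs_mul, abs_of_nonneg hk0]
    have e2 : b * (expRate Q / (2 * B)) * (k * P) ≤ expRate Q / 2 * P := by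
      have : b * k ≤ B := by rw [le_div_iff₀ hb] at hk1; linarith
      calc b * (expRate Q / (2 * B)) * (k * P) = (b * k) * (expRate Q / (2 * B) * P) := by ring
        _ ≤ B * (expRate Q / (2 * B) * P) := by gcongr
        _ = _ := by field_simp
    rw [← sq_abs, e1]
    calc (k * P) ^ 2 * Real.exp (b * (expRate Q / (2 * B)) * (k * P))
        ≤ (k * P) ^ 2 * Real.exp (expRate Q / 2 * P) := by gcongr
      _ = k * k * (P ^ 2 * Real.exp (expRate Q / 2 * P)) := by ring
      _ ≤ B / b * k * (momC Q * ((Real.exp (expRate Q * z.1 j ^ 2) +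
          Real.exp (expRate Q * (z.1 ⬝ᵥ v) ^ 2)) / 2)) :=
          mul_le_mul (mul_le_mul_of_nonneg_right hk1 hk0) h1 (by positivity) (by positivity)
      _ = _ := by simp only [W, expSq, dotProduct_single_one]; ring
  have hkmeas : Measurable fun z : Vec p × ℝ => W z.1 * Kh K b (z.2 - z.1 ⬝ᵥ β) := by
    refine Measurable.mul ?_ ((measurable_Kh hK b).comp (by fun_prop))
    exact ((((measurable_expSq Q _).add (measurable_expSq Q v)).div_const 2).const_mul
      _).const_mul _ |>.comp measurable_fst
  have hky : ∀ x, ∫⁻ y, ENNReal.ofReal (W x * Kh K b (y - x ⬝ᵥ β)) ≤ ENNReal.ofReal (W x) :=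
    fun x => (lintegral_Kh_mul hK hb (x ⬝ᵥ β) (hW0 x)).le
  obtain ⟨hi, hle⟩ := integrable_and_integral_le (W := W) hD hkmeas
    (fun z => mul_nonneg (hW0 _) (Kh_nonneg hK hb _)) hW0 hky hWint
  have hmain : Integrable (fun z => φ z ^ 2 * Real.exp (b * (expRate Q / (2 * B)) * |φ z|))
      D.law := by
    refine hi.mono' (by fun_prop) (ae_of_all _ fun z => ?_)
    rw [Real.norm_eq_abs, abs_of_nonneg (by positivity)]
    exact hpt z
  refine ⟨hmain, (integral_mono hmain hi hpt).trans (hle.trans ?_)⟩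
  simp only [W]
  rw [integral_const_mul, integral_const_mul, integral_div,
    integral_add (integrable_expSq hD hj1) (integrable_expSq hD hv)]
  have h1 := integral_expSq_le hD hj1
  have h3 := integral_expSq_le hD hv
  calc densBound Q * (B / b * (momC Q * ((∫ z, expSq Q (Pi.single j 1) z.1 ∂D.law +
        ∫ z, expSq Q v z.1 ∂D.law) / 2)))
      ≤ densBound Q * (B / b * (momC Q * ((3 + 3) / 2))) := by gcongr
    _ = _ := by ring

/-- The variance proxy of `d(x, y) x_j` for a factor `|d| ≤ 1` that is rarely nonzero: its integral
over `y` is at most `r₁ |xᵀu| + r₂`. This gives the proxy the size `r₁ + r₂`. -/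
lemma indicator_variance (hD : D.Regular Q) {d : Vec p × ℝ → ℝ} (hd : Measurable d)
    (hd1 : ∀ z, |d z| ≤ 1) {u : Vec p} (hu : l2 u ≤ 1) {r₁ r₂ : ℝ} (hr₁ : 0 ≤ r₁) (hr₂ : 0 ≤ r₂)
    (hdy : ∀ x, ∫⁻ y, ENNReal.ofReal |d (x, y)| ≤ ENNReal.ofReal (r₁ * |x ⬝ᵥ u| + r₂))
    (j : Fin (p + 1)) {φ : Vec p × ℝ → ℝ} (hφm : Measurable φ) (hφ : ∀ z, |φ z| = |d z * z.1 j|) :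
    Integrable (fun z => φ z ^ 2 * Real.exp (expRate Q / 2 * |φ z|)) D.law ∧
      ∫ z, φ z ^ 2 * Real.exp (expRate Q / 2 * |φ z|) ∂D.law ≤
        3 * densBound Q * momC Q * (r₁ + r₂) ∧
      ∫ z, |φ z| ∂D.law ≤ 6 * densBound Q * momC Q * (r₁ + r₂) := by
  have hA := expRate_pos Q
  have hM := momC_pos Q
  have hB1 := one_le_densBound Q
  have hj1 : l2 (Pi.single j 1 : Vec p) ≤ 1 := (l2_single j).le
  have hej := integrable_expSq hD hj1
  have heu := integrable_expSq hD hu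
  have h1 := integral_expSq_le hD hj1
  have h3 := integral_expSq_le hD hu
  -- both moments have the form `ψ ≤ |d| g(|x_j|)`: integrate `|d|` over `y` first
  have key : ∀ (ψ : Vec p × ℝ → ℝ) (g : ℝ → ℝ) (c : ℝ), 0 ≤ c → Measurable ψ → Measurable g →
      (∀ w, 0 ≤ g w) → (∀ z, 0 ≤ ψ z) →
      (∀ z, ψ z ≤ |d z| * g |z.1 j|) →
      (∀ w₁ w₂ : ℝ, 0 ≤ w₁ → 0 ≤ w₂ → w₁ * g w₂ ≤
        c * (Real.exp (expRate Q * w₁ ^ 2) + Real.exp (expRate Q * w₂ ^ 2))) →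
      (∀ w₂ : ℝ, 0 ≤ w₂ → g w₂ ≤ c * (2 * Real.exp (expRate Q * w₂ ^ 2))) →
      Integrable ψ D.law ∧ ∫ z, ψ z ∂D.law ≤ densBound Q * (6 * c * (r₁ + r₂)) := by
    intro ψ g c hc hψm hgm hg0 hψ0 hψ hg1 hg2
    set W : Vec p → ℝ := fun x => (r₁ * |x ⬝ᵥ u| + r₂) * g |x j|
    set W' : Vec p → ℝ := fun x => c * r₁ * (expSq Q u x + expSq Q (Pi.single j 1) x) +
      c * r₂ * (2 * expSq Q (Pi.single j 1) x)
    have hW0 : ∀ x, 0 ≤ W x := fun x => mul_nonneg (by positivity) (hg0 _)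
    have hWW : ∀ x, W x ≤ W' x := fun x => by
      have e1 := hg1 |x ⬝ᵥ u| |x j| (abs_nonneg _) (abs_nonneg _)
      have e2 := hg2 |x j| (abs_nonneg _)
      rw [sq_abs] at e1 e2
      rw [sq_abs] at e1
      simp only [W, W', expSq, dotProduct_single_one]
      calc (r₁ * |x ⬝ᵥ u| + r₂) * g |x j| = r₁ * (|x ⬝ᵥ u| * g |x j|) + r₂ * g |x j| := by ring
        _ ≤ r₁ * (c * (Real.exp (expRate Q * (x ⬝ᵥ u) ^ 2) + Real.exp (expRate Q * x j ^ 2)))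
            + r₂ * (c * (2 * Real.exp (expRate Q * x j ^ 2))) := by gcongr
        _ = _ := by ring
    have hW'int : Integrable (fun z : Vec p × ℝ => W' z.1) D.law :=
      ((heu.add hej).const_mul _).add ((hej.const_mul 2).const_mul _)
    have hWm : Measurable W := by simp only [W]; fun_prop
    have hWint : Integrable (fun z : Vec p × ℝ => W z.1) D.law := by
      refine hW'int.mono' (hWm.comp measurable_fst).aestronglyMeasurable (ae_of_all _ fun z => ?_)
      rw [Real.norm_eq_abs, abs_of_nonneg (hW0 _)]
      exact hWW _
    have hkm : Measurable fun z : Vec p × ℝ => |d z| * g |z.1 j| := by fun_prop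
    obtain ⟨hi, hle⟩ := integrable_and_integral_le hD hkm
      (fun z => mul_nonneg (abs_nonneg _) (hg0 _)) hW0 (fun x => by
        simp only [mul_comm _ (g |x j|)]
        simp only [ENNReal.ofReal_mul (hg0 _), W, mul_comm _ (g |x j|)]
        rw [lintegral_const_mul']
        · gcongr; exact hdy x
        · exact ENNReal.ofReal_ne_top) hWint
    have hψi : Integrable ψ D.law := hi.mono' hψm.aestronglyMeasurable (ae_of_all _ fun z => by
      rw [Real.norm_eq_abs, abs_of_nonneg (hψ0 z)]; exact hψ z)
    refine ⟨hψi, (integral_mono hψi hi hψ).trans (hle.trans ?_)⟩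
    refine mul_le_mul_of_nonneg_left ?_ (zero_le_one.trans hB1)
    refine (integral_mono hWint hW'int fun z => hWW z.1).trans ?_
    simp only [W']
    have hadd : Integrable (fun z : Vec p × ℝ => expSq Q u z.1 + expSq Q (Pi.single j 1) z.1)
        D.law := heu.add hej
    rw [integral_add (hadd.const_mul _) ((hej.const_mul 2).const_mul _),
      integral_const_mul, integral_const_mul, integral_const_mul, integral_add heu hej]
    calc _ ≤ c * r₁ * (3 + 3) + c * r₂ * (2 * 3) := by gcongr
      _ = _ := by ring
  obtain ⟨k1, k2⟩ := key (fun z => φ z ^ 2 * Real.exp (expRate Q / 2 * |φ z|))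
    (fun w => w ^ 2 * Real.exp (expRate Q / 2 * w)) (momC Q / 2) (by positivity) (by fun_prop)
    (by fun_prop) (fun w => by positivity) (fun z => by positivity) (fun z => by
      rw [← sq_abs (φ z), hφ, abs_mul]
      have := hd1 z
      calc (|d z| * |z.1 j|) ^ 2 * Real.exp (expRate Q / 2 * (|d z| * |z.1 j|))
          ≤ (|d z| * |z.1 j|) ^ 2 * Real.exp (expRate Q / 2 * (1 * |z.1 j|)) := by gcongr
        _ = |d z| * |d z| * (|z.1 j| ^ 2 * Real.exp (expRate Q / 2 * |z.1 j|)) := by ring_nf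
        _ ≤ 1 * |d z| * (|z.1 j| ^ 2 * Real.exp (expRate Q / 2 * |z.1 j|)) := by gcongr
        _ = _ := by ring)
    (fun w₁ w₂ _ _ => by
      have := mul_sq_mul_exp_le hA w₁ w₂
      simp only [momC]; linarith)
    (fun w _ => by
      have := sq_mul_exp_le_expSq hA w
      simp only [momC]; linarith)
  obtain ⟨-, k4⟩ := key (fun z => |φ z|) (fun w => |w|) (momC Q) hM.le (by fun_prop)
    (by fun_prop) (fun w => abs_nonneg w) (fun z => abs_nonneg _)
    (fun z => by simp only [abs_abs]; rw [hφ, abs_mul])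
    (fun w₁ w₂ h1 h2 => by
      have := abs_mul_le_expSq hA w₁ w₂
      rw [abs_mul, abs_of_nonneg h1] at this
      exact this)
    (fun w _ => by
      have := abs_le_expSq hA w
      have h2 := mul_pos hM (Real.exp_pos (expRate Q * w ^ 2))
      simp only [momC] at h2 ⊢; linarith)
  refine ⟨k1, k2.trans (le_of_eq (by ring)), k4.trans (le_of_eq (by ring))⟩

/-- The variance proxy of a summand of the score. -/
lemma score_variance (hD : D.Regular Q) (j : Fin (p + 1)) {φ : Vec p × ℝ → ℝ}
    (hφm : Measurable φ) (hφ : ∀ z, |φ z| ≤ |z.1 j|) :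
    Integrable (fun z => φ z ^ 2 * Real.exp (expRate Q / 2 * |φ z|)) D.law ∧
      ∫ z, φ z ^ 2 * Real.exp (expRate Q / 2 * |φ z|) ∂D.law ≤ 3 * momC Q := by
  have hA := expRate_pos Q
  have hM := momC_pos Q
  have hj1 : l2 (Pi.single j 1 : Vec p) ≤ 1 := (l2_single j).le
  have hej := (integrable_expSq hD hj1).const_mul (momC Q)
  have hpt : ∀ z, φ z ^ 2 * Real.exp (expRate Q / 2 * |φ z|) ≤
      momC Q * expSq Q (Pi.single j 1) z.1 := fun z => by
    have h1 := sq_mul_exp_le_expSq hA |z.1 j|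
    rw [sq_abs (z.1 j)] at h1
    simp only [expSq, dotProduct_single_one]
    refine le_trans ?_ h1
    rw [← sq_abs (φ z), ← sq_abs (z.1 j)]
    have := hφ z
    gcongr
  have hi : Integrable (fun z => φ z ^ 2 * Real.exp (expRate Q / 2 * |φ z|)) D.law := by
    refine hej.mono' (by fun_prop) (ae_of_all _ fun z => ?_)
    rw [Real.norm_eq_abs, abs_of_nonneg (by positivity)]
    exact hpt z
  refine ⟨hi, (integral_mono hi hej hpt).trans ?_⟩
  rw [integral_const_mul]
  have := integral_expSq_le hD hj1
  nlinarith

end Population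

end DHSQR

namespace DHSQR

/-! ### Bernstein's inequality under an exponential moment condition -/

section Bernstein

/-- Taylor's inequality for the exponential function, with a remainder valid for all `x`. -/
lemma exp_le_one_add (x : ℝ) : Real.exp x ≤ 1 + x + x ^ 2 * Real.exp |x| := by
  have h := Complex.norm_exp_sub_sum_le_norm_mul_exp (x : ℂ) 2
  have e : Complex.exp (x : ℂ) - ∑ m ∈ Finset.range 2, (x : ℂ) ^ m / m.factorial =
      ((Real.exp x - (1 + x) : ℝ) : ℂ) := by
    simp [Finset.sum_range_succ]
  rw [e, Complex.norm_real, Complex.norm_real, Real.norm_eq_abs, Real.norm_eq_abs, sq_abs] at h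
  linarith [le_abs_self (Real.exp x - (1 + x))]

variable {α : Type*} [MeasurableSpace α] {μ : Measure α} [IsProbabilityMeasure μ] {φ : α → ℝ}
  {a V : ℝ}

lemma integrable_of_exp_moment (ha : 0 ≤ a) (hφ : Measurable φ)
    (hint : Integrable (fun z => φ z ^ 2 * Real.exp (a * |φ z|)) μ) : Integrable φ μ := by
  refine ((integrable_const 1).add hint).mono' hφ.aestronglyMeasurable (ae_of_all _ fun z => ?_)
  have h1 : (1 : ℝ) ≤ Real.exp (a * |φ z|) := Real.one_le_exp (by positivity)
  have h2 : φ z ^ 2 ≤ φ z ^ 2 * Real.exp (a * |φ z|) := le_mul_of_one_le_right (sq_nonneg _) h1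
  simp only [Pi.add_apply, Real.norm_eq_abs]
  nlinarith [sq_nonneg (|φ z| - 1), sq_abs (φ z), sq_nonneg (φ z)]

/-- The moment generating function under the weighted second moment bound
`E φ² exp(a |φ|) ≤ V`. -/
lemma integral_exp_mul_le (hφ : Measurable φ) (ha : 0 ≤ a)
    (hint : Integrable (fun z => φ z ^ 2 * Real.exp (a * |φ z|)) μ)
    (hV : ∫ z, φ z ^ 2 * Real.exp (a * |φ z|) ∂μ ≤ V) {l : ℝ} (hl : |l| ≤ a) :
    Integrable (fun z => Real.exp (l * φ z)) μ ∧
      ∫ z, Real.exp (l * φ z) ∂μ ≤ Real.exp (l * ∫ z, φ z ∂μ + l ^ 2 * V) := by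
  have hi := integrable_of_exp_moment ha hφ hint
  have hsum : Integrable (fun z => 1 + l * φ z) μ := (integrable_const 1).add (hi.const_mul l)
  have hpt : ∀ z, Real.exp (l * φ z) ≤
      1 + l * φ z + l ^ 2 * (φ z ^ 2 * Real.exp (a * |φ z|)) := fun z => by
    refine (exp_le_one_add _).trans ?_
    rw [mul_pow, mul_assoc, abs_mul]
    gcongr
  have hbd := hsum.add (hint.const_mul (l ^ 2))
  have hexp : Integrable (fun z => Real.exp (l * φ z)) μ := by
    refine hbd.mono' (by fun_prop) (ae_of_all _ fun z => ?_)
    rw [Real.norm_eq_abs, Real.abs_exp]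
    exact hpt z
  refine ⟨hexp, (integral_mono hexp hbd hpt).trans ?_⟩
  simp only [Pi.add_apply]
  rw [integral_add hsum (hint.const_mul (l ^ 2)), integral_add (integrable_const 1)
    (hi.const_mul l), integral_const_mul, integral_const_mul]
  simp only [integral_const, probReal_univ, smul_eq_mul, mul_one]
  have h1 := mul_le_mul_of_nonneg_left hV (sq_nonneg l)
  have h2 := Real.add_one_le_exp (l * ∫ z, φ z ∂μ + l ^ 2 * V)
  linarith

end Bernstein

namespace Experiment

variable {E : Experiment} {φ : Vec E.p × ℝ → ℝ} {a V : ℝ}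

/-- The empirical mean of `φ` over the observations with index in `I`. -/
noncomputable def empMean (E : Experiment) (I : Finset (Fin (E.m * E.n)))
    (φ : Vec E.p × ℝ → ℝ) (ω : E.Ω) : ℝ :=
  (I.card : ℝ)⁻¹ * ∑ i ∈ I, φ (E.X i ω, E.Y i ω)

lemma measurable_obs (i : Fin (E.m * E.n)) : Measurable fun ω => (E.X i ω, E.Y i ω) :=
  (E.measurable_X i).prodMk (E.measurable_Y i)

/-- Chernoff's bound; `V` is the variance proxy, and `t ≤ 2 a V` is the range in which the tail is
Gaussian. -/
lemma empMean_upper_tail (hφ : Measurable φ) (ha : 0 ≤ a) (hV0 : 0 < V)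
    (hint : Integrable (fun z => φ z ^ 2 * Real.exp (a * |φ z|)) E.pop.law)
    (hV : ∫ z, φ z ^ 2 * Real.exp (a * |φ z|) ∂E.pop.law ≤ V) {t : ℝ} (ht : 0 < t)
    (hta : t ≤ 2 * a * V) (I : Finset (Fin (E.m * E.n))) (hI : I.Nonempty) :
    E.P.real {ω | t ≤ E.empMean I φ ω - ∫ z, φ z ∂E.pop.law} ≤
      Real.exp (-(I.card * t ^ 2 / (4 * V))) := by
  set mean := ∫ z, φ z ∂E.pop.law
  -- the exponent that minimizes `-l t + l² V`; `hta` makes it admissible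
  set l := t / (2 * V)
  have hl0 : 0 ≤ l := by positivity
  have hla : |l| ≤ a := by
    rw [abs_of_nonneg hl0, div_le_iff₀ (by positivity)]; linarith
  obtain ⟨h1, h2⟩ := integral_exp_mul_le (μ := E.pop.law) hφ ha hint hV hla
  have hcard : (0 : ℝ) < I.card := by exact_mod_cast hI.card_pos
  set Z : Fin (E.m * E.n) → E.Ω → ℝ := fun i ω => φ (E.X i ω, E.Y i ω)
  have hZm : ∀ i, Measurable (Z i) := fun i => hφ.comp (measurable_obs i)
  have hZind : iIndepFun Z E.P := E.indep.comp (fun _ => φ) (fun _ => hφ)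
  have hZint : ∀ i, Integrable (fun ω => Real.exp (l * Z i ω)) E.P := fun i => by
    have h3 := h1
    rw [← E.law_eq i] at h3
    exact (integrable_map_measure (by fun_prop) (measurable_obs i).aemeasurable).1 h3
  have hmgf : ∀ i, mgf (Z i) E.P l ≤ Real.exp (l * mean + l ^ 2 * V) := fun i => by
    refine le_trans (le_of_eq ?_) h2
    unfold mgf
    conv_rhs => rw [← E.law_eq i]
    rw [integral_map (measurable_obs i).aemeasurable (by fun_prop)]
  have hsum : Integrable (fun ω => Real.exp (l * (∑ i ∈ I, Z i) ω)) E.P :=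
    hZind.integrable_exp_mul_sum hZm fun i _ => hZint i
  have h3 := measure_ge_le_exp_mul_mgf (X := ∑ i ∈ I, Z i) (I.card * (t + mean)) hl0 hsum
  have hset : {ω | t ≤ E.empMean I φ ω - mean} = {ω | I.card * (t + mean) ≤ (∑ i ∈ I, Z i) ω} := by
    ext ω
    simp only [Set.mem_ofPred_eq, empMean, Finset.sum_apply, Z]
    rw [le_sub_iff_add_le, inv_mul_eq_div, le_div_iff₀ hcard, mul_comm]
  rw [hset]
  refine h3.trans ?_
  rw [hZind.mgf_sum hZm]
  calc Real.exp (-l * (I.card * (t + mean))) * ∏ i ∈ I, mgf (Z i) E.P l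
      ≤ Real.exp (-l * (I.card * (t + mean))) * Real.exp (l * mean + l ^ 2 * V) ^ I.card := by
        gcongr
        rw [← Finset.prod_const]
        exact Finset.prod_le_prod (fun i _ => mgf_nonneg) fun i _ => hmgf i
    _ = Real.exp (-(I.card * t ^ 2 / (4 * V))) := by
        rw [← Real.exp_nat_mul, ← Real.exp_add]
        congr 1
        simp only [l]
        field_simp
        ring

lemma empMean_tail (hφ : Measurable φ) (ha : 0 ≤ a) (hV0 : 0 < V)
    (hint : Integrable (fun z => φ z ^ 2 * Real.exp (a * |φ z|)) E.pop.law)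
    (hV : ∫ z, φ z ^ 2 * Real.exp (a * |φ z|) ∂E.pop.law ≤ V) {t : ℝ} (ht : 0 < t)
    (hta : t ≤ 2 * a * V) (I : Finset (Fin (E.m * E.n))) (hI : I.Nonempty) :
    E.P.real {ω | t ≤ |E.empMean I φ ω - ∫ z, φ z ∂E.pop.law|} ≤
      2 * Real.exp (-(I.card * t ^ 2 / (4 * V))) := by
  have h1 := empMean_upper_tail hφ ha hV0 hint hV ht hta I hI
  have h2 := empMean_upper_tail (φ := fun z => -φ z) (a := a) hφ.neg ha hV0 (by simpa using hint)
    (by simpa using hV) ht hta I hI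
  have hset : {ω | t ≤ |E.empMean I φ ω - ∫ z, φ z ∂E.pop.law|} ⊆
      {ω | t ≤ E.empMean I φ ω - ∫ z, φ z ∂E.pop.law} ∪
      {ω | t ≤ E.empMean I (fun z => -φ z) ω - ∫ z, -φ z ∂E.pop.law} := by
    intro ω hω
    simp only [Set.mem_ofPred_eq, Set.mem_union, empMean, Finset.sum_neg_distrib, mul_neg,
      integral_neg] at hω ⊢
    rcases le_abs.1 hω with h | h
    · exact Or.inl h
    · right; linarith
  calc _ ≤ _ := measureReal_mono hset
    _ ≤ _ := measureReal_union_le _ _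
    _ ≤ _ := by linarith

/-- Bernstein's inequality with a union bound over a finite family. -/
lemma empMean_tail_union {T : Type*} (F : Finset T) {φ : T → Vec E.p × ℝ → ℝ}
    (hφ : ∀ τ ∈ F, Measurable (φ τ)) (ha : 0 ≤ a) (hV0 : 0 < V)
    (hint : ∀ τ ∈ F, Integrable (fun z => φ τ z ^ 2 * Real.exp (a * |φ τ z|)) E.pop.law)
    (hV : ∀ τ ∈ F, ∫ z, φ τ z ^ 2 * Real.exp (a * |φ τ z|) ∂E.pop.law ≤ V) {t : ℝ} (ht : 0 < t)
    (hta : t ≤ 2 * a * V) (I : Finset (Fin (E.m * E.n))) (hI : I.Nonempty) :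
    E.P.real {ω | ∃ τ ∈ F, t ≤ |E.empMean I (φ τ) ω - ∫ z, φ τ z ∂E.pop.law|} ≤
      F.card * (2 * Real.exp (-(I.card * t ^ 2 / (4 * V)))) := by
  have hset : {ω | ∃ τ ∈ F, t ≤ |E.empMean I (φ τ) ω - ∫ z, φ τ z ∂E.pop.law|} =
      ⋃ τ ∈ F, {ω | t ≤ |E.empMean I (φ τ) ω - ∫ z, φ τ z ∂E.pop.law|} := by
    ext ω; simp
  rw [hset, ← nsmul_eq_mul]
  exact (measureReal_biUnion_finset_le _ _).trans (Finset.sum_le_card_nsmul _ _ _ fun τ hτ =>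
    empMean_tail (hφ τ hτ) ha hV0 (hint τ hτ) (hV τ hτ) ht hta I hI)

end Experiment

/-! ### Grids in the coordinate subspace of the support -/

section Grid

variable {p : ℕ}

open Classical in
/-- The vectors supported on `S` whose coordinates are multiples of `1 / M` in `[-1, 1]`. -/
noncomputable def grid (S : Finset (Fin (p + 1))) (M : ℕ) : Finset (Vec p) :=
  (Fintype.piFinset fun j => if j ∈ S then Finset.Icc (-(M : ℤ)) M else {0}).image
    fun k j => (k j : ℝ) / M

lemma card_grid_le (S : Finset (Fin (p + 1))) (M : ℕ) :
    (grid S M).card ≤ (2 * M + 1) ^ S.card := by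
  classical
  refine Finset.card_image_le.trans ?_
  rw [Fintype.card_piFinset]
  have h : ∀ j : Fin (p + 1), (if j ∈ S then Finset.Icc (-(M : ℤ)) M else {0}).card =
      if j ∈ S then 2 * M + 1 else 1 := fun j => by
    split_ifs
    · simp; omega
    · simp
  simp only [h, Finset.prod_ite, Finset.prod_const, one_pow, mul_one]
  simp

lemma exists_round {M : ℕ} (hM : 0 < M) {x : ℝ} (hx : |x| ≤ 1) :
    ∃ k : ℤ, k ∈ Finset.Icc (-(M : ℤ)) M ∧ |x - k / M| ≤ 1 / M ∧ |(k : ℝ) / M| ≤ |x| ∧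
      (x = 0 → k = 0) := by
  have hM' : (0 : ℝ) < M := by exact_mod_cast hM
  have key : ∀ y : ℝ, 0 ≤ y → y ≤ 1 → 0 ≤ ⌊y * M⌋ ∧ ⌊y * M⌋ ≤ M ∧
      (⌊y * M⌋ : ℝ) / M ≤ y ∧ y ≤ (⌊y * M⌋ : ℝ) / M + 1 / M := by
    intro y hy hy1
    refine ⟨Int.floor_nonneg.2 (by positivity), ?_, ?_, ?_⟩
    · have : (⌊y * M⌋ : ℝ) ≤ M := (Int.floor_le _).trans (mul_le_of_le_one_left hM'.le hy1)
      exact_mod_cast this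
    · rw [div_le_iff₀ hM']; exact Int.floor_le _
    · rw [← add_div, le_div_iff₀ hM']; exact (Int.lt_floor_add_one _).le
  rcases le_total 0 x with h | h
  · obtain ⟨h1, h2, h3, h4⟩ := key x h ((le_abs_self x).trans hx)
    refine ⟨⌊x * M⌋, Finset.mem_Icc.2 ⟨by omega, h2⟩, ?_, ?_, fun h0 => by simp [h0]⟩
    · rw [abs_of_nonneg (by linarith)]; linarith
    · rw [abs_of_nonneg h, abs_of_nonneg (by have : (0 : ℝ) ≤ ⌊x * M⌋ := by exact_mod_cast h1
                                             positivity)]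
      exact h3
  · obtain ⟨h1, h2, h3, h4⟩ := key (-x) (by linarith) ((neg_le_abs x).trans hx)
    refine ⟨-⌊-x * M⌋, Finset.mem_Icc.2 ⟨by omega, by omega⟩, ?_, ?_, fun h0 => by simp [h0]⟩
    · rw [Int.cast_neg, neg_div, sub_neg_eq_add, abs_of_nonpos (by linarith)]; linarith
    · rw [Int.cast_neg, neg_div, abs_neg, abs_of_nonpos h,
        abs_of_nonneg (by have : (0 : ℝ) ≤ ⌊-x * M⌋ := by exact_mod_cast h1
                          positivity)]
      exact h3

/-- Rounding towards zero does not increase the `ℓ₂` norm. -/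
lemma exists_mem_grid {S : Finset (Fin (p + 1))} {M : ℕ} (hM : 0 < M) {v : Vec p}
    (hv : ∀ j ∉ S, v j = 0) (hv1 : l2 v ≤ 1) :
    ∃ g ∈ grid S M, (∀ j ∉ S, g j = 0) ∧ (∀ j, |v j - g j| ≤ 1 / M) ∧ l2 g ≤ l2 v := by
  classical
  choose k hk1 hk2 hk3 hk4 using fun j => exists_round hM ((abs_le_l2 v j).trans hv1)
  refine ⟨fun j => (k j : ℝ) / M, Finset.mem_image.2 ⟨k, ?_, rfl⟩, fun j hj => ?_, hk2, ?_⟩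
  · rw [Fintype.mem_piFinset]
    intro j
    split_ifs with hj
    · exact hk1 j
    · simpa using hk4 j (hv j hj)
  · simp [hk4 j (hv j hj)]
  · unfold l2
    exact Real.sqrt_le_sqrt (Finset.sum_le_sum fun j _ => sq_le_sq.2 (hk3 j))

end Grid

end DHSQR

namespace DHSQR

/-! ### The empirical processes -/

section Processes

variable {p : ℕ}

/-- A summand of `D̂_{1,b} v`, coordinate `j`. -/
noncomputable def kerFun (K : ℝ → ℝ) (b : ℝ) (β v : Vec p) (j : Fin (p + 1)) (z : Vec p × ℝ) : ℝ :=
  Kh K b (resid β z.1 z.2) * (z.1 j * (z.1 ⬝ᵥ v))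

/-- A summand of the score at `β`, coordinate `j`. -/
noncomputable def scoreFun (τ : ℝ) (β : Vec p) (j : Fin (p + 1)) (z : Vec p × ℝ) : ℝ :=
  (indNonpos (resid β z.1 z.2) - τ) * z.1 j

/-- A summand of the increment of the score from `β₀` to `β`, coordinate `j`. -/
noncomputable def incrFun (β₀ β : Vec p) (j : Fin (p + 1)) (z : Vec p × ℝ) : ℝ :=
  (indNonpos (resid β z.1 z.2) - indNonpos (resid β₀ z.1 z.2)) * z.1 j

/-- The weight `|x_j|` of the observations in the slab `|y - xᵀβ| ≤ η`; it dominates the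
oscillation of a summand of the score around `β`. -/
noncomputable def slabFun (η : ℝ) (β : Vec p) (j : Fin (p + 1)) (z : Vec p × ℝ) : ℝ :=
  (if |resid β z.1 z.2| ≤ η then 1 else 0) * |z.1 j|

lemma measurable_resid (β : Vec p) : Measurable fun z : Vec p × ℝ => resid β z.1 z.2 := by
  unfold resid; fun_prop

lemma measurable_kerFun {K : ℝ → ℝ} (hK : IsSmoothingKernel K) (b : ℝ) (β v : Vec p)
    (j : Fin (p + 1)) : Measurable (kerFun K b β v j) :=
  ((measurable_Kh hK b).comp (measurable_resid β)).mul (by fun_prop)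

lemma measurable_scoreFun (τ : ℝ) (β : Vec p) (j : Fin (p + 1)) : Measurable (scoreFun τ β j) :=
  ((measurable_indNonpos.comp (measurable_resid β)).sub_const _).mul (by fun_prop)

lemma measurable_indIncr (β₀ β : Vec p) : Measurable fun z : Vec p × ℝ =>
    indNonpos (resid β z.1 z.2) - indNonpos (resid β₀ z.1 z.2) :=
  (measurable_indNonpos.comp (measurable_resid β)).sub
    (measurable_indNonpos.comp (measurable_resid β₀))

lemma measurable_incrFun (β₀ β : Vec p) (j : Fin (p + 1)) : Measurable (incrFun β₀ β j) :=
  (measurable_indIncr β₀ β).mul (by fun_prop)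

lemma measurable_slab (η : ℝ) (β : Vec p) : Measurable fun z : Vec p × ℝ =>
    (if |resid β z.1 z.2| ≤ η then (1 : ℝ) else 0) :=
  Measurable.ite (measurableSet_le (measurable_resid β).norm measurable_const)
    measurable_const measurable_const

lemma measurable_slabFun (η : ℝ) (β : Vec p) (j : Fin (p + 1)) : Measurable (slabFun η β j) :=
  (measurable_slab η β).mul (by fun_prop)

lemma abs_indNonpos_sub_le_one (e e' : ℝ) : |indNonpos e - indNonpos e'| ≤ 1 := by
  unfold indNonpos; split_ifs <;> norm_num

/-- The two indicators differ only for `y` between `xᵀβ₀` and `xᵀβ`. -/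
lemma lintegral_indIncr_le (β₀ β : Vec p) (x : Vec p) :
    ∫⁻ y, ENNReal.ofReal |indNonpos (resid β x y) - indNonpos (resid β₀ x y)| ≤
      ENNReal.ofReal |x ⬝ᵥ (β - β₀)| := by
  have h : ∀ y, ENNReal.ofReal |indNonpos (resid β x y) - indNonpos (resid β₀ x y)| ≤
      (Set.uIoc (x ⬝ᵥ β₀) (x ⬝ᵥ β)).indicator 1 y := by
    intro y
    by_cases hy : y ∈ Set.uIoc (x ⬝ᵥ β₀) (x ⬝ᵥ β)
    · rw [Set.indicator_of_mem hy, Pi.one_apply]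
      exact ENNReal.ofReal_le_one.2 (abs_indNonpos_sub_le_one _ _)
    · rw [Set.indicator_of_notMem hy]
      have : indNonpos (resid β x y) = indNonpos (resid β₀ x y) := by
        rw [Set.mem_uIoc, not_or, not_and_or, not_and_or] at hy
        unfold indNonpos resid
        obtain ⟨h1, h2⟩ := hy
        congr 1
        simp only [eq_iff_iff]
        constructor <;> intro h <;> rcases h1 with h1 | h1 <;> rcases h2 with h2 | h2 <;> linarith
      simp [this]
  refine (lintegral_mono h).trans ?_
  rw [lintegral_indicator_one measurableSet_uIoc, Real.volume_uIoc, dotProduct_sub]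

lemma lintegral_slab_le {η : ℝ} (β : Vec p) (x : Vec p) :
    ∫⁻ y, ENNReal.ofReal |if |resid β x y| ≤ η then (1 : ℝ) else 0| ≤
      ENNReal.ofReal (2 * η) := by
  have h : ∀ y, ENNReal.ofReal |if |resid β x y| ≤ η then (1 : ℝ) else 0| =
      (Set.Icc (x ⬝ᵥ β - η) (x ⬝ᵥ β + η)).indicator 1 y := by
    intro y
    have : |resid β x y| ≤ η ↔ y ∈ Set.Icc (x ⬝ᵥ β - η) (x ⬝ᵥ β + η) := by
      unfold resid
      rw [abs_le, Set.mem_Icc]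
      constructor <;> rintro ⟨h1, h2⟩ <;> constructor <;> linarith
    by_cases hy : |resid β x y| ≤ η
    · rw [if_pos hy, Set.indicator_of_mem (this.1 hy)]; simp
    · rw [if_neg hy, Set.indicator_of_notMem (fun h => hy (this.2 h))]; simp
  simp only [h]
  rw [lintegral_indicator_one measurableSet_Icc, Real.volume_Icc]
  exact le_of_eq (by congr 1; ring)

/-! ### Discretization -/

lemma abs_dot_le_card {S : Finset (Fin (p + 1))} {x v : Vec p} {T c : ℝ} (hv : ∀ j ∉ S, v j = 0)
    (hvc : ∀ j, |v j| ≤ c) (hx : ∀ j, |x j| ≤ T) : |x ⬝ᵥ v| ≤ S.card * (T * c) := by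
  have hT : 0 ≤ T := (abs_nonneg _).trans (hx 0)
  rw [dotProduct, ← Finset.sum_subset (Finset.subset_univ S) fun j _ hj => by simp [hv j hj],
    ← nsmul_eq_mul]
  refine (Finset.abs_sum_le_sum_abs _ _).trans (Finset.sum_le_card_nsmul _ _ _ fun j _ => ?_)
  rw [abs_mul]
  exact mul_le_mul (hx j) (hvc j) (abs_nonneg _) hT

lemma kerFun_sub_le {K : ℝ → ℝ} {B b : ℝ} (hb : 0 < b) (hK0 : ∀ u, 0 ≤ K u) (hB : 0 ≤ B)
    (hKB : ∀ u, K u ≤ B) (hKL : ∀ u v, |K u - K v| ≤ B * |u - v|) {β β' v v' : Vec p}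
    {j : Fin (p + 1)} {z : Vec p × ℝ} {T d e : ℝ} (hx : |z.1 j| ≤ T)
    (h1 : |z.1 ⬝ᵥ (β - β')| ≤ d) (h2 : |z.1 ⬝ᵥ v| ≤ e) (h3 : |z.1 ⬝ᵥ (v - v')| ≤ d) :
    |kerFun K b β v j z - kerFun K b β' v' j z| ≤ B / b ^ 2 * d * (T * e) + B / b * (T * d) := by
  have hT : 0 ≤ T := (abs_nonneg _).trans hx
  have hd : 0 ≤ d := (abs_nonneg _).trans h1
  have he : 0 ≤ e := (abs_nonneg _).trans h2
  have e1 : |Kh K b (resid β z.1 z.2) - Kh K b (resid β' z.1 z.2)| ≤ B / b ^ 2 * d := by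
    unfold Kh
    rw [← sub_div, abs_div, abs_of_pos hb, div_le_iff₀ hb]
    refine (hKL _ _).trans ?_
    rw [← sub_div, abs_div, abs_of_pos hb]
    have : |resid β z.1 z.2 - resid β' z.1 z.2| ≤ d := by
      unfold resid
      rw [show z.2 - z.1 ⬝ᵥ β - (z.2 - z.1 ⬝ᵥ β') = -(z.1 ⬝ᵥ (β - β')) by
        rw [dotProduct_sub]; ring, abs_neg]
      exact h1
    calc B * (|resid β z.1 z.2 - resid β' z.1 z.2| / b) ≤ B * (d / b) := by gcongr
      _ = _ := by field_simp
  have e2 : |Kh K b (resid β' z.1 z.2)| ≤ B / b := by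
    unfold Kh
    rw [abs_of_nonneg (div_nonneg (hK0 _) hb.le)]
    exact div_le_div_of_nonneg_right (hKB _) hb.le
  have e3 : kerFun K b β v j z - kerFun K b β' v' j z =
      (Kh K b (resid β z.1 z.2) - Kh K b (resid β' z.1 z.2)) * (z.1 j * (z.1 ⬝ᵥ v)) +
      Kh K b (resid β' z.1 z.2) * (z.1 j * (z.1 ⬝ᵥ (v - v'))) := by
    unfold kerFun
    rw [dotProduct_sub]; ring
  rw [e3]
  refine (abs_add_le _ _).trans ?_
  simp only [abs_mul]
  gcongr

/-- Outside the slab the indicator does not change between `β'` and `β`. -/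
lemma scoreFun_sub_le {τ η : ℝ} {β β' : Vec p} {j : Fin (p + 1)} {z : Vec p × ℝ}
    (h : |z.1 ⬝ᵥ (β - β')| ≤ η) : |scoreFun τ β j z - scoreFun τ β' j z| ≤ slabFun η β' j z := by
  unfold scoreFun slabFun
  rw [← sub_mul, abs_mul]
  refine mul_le_mul_of_nonneg_right ?_ (abs_nonneg _)
  rw [sub_sub_sub_cancel_right]
  split_ifs with hs
  · exact abs_indNonpos_sub_le_one _ _
  · have : indNonpos (resid β z.1 z.2) = indNonpos (resid β' z.1 z.2) := by
      have e : resid β z.1 z.2 = resid β' z.1 z.2 - z.1 ⬝ᵥ (β - β') := by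
        unfold resid; rw [dotProduct_sub]; ring
      rw [abs_le] at h hs
      unfold indNonpos
      congr 1
      rw [e, eq_iff_iff]
      constructor
      · intro h3
        by_contra h4
        exact hs ⟨by linarith, by linarith [h.2]⟩
      · intro h3
        by_contra h4
        exact hs ⟨by linarith [h.1], by linarith [h.1, h.2]⟩
    simp [this]

end Processes

namespace Experiment

variable {E : Experiment}

lemma abs_empMean_sub_le {I : Finset (Fin (E.m * E.n))} {φ ψ χ : Vec E.p × ℝ → ℝ} {ω : E.Ω}
    (h : ∀ i ∈ I, |φ (E.X i ω, E.Y i ω) - ψ (E.X i ω, E.Y i ω)| ≤ χ (E.X i ω, E.Y i ω)) :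
    |E.empMean I φ ω - E.empMean I ψ ω| ≤ E.empMean I χ ω := by
  unfold empMean
  rw [← mul_sub, ← Finset.sum_sub_distrib, abs_mul, abs_of_nonneg (by positivity)]
  gcongr
  exact (Finset.abs_sum_le_sum_abs _ _).trans (Finset.sum_le_sum h)

lemma empMean_const {I : Finset (Fin (E.m * E.n))} (hI : I.Nonempty) (c : ℝ) (ω : E.Ω) :
    E.empMean I (fun _ => c) ω = c := by
  have : (I.card : ℝ) ≠ 0 := by exact_mod_cast hI.card_pos.ne'
  unfold empMean
  rw [Finset.sum_const, nsmul_eq_mul, inv_mul_cancel_left₀ this]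

lemma score_apply (τ : ℝ) (β : Vec E.p) (ω : E.Ω) (j : Fin (E.p + 1)) :
    score τ (fun i => E.X i ω) (fun i => E.Y i ω) β j =
      E.empMean Finset.univ (scoreFun τ β j) ω := by
  simp [score, empMean, scoreFun, Finset.sum_apply]

lemma card_machineOne (hm : 1 ≤ E.m) :
    (machineOne E.n : Finset (Fin (E.m * E.n))).card = E.n := by
  unfold machineOne
  rw [Fin.card_filter_val_lt, min_eq_right]
  exact Nat.le_mul_of_pos_left _ hm

lemma Dlocal_apply {K : ℝ → ℝ} (hK : ∀ u, 0 ≤ K u) (hm : 1 ≤ E.m) (β v : Vec E.p) (ω : E.Ω)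
    (j : Fin (E.p + 1)) :
    (Dlocal K E.n E.b (fun i => E.X i ω) (fun i => E.Y i ω) β *ᵥ v) j =
      E.empMean (machineOne E.n) (kerFun K E.b β v j) ω := by
  rw [Dlocal_mulVec_apply hK E.b_pos, empMean, card_machineOne hm]
  rfl

/-- The event on which the local matrix `D̂_{1,b}` and the score are uniformly close to their
population versions, over the vectors `β` supported on `S` in the ball of radius `R` about `β*`. -/
def GoodSample (E : Experiment) (K : ℝ → ℝ) (τ A₁ A₂ R : ℝ) (ω : E.Ω) : Prop :=
  ∀ β : Vec E.p, (∀ j ∉ E.pop.S, β j = 0) → l2 (β - E.pop.beta) ≤ R →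
    (∀ v : Vec E.p, (∀ j ∉ E.pop.S, v j = 0) → ∀ j,
      |(Dlocal K E.n E.b (fun i => E.X i ω) (fun i => E.Y i ω) β *ᵥ v) j - (E.pop.Info *ᵥ v) j| ≤
        A₁ * E.b * l2 v) ∧
    ∀ j, |score τ (fun i => E.X i ω) (fun i => E.Y i ω) β j
        - (E.pop.Info *ᵥ (β - E.pop.beta)) j| ≤
      A₂ * (E.rate + l2 (β - E.pop.beta) ^ 2)

/-- The scales of an experiment for which the concentration bounds are effective: the bandwidth and
the radius `R` are small, and the local bandwidth is large enough, `n b³ ≥ κ s log N`, for the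
deviations of `D̂_{1,b}` to be of the order `b` of its bias. -/
structure EffectiveScale (E : Experiment) (Q : Constants) (R κ small : ℝ) : Prop where
  N_ge : 3 ≤ E.N
  s_pos : 1 ≤ E.pop.s
  s_le : E.pop.s ≤ E.N
  dim : (E.p : ℝ) + 1 ≤ (E.N : ℝ) ^ (Q.ν + 1)
  b_le : E.b ≤ small
  inv_le_b : 1 / (E.N : ℝ) ≤ E.b
  cube_le : κ * (E.pop.s * Real.log E.N) ≤ E.n * E.b ^ 3
  R_nonneg : 0 ≤ R
  R_le : R ≤ E.b
  R_mul_le : (R + 2 / E.N) * E.pop.s ≤ small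
  rate_mul_le : E.pop.s * E.rate ≤ small
  log_le : (Q.ν + 3) * Real.log E.N ≤ 2 * expRate Q * (E.N : ℝ) ^ 2

/-- Passage from the grid to all vectors. When the covariates are bounded by `N`, the mesh `N⁻⁸`
makes the discretization error of the kernel, which is multiplied by `b⁻²` and a power of `N`, at
most of order `b`. The score is discontinuous; its oscillation is bounded by the weight of a slab
around a grid point. -/
lemma goodSample_of_grid {K : ℝ → ℝ} (hK : IsSmoothingKernel K) {Q : Constants}
    (hD : E.pop.Regular Q) {B : ℝ} (hB : 0 < B) (hKB : ∀ u, K u ≤ B)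
    (hKL : ∀ u v, |K u - K v| ≤ B * |u - v|) {R κ small c₁ c₂ : ℝ}
    (hE : EffectiveScale E Q R κ small) (hsmall : small ≤ 1) {ω : E.Ω}
    (hint : ∀ (g v : Vec E.p) (j : Fin (E.p + 1)), l2 v ≤ 1 →
      Integrable (kerFun K E.b (E.pop.beta + g) v j) E.pop.law)
    (hslab : ∀ (η : ℝ) (g : Vec E.p) (j : Fin (E.p + 1)), 0 ≤ η →
      ∫ z, slabFun η (E.pop.beta + g) j z ∂E.pop.law ≤ 12 * densBound Q * momC Q * η)
    (hX : ∀ i j, |E.X i ω j| ≤ E.N)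
    (h1 : ∀ g ∈ grid E.pop.S (E.N ^ 8), l2 g ≤ R → ∀ v ∈ grid E.pop.S (E.N ^ 8), l2 v ≤ 1 →
      ∀ j, |E.empMean (machineOne E.n) (kerFun K E.b (E.pop.beta + g) v j) ω -
        ∫ z, kerFun K E.b (E.pop.beta + g) v j z ∂E.pop.law| ≤ c₁ * E.b)
    (h2 : ∀ j, |E.empMean Finset.univ (scoreFun Q.τ E.pop.beta j) ω -
        ∫ z, scoreFun Q.τ E.pop.beta j z ∂E.pop.law| ≤ c₂ * E.rate)
    (h3 : ∀ g ∈ grid E.pop.S (E.N ^ 8), l2 g ≤ R → ∀ j,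
      |E.empMean Finset.univ (incrFun E.pop.beta (E.pop.beta + g) j) ω -
        ∫ z, incrFun E.pop.beta (E.pop.beta + g) j z ∂E.pop.law| ≤ E.rate)
    (h4 : ∀ g ∈ grid E.pop.S (E.N ^ 8), l2 g ≤ R → ∀ j,
      |E.empMean Finset.univ
          (slabFun (E.pop.s * (E.N / (E.N : ℝ) ^ 8)) (E.pop.beta + g) j) ω -
        ∫ z, slabFun (E.pop.s * (E.N / (E.N : ℝ) ^ 8)) (E.pop.beta + g) j z ∂E.pop.law| ≤
        E.rate) :
    E.GoodSample K Q.τ (c₁ + 9 * densBound Q * momC Q * ((∫ u, |u| * K u) + 1) + 2 * B +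
      6 * densBound Q * momC Q) (2 + c₂ + 24 * densBound Q * momC Q) R ω := by
  have hC0 : 0 < densBound Q * momC Q :=
    mul_pos (zero_lt_one.trans_le (one_le_densBound Q)) (momC_pos Q)
  have hk1 : 0 ≤ ∫ u, |u| * K u := integral_nonneg fun u => mul_nonneg (abs_nonneg _) (hK.nonneg _)
  have hNpos : 0 < E.N := by have := hE.N_ge; omega
  have hN3 : (3 : ℝ) ≤ E.N := by exact_mod_cast hE.N_ge
  have hN0 : (0 : ℝ) < E.N := by linarith
  have hN1 : (1 : ℝ) ≤ E.N := by linarith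
  have hs : (E.pop.s : ℝ) ≤ E.N := by exact_mod_cast hE.s_le
  have hs0 : (0 : ℝ) ≤ E.pop.s := Nat.cast_nonneg _
  have hm : 1 ≤ E.m := by
    rcases Nat.eq_zero_or_pos E.m with h | h
    · simp [N, h] at hNpos
    · exact h
  have hn : 1 ≤ E.n := by
    rcases Nat.eq_zero_or_pos E.n with h | h
    · simp [N, h] at hNpos
    · exact h
  have hb := E.b_pos
  have hbN : 1 / E.b ≤ E.N := by
    rw [div_le_comm₀ hb hN0]; exact hE.inv_le_b
  have hM : 0 < E.N ^ 8 := by positivity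
  have hR1 : R ≤ 1 := hE.R_le.trans (hE.b_le.trans hsmall)
  have hI1 : (machineOne E.n : Finset (Fin (E.m * E.n))).Nonempty := by
    rw [← Finset.card_pos, card_machineOne hm]; exact hn
  have hβS : ∀ j ∉ E.pop.S, E.pop.beta j = 0 := fun j hj => by
    by_contra h; exact hj (mem_supp.2 h)
  have hrate : 1 / (E.N : ℝ) ≤ E.rate := by
    have hlog : 1 ≤ Real.log E.N := by
      rw [Real.le_log_iff_exp_le hN0]
      linarith [Real.exp_one_lt_d9]
    refine Real.le_sqrt_of_sq_le ?_
    rw [div_pow, one_pow]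
    refine div_le_div₀ (by linarith) hlog hN0 ?_
    nlinarith
  set ε : ℝ := 1 / ((E.N ^ 8 : ℕ) : ℝ) with hε
  have hε' : ε = 1 / (E.N : ℝ) ^ 8 := by rw [hε]; push_cast; rfl
  have hε0 : 0 < ε := by rw [hε']; positivity
  intro β hβ hβR
  obtain ⟨g, hg, hgS, hgε, hgl⟩ := exists_mem_grid (S := E.pop.S) hM (v := β - E.pop.beta)
    (fun j hj => by simp [hβ j hj, hβS j hj]) (hβR.trans hR1)
  have hgR := hgl.trans hβR
  set β' := E.pop.beta + g with hβ'
  have hββ' : β - β' = (β - E.pop.beta) - g := by rw [hβ']; abel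
  have hββ'S : ∀ j ∉ E.pop.S, (β - β') j = 0 := fun j hj => by
    rw [hββ']; simp [hβ j hj, hβS j hj, hgS j hj]
  have hββ'ε : ∀ j, |(β - β') j| ≤ ε := fun j => by rw [hββ']; exact hgε j
  have hβ'g : β' - E.pop.beta = g := by rw [hβ']; abel
  have hdot : ∀ (i : Fin (E.m * E.n)) (u : Vec E.p), (∀ j ∉ E.pop.S, u j = 0) →
      (∀ j, |u j| ≤ ε) → |E.X i ω ⬝ᵥ u| ≤ E.pop.s * (E.N * ε) := fun i u hu huε =>
    abs_dot_le_card hu huε (hX i)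
  have hsε : √(E.pop.s : ℝ) * ε ≤ 1 / E.N := by
    have h5 : √(E.pop.s : ℝ) ≤ E.N := by
      rw [Real.sqrt_le_iff]
      exact ⟨hN0.le, by nlinarith⟩
    calc √(E.pop.s : ℝ) * ε ≤ E.N * ε := by gcongr
      _ = 1 / (E.N : ℝ) ^ 7 := by rw [hε']; field_simp
      _ ≤ 1 / E.N := by
          gcongr
          exact le_self_pow₀ hN1 (by norm_num)
  constructor
  · -- it suffices to treat vectors in the unit ball
    have hunit : ∀ v : Vec E.p, (∀ j ∉ E.pop.S, v j = 0) → l2 v ≤ 1 → ∀ j,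
        |E.empMean (machineOne E.n) (kerFun K E.b β v j) ω - (E.pop.Info *ᵥ v) j| ≤
        (c₁ + 9 * densBound Q * momC Q * ((∫ u, |u| * K u) + 1) + 2 * B +
          6 * densBound Q * momC Q) * E.b := by
      intro v hv hv1 j
      obtain ⟨v', hv', hv'S, hv'ε, hv'l⟩ := exists_mem_grid hM hv hv1
      have hv'1 := hv'l.trans hv1
      have hvS : ∀ j ∉ E.pop.S, (v - v') j = 0 := fun j hj => by simp [hv j hj, hv'S j hj]
      have e1 := h1 g hg hgR v' hv' hv'1 j
      have e2 := Population.kernel_bias hK hD hb β' v' j (hint g v' j hv'1)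
      have e3 := Population.abs_Info_mulVec_le hD (v - v') j
      have e4 : l2 (v - v') ≤ 1 / E.N := (l2_le_sqrt_card_mul hvS hε0.le hv'ε).trans hsε
      have e5 : |E.empMean (machineOne E.n) (kerFun K E.b β v j) ω -
          E.empMean (machineOne E.n) (kerFun K E.b β' v' j) ω| ≤ 2 * B * E.b := by
        refine (abs_empMean_sub_le (χ := fun _ => 2 * B * E.b) fun i _ => ?_).trans
          (empMean_const hI1 _ _).le
        refine (kerFun_sub_le (z := (E.X i ω, E.Y i ω)) hb hK.nonneg hB.le hKB hKL (hX i j)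
          (hdot i _ hββ'S hββ'ε)
          (abs_dot_le_card (c := 1) hv (fun j => (abs_le_l2 v j).trans hv1) (hX i))
          (hdot i _ hvS hv'ε)).trans ?_
        have hNε : E.pop.s * (E.N * ε) ≤ (E.N : ℝ) ^ 2 * ε := by
          rw [sq, mul_assoc]; gcongr
        have t1 : B / E.b ^ 2 * (E.pop.s * (E.N * ε)) * (E.N * (E.pop.s * (E.N * 1))) ≤
            B * E.b := by
          calc B / E.b ^ 2 * (E.pop.s * (E.N * ε)) * (E.N * (E.pop.s * (E.N * 1)))
              ≤ B / E.b ^ 2 * ((E.N : ℝ) ^ 2 * ε) * (E.N * (E.N * (E.N * 1))) := by gcongr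
            _ = B * (1 / E.b) ^ 2 * ((E.N : ℝ) ^ 5 * ε) := by ring
            _ ≤ B * (E.N : ℝ) ^ 2 * ((E.N : ℝ) ^ 5 * ε) := by gcongr
            _ = B * (1 / E.N) := by rw [hε']; field_simp
            _ ≤ B * E.b := by gcongr; exact hE.inv_le_b
        have t2 : B / E.b * (E.N * (E.pop.s * (E.N * ε))) ≤ B * E.b := by
          calc B / E.b * (E.N * (E.pop.s * (E.N * ε)))
              ≤ B / E.b * (E.N * ((E.N : ℝ) ^ 2 * ε)) := by gcongr
            _ = B * (1 / E.b) * ((E.N : ℝ) ^ 3 * ε) := by ring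
            _ ≤ B * E.N * ((E.N : ℝ) ^ 3 * ε) := by gcongr
            _ = B * (1 / (E.N : ℝ) ^ 4) := by rw [hε']; field_simp
            _ ≤ B * (1 / E.N) := by
                gcongr
                exact le_self_pow₀ hN1 (by norm_num)
            _ ≤ B * E.b := by gcongr; exact hE.inv_le_b
        change B / E.b ^ 2 * (E.pop.s * (E.N * ε)) * (E.N * (E.pop.s * (E.N * 1))) +
          B / E.b * (E.N * (E.pop.s * (E.N * ε))) ≤ _
        linarith
      -- discretization, deviation, bias, and the change of `I v` under discretization
      have e6 : E.empMean (machineOne E.n) (kerFun K E.b β v j) ω - (E.pop.Info *ᵥ v) j =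
          (E.empMean (machineOne E.n) (kerFun K E.b β v j) ω -
            E.empMean (machineOne E.n) (kerFun K E.b β' v' j) ω) +
          (E.empMean (machineOne E.n) (kerFun K E.b β' v' j) ω -
            ∫ z, kerFun K E.b β' v' j z ∂E.pop.law) +
          (∫ z, kerFun K E.b β' v' j z ∂E.pop.law - (E.pop.Info *ᵥ v') j) -
          (E.pop.Info *ᵥ (v - v')) j := by
        rw [mulVec_sub, Pi.sub_apply]; ring
      have e7 : 9 * densBound Q * momC Q * (E.b * (∫ u, |u| * K u) + l2 (β' - E.pop.beta)) * l2 v' ≤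
          9 * densBound Q * momC Q * ((∫ u, |u| * K u) + 1) * E.b := by
        rw [hβ'g]
        have h8 : E.b * (∫ u, |u| * K u) + l2 g ≤ ((∫ u, |u| * K u) + 1) * E.b := by
          linarith [hgR, hE.R_le]
        have h9 := l2_nonneg v'
        have h10 := l2_nonneg g
        calc _ ≤ 9 * densBound Q * momC Q * (((∫ u, |u| * K u) + 1) * E.b) * 1 := by
              have : 0 ≤ 9 * densBound Q * momC Q := by linarith
              gcongr
          _ = _ := by ring
      have e8 : 6 * densBound Q * momC Q * l2 (v - v') ≤ 6 * densBound Q * momC Q * E.b := by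
        have : 0 ≤ 6 * densBound Q * momC Q := by linarith
        gcongr
        exact e4.trans hE.inv_le_b
      rw [e6]
      refine (abs_sub _ _).trans ((add_le_add_left ((abs_add_le _ _).trans
        (add_le_add_left (abs_add_le _ _) _)) _).trans ?_)
      have e9 := e2.trans e7
      have e10 := e3.trans e8
      unfold kerFun at e9 e1 e5 ⊢
      linarith
    -- by homogeneity, the bound extends to all `v`
    intro v hv j
    rw [Dlocal_apply hK.nonneg hm]
    rcases (l2_nonneg v).eq_or_lt with h0 | h0
    · have hv0 := eq_zero_of_l2_eq_zero h0.symm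
      rw [← h0, hv0]
      simp [empMean, kerFun]
    · have h5 := hunit ((l2 v)⁻¹ • v) (fun j hj => by simp [hv j hj]) (by
        rw [l2_smul, abs_of_pos (inv_pos.2 h0), inv_mul_cancel₀ h0.ne']) j
      have h6 : E.empMean (machineOne E.n) (kerFun K E.b β ((l2 v)⁻¹ • v) j) ω =
          (l2 v)⁻¹ * E.empMean (machineOne E.n) (kerFun K E.b β v j) ω := by
        unfold empMean kerFun
        simp only [dotProduct_smul, smul_eq_mul, Finset.mul_sum]
        exact Finset.sum_congr rfl fun i _ => by ring
      rw [h6, mulVec_smul, Pi.smul_apply, smul_eq_mul, ← mul_sub, abs_mul,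
        abs_of_pos (inv_pos.2 h0), inv_mul_eq_div, div_le_iff₀ h0] at h5
      exact h5
  · intro j
    rw [score_apply]
    have hη0 : 0 ≤ (E.pop.s : ℝ) * (E.N / (E.N : ℝ) ^ 8) := by positivity
    have hηε : (E.pop.s : ℝ) * (E.N / (E.N : ℝ) ^ 8) = E.pop.s * (E.N * ε) := by
      rw [hε']; ring
    have hη : (E.pop.s : ℝ) * (E.N / (E.N : ℝ) ^ 8) ≤ E.rate := by
      refine le_trans ?_ hrate
      calc (E.pop.s : ℝ) * (E.N / (E.N : ℝ) ^ 8) ≤ E.N * (E.N / (E.N : ℝ) ^ 8) := by gcongr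
        _ = 1 / (E.N : ℝ) ^ 6 := by field_simp
        _ ≤ 1 / E.N := by
            gcongr
            exact le_self_pow₀ hN1 (by norm_num)
    set η := (E.pop.s : ℝ) * (E.N / (E.N : ℝ) ^ 8)
    have e1 := h3 g hg hgR j
    have e2 := h2 j
    have e3 := h4 g hg hgR j
    have e4 := hslab η g j hη0
    have e5 := Population.score_bias hD β' j
    have e6 := Population.score_bias hD E.pop.beta j
    have e7 := Population.abs_Info_mulVec_le hD (β - β') j
    have e8 : |E.empMean Finset.univ (scoreFun Q.τ β j) ω -
        E.empMean Finset.univ (scoreFun Q.τ β' j) ω| ≤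
        E.empMean Finset.univ (slabFun η β' j) ω :=
      abs_empMean_sub_le fun i _ => scoreFun_sub_le (z := (E.X i ω, E.Y i ω)) (by
        rw [hηε]; exact hdot i _ hββ'S hββ'ε)
    -- the score at `β'` is split into its value at `β*`, of order `rate`, and the increment, whose
    -- variance is small
    have e9 : E.empMean Finset.univ (scoreFun Q.τ β' j) ω =
        E.empMean Finset.univ (incrFun E.pop.beta β' j) ω +
        E.empMean Finset.univ (scoreFun Q.τ E.pop.beta j) ω := by
      unfold empMean
      rw [← mul_add, ← Finset.sum_add_distrib]
      congr 1
      exact Finset.sum_congr rfl fun i _ => by unfold incrFun scoreFun; ring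
    have e10 : ∫ z, incrFun E.pop.beta β' j z ∂E.pop.law =
        ∫ z, scoreFun Q.τ β' j z ∂E.pop.law - ∫ z, scoreFun Q.τ E.pop.beta j z ∂E.pop.law := by
      unfold scoreFun
      rw [← integral_sub (Population.integrable_score hD _ j)
        (Population.integrable_score hD _ j)]
      exact integral_congr_ae (ae_of_all _ fun z => by unfold incrFun; ring)
    have e11 : l2 (β - β') ≤ E.rate :=
      ((l2_le_sqrt_card_mul hββ'S hε0.le hββ'ε).trans hsε).trans hrate
    have e12 : (E.pop.Info *ᵥ (β - E.pop.beta)) j =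
        (E.pop.Info *ᵥ (β' - E.pop.beta)) j + (E.pop.Info *ᵥ (β - β')) j := by
      rw [← Pi.add_apply, ← mulVec_add]; congr 2; abel
    have e13 : 6 * densBound Q * momC Q * l2 (β' - E.pop.beta) ^ 2 ≤
        6 * (densBound Q * momC Q) * l2 (β - E.pop.beta) ^ 2 := by
      rw [hβ'g, mul_assoc 6]
      have := l2_nonneg g
      gcongr
    have e14 : 6 * densBound Q * momC Q * l2 (β - β') ≤ 6 * (densBound Q * momC Q) * E.rate := by
      rw [mul_assoc 6]
      gcongr
    have e15 : 12 * densBound Q * momC Q * η ≤ 12 * (densBound Q * momC Q) * E.rate := by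
      rw [mul_assoc 12]
      gcongr
    rw [sub_self, mulVec_zero, Pi.zero_apply, sub_zero] at e6
    have hl0 : l2 (0 : Vec E.p) = 0 := by simp [l2]
    rw [hl0] at e6
    have hr0 : 0 ≤ E.rate := Real.sqrt_nonneg _
    rw [e10] at e1
    rw [e9] at e8
    change |∫ z, scoreFun Q.τ β' j z ∂E.pop.law - _| ≤ _ at e5
    change |∫ z, scoreFun Q.τ E.pop.beta j z ∂E.pop.law| ≤ _ at e6
    rw [e12]
    have hq0 := sq_nonneg (l2 (β - E.pop.beta))
    have hmul : 0 ≤ (densBound Q * momC Q) * l2 (β - E.pop.beta) ^ 2 := by positivity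
    have hmul2 : 0 ≤ (c₂ * E.rate) := (abs_nonneg _).trans e2
    have hc2 : 0 ≤ c₂ := nonneg_of_mul_nonneg_left hmul2
      (lt_of_lt_of_le (by positivity : 0 < 1 / (E.N : ℝ)) hrate)
    have hmul3 : 0 ≤ c₂ * l2 (β - E.pop.beta) ^ 2 := by positivity
    rw [abs_le] at e1 e2 e3 e5 e6 e7 e8 ⊢
    obtain ⟨e1a, e1b⟩ := e1
    obtain ⟨e2a, e2b⟩ := e2
    obtain ⟨e3a, e3b⟩ := e3
    obtain ⟨e5a, e5b⟩ := e5
    obtain ⟨e6a, e6b⟩ := e6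
    obtain ⟨e7a, e7b⟩ := e7
    obtain ⟨e8a, e8b⟩ := e8
    have hmul4 : 0 ≤ (densBound Q * momC Q) * E.rate := by positivity
    have hexp : (2 + c₂ + 24 * densBound Q * momC Q) * (E.rate + l2 (β - E.pop.beta) ^ 2) =
        2 * E.rate + c₂ * E.rate + 24 * (densBound Q * momC Q * E.rate) +
        2 * l2 (β - E.pop.beta) ^ 2 + c₂ * l2 (β - E.pop.beta) ^ 2 +
        24 * (densBound Q * momC Q * l2 (β - E.pop.beta) ^ 2) := by ring
    rw [hexp]
    constructor <;> linarith

end Experiment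

end DHSQR

namespace DHSQR

namespace Experiment

/-! ### Probability of a good sample -/

/-- The event that one of the empirical means of a finite family deviates by at least `t` from its
expectation. -/
def deviation {T : Type*} (E : Experiment) (I : Finset (Fin (E.m * E.n))) (F : Finset T)
    (φ : T → Vec E.p × ℝ → ℝ) (t : ℝ) : Set E.Ω :=
  {ω | ∃ τ ∈ F, t ≤ |E.empMean I (φ τ) ω - ∫ z, φ τ z ∂E.pop.law|}

lemma lt_of_notMem_deviation {T : Type*} {E : Experiment} {I : Finset (Fin (E.m * E.n))}
    {F : Finset T} {φ : T → Vec E.p × ℝ → ℝ} {t : ℝ} {ω : E.Ω} (h : ω ∉ E.deviation I F φ t)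
    {τ : T} (hτ : τ ∈ F) : |E.empMean I (φ τ) ω - ∫ z, φ τ z ∂E.pop.law| < t := by
  by_contra! h'
  exact h ⟨τ, hτ, h'⟩

lemma mul_two_exp_neg_le {c x L e : ℝ} (hc : c ≤ Real.exp x) (h : x + L ≤ e) :
    c * (2 * Real.exp (-e)) ≤ 2 * Real.exp (-L) := by
  calc c * (2 * Real.exp (-e)) ≤ Real.exp x * (2 * Real.exp (-e)) := by gcongr
    _ = 2 * Real.exp (x - e) := by rw [mul_left_comm, ← Real.exp_add]; rfl
    _ ≤ _ := by gcongr; linarith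

variable {E : Experiment} {Q : Constants}

lemma covariate_tail (hD : E.pop.Regular Q) {T : ℝ} (hT : 0 < T) (i : Fin (E.m * E.n))
    (j : Fin (E.p + 1)) :
    E.P.real {ω | T < |E.X i ω j|} ≤ 2 * Real.exp (-(2 * expRate Q * T ^ 2)) := by
  have hA := expRate_pos Q
  have h1 := Population.tail_le hD (l2_single j).le (t := 2 * √(expRate Q) * T) (by positivity)
  rw [← E.law_eq i, Measure.map_apply (measurable_obs i)
    (measurableSet_le measurable_const (by fun_prop))] at h1
  have h2 : E.P {ω | T < |E.X i ω j|} ≤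
      ENNReal.ofReal (2 * Real.exp (-(2 * expRate Q * T ^ 2))) := by
    refine (measure_mono ?_).trans (h1.trans (le_of_eq ?_))
    · intro ω hω
      simp only [Set.mem_ofPred_eq, Set.mem_preimage, dotProduct_single_one] at hω ⊢
      exact mul_le_mul_of_nonneg_left hω.le (by positivity)
    · congr 3
      rw [mul_pow, mul_pow, Real.sq_sqrt hA.le]; ring
  rw [measureReal_def]
  exact ENNReal.toReal_le_of_le_ofReal (by positivity) h2

namespace EffectiveScale

variable {R κ small : ℝ}

lemma N_pos (hE : EffectiveScale E Q R κ small) : (0 : ℝ) < E.N := by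
  have : 0 < E.N := by have := hE.N_ge; omega
  exact_mod_cast this

lemma N_real_ge (hE : EffectiveScale E Q R κ small) : (3 : ℝ) ≤ E.N := by
  exact_mod_cast hE.N_ge

lemma m_pos (hE : EffectiveScale E Q R κ small) : 1 ≤ E.m := by
  have hN := hE.N_pos
  rcases Nat.eq_zero_or_pos E.m with h | h
  · simp [N, h] at hN
  · exact h

lemma n_pos (hE : EffectiveScale E Q R κ small) : 1 ≤ E.n := by
  have hN := hE.N_pos
  rcases Nat.eq_zero_or_pos E.n with h | h
  · simp [N, h] at hN
  · exact h

lemma one_le_log (hE : EffectiveScale E Q R κ small) : 1 ≤ Real.log E.N := by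
  rw [Real.le_log_iff_exp_le hE.N_pos]
  linarith [Real.exp_one_lt_d9, hE.N_real_ge]

lemma one_le_s (hE : EffectiveScale E Q R κ small) : (1 : ℝ) ≤ E.pop.s := by
  exact_mod_cast hE.s_pos

lemma rate_pos (hE : EffectiveScale E Q R κ small) : 0 < E.rate :=
  Real.sqrt_pos.2 (div_pos (by linarith [hE.one_le_log]) hE.N_pos)

lemma N_mul_rate_sq (hE : EffectiveScale E Q R κ small) : E.N * E.rate ^ 2 = Real.log E.N := by
  have := hE.N_pos
  have := hE.one_le_log
  unfold rate
  rw [Real.sq_sqrt (by positivity)]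
  field_simp

lemma rate_le (hE : EffectiveScale E Q R κ small) : E.rate ≤ small :=
  (le_mul_of_one_le_left hE.rate_pos.le hE.one_le_s).trans hE.rate_mul_le

lemma machineOne_nonempty (hE : EffectiveScale E Q R κ small) :
    (machineOne E.n : Finset (Fin (E.m * E.n))).Nonempty := by
  rw [← Finset.card_pos, card_machineOne hE.m_pos]; exact hE.n_pos

lemma card_univ_eq : ((Finset.univ : Finset (Fin (E.m * E.n))).card : ℝ) = E.N := by
  rw [Finset.card_univ, Fintype.card_fin]; rfl

lemma univ_nonempty (hE : EffectiveScale E Q R κ small) :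
    (Finset.univ : Finset (Fin (E.m * E.n))).Nonempty := by
  have h := hE.N_pos
  rw [← card_univ_eq] at h
  exact Finset.card_pos.1 (by exact_mod_cast h)

lemma card_grid_le_exp (hE : EffectiveScale E Q R κ small) :
    ((grid E.pop.S (E.N ^ 8)).card : ℝ) ≤ Real.exp (10 * (E.pop.s * Real.log E.N)) := by
  have hN0 := hE.N_pos
  have hN3 := hE.N_real_ge
  have h1 : ((grid E.pop.S (E.N ^ 8)).card : ℝ) ≤ ((2 * (E.N : ℝ) ^ 8 + 1) ^ E.pop.s) := by
    exact_mod_cast card_grid_le E.pop.S (E.N ^ 8)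
  refine h1.trans ?_
  have h2 : 2 * (E.N : ℝ) ^ 8 + 1 ≤ Real.exp (10 * Real.log E.N) := by
    have h3 : Real.exp (10 * Real.log E.N) = (E.N : ℝ) ^ 10 := by
      rw [show (10 : ℝ) * Real.log E.N = ((10 : ℕ) : ℝ) * Real.log E.N by norm_num,
        Real.exp_nat_mul, Real.exp_log hN0]
    rw [h3]
    have h4 : (1 : ℝ) ≤ (E.N : ℝ) ^ 8 := one_le_pow₀ (by linarith)
    have h5 : (9 : ℝ) ≤ (E.N : ℝ) ^ 2 := by nlinarith
    calc 2 * (E.N : ℝ) ^ 8 + 1 ≤ 9 * (E.N : ℝ) ^ 8 := by linarith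
      _ ≤ (E.N : ℝ) ^ 2 * (E.N : ℝ) ^ 8 := by gcongr
      _ = _ := by ring
  calc (2 * (E.N : ℝ) ^ 8 + 1) ^ E.pop.s ≤ Real.exp (10 * Real.log E.N) ^ E.pop.s := by gcongr
    _ = _ := by rw [← Real.exp_nat_mul]; congr 1; ring

lemma card_coords_le_exp (hE : EffectiveScale E Q R κ small) :
    ((Finset.univ : Finset (Fin (E.p + 1))).card : ℝ) ≤
      Real.exp ((Q.ν + 1) * Real.log E.N) := by
  rw [Finset.card_univ, Fintype.card_fin]
  push_cast
  refine hE.dim.trans (le_of_eq ?_)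
  rw [Real.rpow_def_of_pos hE.N_pos, mul_comm]

/-- The exponent `22 + ν` beats the cardinality of the index sets: `10 s log N` for each of the two
grids, and `(ν + 1) log N` for the coordinates. -/
lemma exponent_le (hE : EffectiveScale E Q R κ small) :
    20 * (E.pop.s * Real.log E.N) + (Q.ν + 1) * Real.log E.N + Real.log E.N ≤
      (22 + Q.ν) * (E.pop.s * Real.log E.N) := by
  have h1 : Real.log E.N ≤ E.pop.s * Real.log E.N :=
    le_mul_of_one_le_left (by linarith [hE.one_le_log]) hE.one_le_s
  have h2 := mul_le_mul_of_nonneg_left h1 (by linarith [Q.ν_pos] : 0 ≤ Q.ν + 2)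
  linarith

end EffectiveScale

/-- The grid points in the ball of radius `r`. -/
noncomputable def gridBall (E : Experiment) (r : ℝ) : Finset (Vec E.p) :=
  (grid E.pop.S (E.N ^ 8)).filter fun g => l2 g ≤ r

lemma mem_gridBall {r : ℝ} {g : Vec E.p} :
    g ∈ E.gridBall r ↔ g ∈ grid E.pop.S (E.N ^ 8) ∧ l2 g ≤ r := Finset.mem_filter

lemma card_gridBall_le {R κ small : ℝ} (hE : EffectiveScale E Q R κ small) (r : ℝ) :
    ((E.gridBall r).card : ℝ) ≤ Real.exp (10 * (E.pop.s * Real.log E.N)) :=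
  le_trans (by exact_mod_cast Finset.card_filter_le _ _) hE.card_grid_le_exp

/-- The deviations of the local matrix are of order `b`: the Bernstein exponent is
`n b² / (1 / b) = n b³`, which is at least `κ s log N`. -/
lemma kernel_deviation {K : ℝ → ℝ} (hK : IsSmoothingKernel K) (hD : E.pop.Regular Q) {B : ℝ}
    (hB : 0 < B) (hKB : ∀ u, K u ≤ B) {R κ small c : ℝ} (hκ : 0 < κ)
    (hE : EffectiveScale E Q R κ small) (hc : 0 < c)
    (hcsq : c ^ 2 = 12 * (densBound Q * momC Q) * B * (22 + Q.ν) / κ)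
    (hsmall : small ≤ 3 * (densBound Q * momC Q) * expRate Q / c) :
    E.P.real (E.deviation (machineOne E.n)
      (E.gridBall R ×ˢ E.gridBall 1 ×ˢ (Finset.univ : Finset (Fin (E.p + 1))))
      (fun q => kerFun K E.b (E.pop.beta + q.1) q.2.1 q.2.2) (c * E.b)) ≤
      2 * Real.exp (-Real.log E.N) := by
  have hA := expRate_pos Q
  have hM := momC_pos Q
  have hdB : 0 < densBound Q := zero_lt_one.trans_le (one_le_densBound Q)
  have hν := Q.ν_pos
  have hb := E.b_pos
  have hvar : ∀ q ∈ E.gridBall R ×ˢ E.gridBall 1 ×ˢ (Finset.univ : Finset (Fin (E.p + 1))),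
      Integrable (fun z => kerFun K E.b (E.pop.beta + q.1) q.2.1 q.2.2 z ^ 2 *
        Real.exp (E.b * (expRate Q / (2 * B)) *
          |kerFun K E.b (E.pop.beta + q.1) q.2.1 q.2.2 z|)) E.pop.law ∧
      ∫ z, kerFun K E.b (E.pop.beta + q.1) q.2.1 q.2.2 z ^ 2 *
        Real.exp (E.b * (expRate Q / (2 * B)) *
          |kerFun K E.b (E.pop.beta + q.1) q.2.1 q.2.2 z|) ∂E.pop.law ≤
        3 * densBound Q * momC Q * B / E.b := fun q hq =>
    Population.kernel_variance hK hD hB hKB hb (E.pop.beta + q.1)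
      (mem_gridBall.1 (Finset.mem_product.1 (Finset.mem_product.1 hq).2).1).2 q.2.2 rfl
  refine (empMean_tail_union
    (E.gridBall R ×ˢ E.gridBall 1 ×ˢ (Finset.univ : Finset (Fin (E.p + 1))))
    (φ := fun q => kerFun K E.b (E.pop.beta + q.1) q.2.1 q.2.2)
    (fun q _ => measurable_kerFun hK _ _ _ _)
    (a := E.b * (expRate Q / (2 * B))) (by positivity)
    (V := 3 * densBound Q * momC Q * B / E.b) (by positivity)
    (fun q hq => (hvar q hq).1) (fun q hq => (hvar q hq).2)
    (by positivity) ?_ _ hE.machineOne_nonempty).trans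
    (mul_two_exp_neg_le (x := 20 * (E.pop.s * Real.log E.N) + (Q.ν + 1) * Real.log E.N) ?_ ?_)
  · have h1 : c * E.b ≤ 3 * (densBound Q * momC Q) * expRate Q := by
      have := hE.b_le.trans hsmall
      rw [le_div_iff₀ hc] at this; linarith
    refine h1.trans (le_of_eq ?_)
    field_simp
  · rw [Finset.card_product, Finset.card_product]
    push_cast
    calc _ ≤ Real.exp (10 * (E.pop.s * Real.log E.N)) *
          (Real.exp (10 * (E.pop.s * Real.log E.N)) * Real.exp ((Q.ν + 1) * Real.log E.N)) := by
          have h1 := card_gridBall_le hE R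
          have h2 := card_gridBall_le hE 1
          have h3 := hE.card_coords_le_exp
          gcongr
      _ = _ := by rw [← Real.exp_add, ← Real.exp_add]; ring_nf
  · refine hE.exponent_le.trans ?_
    rw [card_machineOne hE.m_pos]
    have h1 : (E.n : ℝ) * (c * E.b) ^ 2 / (4 * (3 * densBound Q * momC Q * B / E.b)) =
        (22 + Q.ν) / κ * (E.n * E.b ^ 3) := by
      rw [mul_pow, hcsq]; field_simp; ring
    rw [h1]
    calc (22 + Q.ν) * (E.pop.s * Real.log E.N)
        = (22 + Q.ν) / κ * (κ * (E.pop.s * Real.log E.N)) := by field_simp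
      _ ≤ _ := mul_le_mul_of_nonneg_left hE.cube_le (by positivity)

/-- The deviations of the score at `β*` are of order `√(log N / N)`; no grid is needed here, so
that the sparsity does not enter. -/
lemma score_deviation (hD : E.pop.Regular Q) {R κ small c : ℝ}
    (hE : EffectiveScale E Q R κ small) (hc : 0 < c)
    (hcsq : c ^ 2 = 12 * momC Q * (22 + Q.ν)) (hsmall : small ≤ 3 * expRate Q * momC Q / c) :
    E.P.real (E.deviation Finset.univ (Finset.univ : Finset (Fin (E.p + 1)))
      (fun j => scoreFun Q.τ E.pop.beta j) (c * E.rate)) ≤ 2 * Real.exp (-Real.log E.N) := by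
  have hA := expRate_pos Q
  have hM := momC_pos Q
  have hν := Q.ν_pos
  have hr := hE.rate_pos
  have hvar : ∀ j : Fin (E.p + 1), _ := fun j => Population.score_variance hD j
    (measurable_scoreFun Q.τ E.pop.beta j) (fun z => by
      have h1 : |indNonpos (resid E.pop.beta z.1 z.2) - Q.τ| ≤ 1 := by
        have := Q.τ_pos
        have := Q.τ_lt
        unfold indNonpos
        split_ifs <;> rw [abs_le] <;> constructor <;> linarith
      unfold scoreFun
      rw [abs_mul]
      exact mul_le_of_le_one_left (abs_nonneg _) h1)
  refine (empMean_tail_union _ (fun j _ => measurable_scoreFun _ _ _)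
    (a := expRate Q / 2) (by positivity) (V := 3 * momC Q) (by positivity)
    (fun j _ => (hvar j).1) (fun j _ => (hvar j).2) (by positivity) ?_ _
    hE.univ_nonempty).trans (mul_two_exp_neg_le hE.card_coords_le_exp ?_)
  · have := hE.rate_le.trans hsmall
    rw [le_div_iff₀ hc] at this; linarith
  · have h1 : (E.N : ℝ) * (c * E.rate) ^ 2 / (4 * (3 * momC Q)) =
        (22 + Q.ν) * (E.N * E.rate ^ 2) := by
      rw [mul_pow, hcsq]; field_simp; ring
    rw [EffectiveScale.card_univ_eq, h1, hE.N_mul_rate_sq]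
    linarith [hE.one_le_log]

/-- Uniformly over the grid the deviations of the increments of the score are at most
`√(log N / N)`, too: the logarithm `s log N` of the cardinality of the grid is
compensated by a variance proxy of order `1 / s`. -/
lemma indicator_deviation {R κ small : ℝ} (hE : EffectiveScale E Q R κ small)
    (hsmall : small ≤ expRate Q / (4 * (22 + Q.ν))) {φ : Vec E.p × Fin (E.p + 1) → Vec E.p × ℝ → ℝ}
    (hφ : ∀ q, Measurable (φ q))
    (hvar : ∀ q : Vec E.p × Fin (E.p + 1), l2 q.1 ≤ R →
      Integrable (fun z => φ q z ^ 2 * Real.exp (expRate Q / 2 * |φ q z|)) E.pop.law ∧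
      ∫ z, φ q z ^ 2 * Real.exp (expRate Q / 2 * |φ q z|) ∂E.pop.law ≤
        1 / (4 * (22 + Q.ν) * E.pop.s)) :
    E.P.real (E.deviation Finset.univ
      (E.gridBall R ×ˢ (Finset.univ : Finset (Fin (E.p + 1)))) φ E.rate) ≤
        2 * Real.exp (-Real.log E.N) := by
  have hA := expRate_pos Q
  have hν := Q.ν_pos
  have hs := hE.one_le_s
  refine (empMean_tail_union (E.gridBall R ×ˢ (Finset.univ : Finset (Fin (E.p + 1))))
    (fun q _ => hφ q) (a := expRate Q / 2) (by positivity)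
    (V := 1 / (4 * (22 + Q.ν) * E.pop.s)) (by positivity)
    (fun q hq => (hvar q (mem_gridBall.1 (Finset.mem_product.1 hq).1).2).1)
    (fun q hq => (hvar q (mem_gridBall.1 (Finset.mem_product.1 hq).1).2).2)
    hE.rate_pos ?_ _ hE.univ_nonempty).trans
    (mul_two_exp_neg_le (x := 20 * (E.pop.s * Real.log E.N) + (Q.ν + 1) * Real.log E.N) ?_ ?_)
  · have h1 := hE.rate_mul_le.trans hsmall
    rw [le_div_iff₀ (by positivity)] at h1
    rw [mul_one_div, le_div_iff₀ (by positivity)]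
    linarith
  · rw [Finset.card_product]
    push_cast
    calc _ ≤ Real.exp (10 * (E.pop.s * Real.log E.N)) * Real.exp ((Q.ν + 1) * Real.log E.N) := by
          have h1 := card_gridBall_le hE R
          have h3 := hE.card_coords_le_exp
          gcongr
      _ = Real.exp (10 * (E.pop.s * Real.log E.N) + (Q.ν + 1) * Real.log E.N) := by
          rw [← Real.exp_add]
      _ ≤ _ := by
          have : 0 ≤ E.pop.s * Real.log E.N :=
            mul_nonneg (by linarith) (by linarith [hE.one_le_log])
          gcongr; norm_num
  · refine hE.exponent_le.trans (le_of_eq ?_)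
    rw [EffectiveScale.card_univ_eq, hE.N_mul_rate_sq]
    field_simp

/-- With high probability all the covariates are bounded by `N`. -/
lemma covariate_deviation (hD : E.pop.Regular Q) {R κ small : ℝ}
    (hE : EffectiveScale E Q R κ small) :
    E.P.real (⋃ q ∈ (Finset.univ : Finset (Fin (E.m * E.n) × Fin (E.p + 1))),
      {ω | (E.N : ℝ) < |E.X q.1 ω q.2|}) ≤ 2 * Real.exp (-Real.log E.N) := by
  refine (measureReal_biUnion_finset_le _ _).trans
    ((Finset.sum_le_card_nsmul _ _ _ fun q _ => covariate_tail hD hE.N_pos q.1 q.2).trans ?_)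
  rw [nsmul_eq_mul]
  refine mul_two_exp_neg_le (x := (Q.ν + 2) * Real.log E.N) ?_ ?_
  · rw [Finset.card_univ, Fintype.card_prod, Fintype.card_fin]
    push_cast
    calc (E.m : ℝ) * E.n * (Fintype.card (Fin (E.p + 1)) : ℝ)
        = E.N * ((Finset.univ : Finset (Fin (E.p + 1))).card : ℝ) := by
          rw [Finset.card_univ, N]; push_cast; ring
      _ ≤ Real.exp (Real.log E.N) * Real.exp ((Q.ν + 1) * Real.log E.N) := by
          rw [Real.exp_log hE.N_pos]
          exact mul_le_mul_of_nonneg_left hE.card_coords_le_exp hE.N_pos.le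
      _ = _ := by rw [← Real.exp_add]; congr 1; ring
  · have := hE.log_le
    linarith

lemma incr_variance (hD : E.pop.Regular Q) (g : Vec E.p) (j : Fin (E.p + 1)) :
    Integrable (fun z => incrFun E.pop.beta (E.pop.beta + g) j z ^ 2 *
      Real.exp (expRate Q / 2 * |incrFun E.pop.beta (E.pop.beta + g) j z|)) E.pop.law ∧
    ∫ z, incrFun E.pop.beta (E.pop.beta + g) j z ^ 2 *
      Real.exp (expRate Q / 2 * |incrFun E.pop.beta (E.pop.beta + g) j z|) ∂E.pop.law ≤
      3 * densBound Q * momC Q * l2 g := by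
  obtain ⟨u, hu, hgu⟩ := exists_unit g
  have h1 := Population.indicator_variance hD (measurable_indIncr E.pop.beta (E.pop.beta + g))
    (fun z => abs_indNonpos_sub_le_one _ _) hu (l2_nonneg g) le_rfl (fun x => by
      refine (lintegral_indIncr_le E.pop.beta (E.pop.beta + g) x).trans (le_of_eq ?_)
      rw [add_sub_cancel_left, add_zero]
      conv_lhs => rw [hgu, dotProduct_smul, smul_eq_mul, abs_mul, abs_of_nonneg (l2_nonneg g)])
    j (measurable_incrFun E.pop.beta (E.pop.beta + g) j) (fun z => rfl)
  rw [add_zero] at h1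
  exact ⟨h1.1, h1.2.1⟩

lemma slab_variance (hD : E.pop.Regular Q) {η : ℝ} (hη : 0 ≤ η) (g : Vec E.p)
    (j : Fin (E.p + 1)) :
    Integrable (fun z => slabFun η (E.pop.beta + g) j z ^ 2 *
      Real.exp (expRate Q / 2 * |slabFun η (E.pop.beta + g) j z|)) E.pop.law ∧
    ∫ z, slabFun η (E.pop.beta + g) j z ^ 2 *
      Real.exp (expRate Q / 2 * |slabFun η (E.pop.beta + g) j z|) ∂E.pop.law ≤
      3 * densBound Q * momC Q * (2 * η) ∧
    ∫ z, |slabFun η (E.pop.beta + g) j z| ∂E.pop.law ≤ 6 * densBound Q * momC Q * (2 * η) := by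
  have h1 := Population.indicator_variance hD (measurable_slab η (E.pop.beta + g))
    (fun z => by split_ifs <;> simp) (u := 0) (by simp [l2]) le_rfl
    (r₂ := 2 * η) (by positivity) (fun x => by
      refine (lintegral_slab_le (E.pop.beta + g) x).trans (le_of_eq ?_)
      rw [zero_mul, zero_add])
    j (measurable_slabFun η (E.pop.beta + g) j) (fun z => by
      unfold slabFun
      rw [abs_mul, abs_abs, abs_mul])
  simpa only [zero_add] using h1

/-- A sample is good with probability at least `1 - 10 / N`: Bernstein's inequality for four
families of empirical means, and the bound on the covariates. The constants do not depend on the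
experiment. -/
lemma goodSample_prob {K : ℝ → ℝ} (hK : IsSmoothingKernel K) (Q : Constants) {κ : ℝ}
    (hκ : 0 < κ) : ∃ A₁ A₂ small : ℝ, 0 ≤ A₁ ∧ 0 ≤ A₂ ∧ 0 < small ∧
      ∀ (E : Experiment) (R : ℝ), E.pop.Regular Q → EffectiveScale E Q R κ small →
        E.P.real {ω | ¬ GoodSample E K Q.τ A₁ A₂ R ω} ≤ 10 / E.N := by
  obtain ⟨B, hB, hKB, hKL⟩ := exists_kernel_bound hK
  have hA := expRate_pos Q
  have hM := momC_pos Q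
  have hdB : 0 < densBound Q := zero_lt_one.trans_le (one_le_densBound Q)
  have hν := Q.ν_pos
  have hc₁p : 0 < √(12 * (densBound Q * momC Q) * B * (22 + Q.ν) / κ) :=
    Real.sqrt_pos.2 (by positivity)
  have hc₁sq := Real.sq_sqrt (show 0 ≤ 12 * (densBound Q * momC Q) * B * (22 + Q.ν) / κ by
    positivity)
  have hc₂p : 0 < √(12 * momC Q * (22 + Q.ν)) := Real.sqrt_pos.2 (by positivity)
  have hc₂sq := Real.sq_sqrt (show 0 ≤ 12 * momC Q * (22 + Q.ν) by positivity)
  generalize √(12 * (densBound Q * momC Q) * B * (22 + Q.ν) / κ) = c₁ at hc₁p hc₁sq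
  generalize √(12 * momC Q * (22 + Q.ν)) = c₂ at hc₂p hc₂sq
  have hk1 : 0 ≤ ∫ u, |u| * K u := integral_nonneg fun u => mul_nonneg (abs_nonneg _) (hK.nonneg _)
  obtain ⟨small, hs0, hs1, hs2, hs3, hs4, hs5⟩ : ∃ small : ℝ, 0 < small ∧ small ≤ 1 ∧
      small ≤ 3 * (densBound Q * momC Q) * expRate Q / c₁ ∧
      small ≤ 3 * expRate Q * momC Q / c₂ ∧ small ≤ expRate Q / (4 * (22 + Q.ν)) ∧
      small ≤ 1 / (12 * (densBound Q * momC Q) * (22 + Q.ν)) :=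
    ⟨min 1 (min (3 * (densBound Q * momC Q) * expRate Q / c₁)
      (min (3 * expRate Q * momC Q / c₂) (min (expRate Q / (4 * (22 + Q.ν)))
      (1 / (12 * (densBound Q * momC Q) * (22 + Q.ν)))))), by positivity,
      by simp, by simp, by simp, by simp, by simp⟩
  refine ⟨c₁ + 9 * densBound Q * momC Q * ((∫ u, |u| * K u) + 1) + 2 * B +
    6 * densBound Q * momC Q, 2 + c₂ + 24 * densBound Q * momC Q, small, by positivity,
    by positivity, hs0, ?_⟩
  intro E R hD hE
  have hN0 := hE.N_pos
  have hη0 : 0 ≤ (E.pop.s : ℝ) * (E.N / (E.N : ℝ) ^ 8) := by positivity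
  have hηN : (E.pop.s : ℝ) * (E.N / (E.N : ℝ) ^ 8) ≤ 1 / E.N := by
    have hs : (E.pop.s : ℝ) ≤ E.N := by exact_mod_cast hE.s_le
    calc (E.pop.s : ℝ) * (E.N / (E.N : ℝ) ^ 8) ≤ E.N * (E.N / (E.N : ℝ) ^ 8) := by gcongr
      _ = 1 / (E.N : ℝ) ^ 6 := by field_simp
      _ ≤ 1 / E.N := by
          gcongr
          exact le_self_pow₀ (by linarith [hE.N_real_ge]) (by norm_num)
  have hV : 3 * densBound Q * momC Q * (R + 2 / E.N) ≤ 1 / (4 * (22 + Q.ν) * E.pop.s) := by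
    have h1 := hE.R_mul_le.trans hs5
    have := hE.one_le_s
    rw [le_div_iff₀ (by positivity)] at h1 ⊢
    linarith
  have hR0 := hE.R_nonneg
  have hd1 := kernel_deviation hK hD hB hKB hκ hE hc₁p hc₁sq hs2
  have hd2 := score_deviation hD hE hc₂p hc₂sq hs3
  have hd3 := indicator_deviation hE hs4
    (φ := fun q => incrFun E.pop.beta (E.pop.beta + q.1) q.2) (fun q => measurable_incrFun _ _ _)
    fun q hq => ⟨(incr_variance hD q.1 q.2).1, (incr_variance hD q.1 q.2).2.trans (le_trans (by
      gcongr
      have : (0 : ℝ) ≤ 2 / E.N := by positivity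
      linarith) hV)⟩
  have hd4 := indicator_deviation hE hs4
    (φ := fun q => slabFun (E.pop.s * (E.N / (E.N : ℝ) ^ 8)) (E.pop.beta + q.1) q.2)
    (fun q => measurable_slabFun _ _ _)
    fun q _ => ⟨(slab_variance hD hη0 q.1 q.2).1, (slab_variance hD hη0 q.1 q.2).2.1.trans
      (le_trans (by
        gcongr
        rw [show (2 : ℝ) / E.N = 2 * (1 / E.N) by ring]
        linarith) hV)⟩
  have hd5 := covariate_deviation hD hE
  have hsub : {ω | ¬ GoodSample E K Q.τ (c₁ + 9 * densBound Q * momC Q * ((∫ u, |u| * K u) + 1) +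
      2 * B + 6 * densBound Q * momC Q) (2 + c₂ + 24 * densBound Q * momC Q) R ω} ⊆
      (((E.deviation (machineOne E.n)
        (E.gridBall R ×ˢ E.gridBall 1 ×ˢ (Finset.univ : Finset (Fin (E.p + 1))))
        (fun q => kerFun K E.b (E.pop.beta + q.1) q.2.1 q.2.2) (c₁ * E.b) ∪
      E.deviation Finset.univ (Finset.univ : Finset (Fin (E.p + 1)))
        (fun j => scoreFun Q.τ E.pop.beta j) (c₂ * E.rate)) ∪
      E.deviation Finset.univ (E.gridBall R ×ˢ (Finset.univ : Finset (Fin (E.p + 1))))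
        (fun q => incrFun E.pop.beta (E.pop.beta + q.1) q.2) E.rate) ∪
      E.deviation Finset.univ (E.gridBall R ×ˢ (Finset.univ : Finset (Fin (E.p + 1))))
        (fun q => slabFun (E.pop.s * (E.N / (E.N : ℝ) ^ 8)) (E.pop.beta + q.1) q.2) E.rate) ∪
      (⋃ q ∈ (Finset.univ : Finset (Fin (E.m * E.n) × Fin (E.p + 1))),
        {ω | (E.N : ℝ) < |E.X q.1 ω q.2|}) := by
    intro ω hω
    by_contra hcon
    rw [Set.mem_union, Set.mem_union, Set.mem_union, Set.mem_union, not_or, not_or, not_or,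
      not_or] at hcon
    obtain ⟨⟨⟨⟨g1, g2⟩, g3⟩, g4⟩, g5⟩ := hcon
    refine hω (goodSample_of_grid hK hD hB hKB hKL hE hs1 ?_ ?_ ?_ ?_ ?_ ?_ ?_)
    · exact fun g v j hv => integrable_of_exp_moment
        (mul_nonneg E.b_pos.le (by positivity)) (measurable_kerFun hK _ _ _ _)
        (Population.kernel_variance hK hD hB hKB E.b_pos (E.pop.beta + g) hv j rfl).1
    · intro η' g j hη'
      refine le_trans (le_of_eq (integral_congr_ae (ae_of_all _ fun z => ?_)))
        ((slab_variance hD hη' g j).2.2.trans (le_of_eq (by ring)))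
      exact (abs_of_nonneg (mul_nonneg (by split_ifs <;> norm_num) (abs_nonneg _))).symm
    · intro i j
      by_contra! h
      exact g5 (Set.mem_biUnion (Finset.mem_coe.2 (Finset.mem_univ (i, j))) h)
    · exact fun g hg hgR v hv hv1 j => (lt_of_notMem_deviation g1 (τ := (g, v, j))
        (Finset.mem_product.2 ⟨mem_gridBall.2 ⟨hg, hgR⟩, Finset.mem_product.2
          ⟨mem_gridBall.2 ⟨hv, hv1⟩, Finset.mem_univ _⟩⟩)).le
    · exact fun j => (lt_of_notMem_deviation g2 (Finset.mem_univ j)).le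
    · exact fun g hg hgR j => (lt_of_notMem_deviation g3 (τ := (g, j)) (Finset.mem_product.2
        ⟨mem_gridBall.2 ⟨hg, hgR⟩, Finset.mem_univ _⟩)).le
    · exact fun g hg hgR j => (lt_of_notMem_deviation g4 (τ := (g, j)) (Finset.mem_product.2
        ⟨mem_gridBall.2 ⟨hg, hgR⟩, Finset.mem_univ _⟩)).le
  have hfin : 5 * (2 * Real.exp (-Real.log E.N)) = 10 / E.N := by
    rw [Real.exp_neg, Real.exp_log hN0]; ring
  rw [← hfin]
  refine (measureReal_mono hsub).trans ?_
  refine (measureReal_union_le _ _).trans ((add_le_add_left ((measureReal_union_le _ _).trans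
    (add_le_add_left ((measureReal_union_le _ _).trans
    (add_le_add_left (measureReal_union_le _ _) _)) _)) _).trans ?_)
  linarith

end Experiment

end DHSQR

namespace DHSQR

/-! ### Orders of magnitude along an admissible sequence -/

namespace Experiment

/-- `√s` times the order `(s log n / n)^{1/3}` of the local bandwidth. One iteration multiplies the
first term of `κ` by this factor. -/
noncomputable def contraction (E : Experiment) : ℝ :=
  (E.pop.s : ℝ) ^ (5 / 6 : ℝ) * (Real.log E.n / E.n) ^ (1 / 3 : ℝ)

/-- `s √(log N / n)`. One iteration multiplies the second term of `κ` by this factor. -/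
noncomputable def contraction' (E : Experiment) : ℝ := E.pop.s * √(Real.log E.N / E.n)

/-- The size relations between `m, n, p, s` and `b` that hold eventually along an admissible
sequence; `ε` is a bound for all the quantities that tend to zero. The sixth power makes
`ε` itself a bound for the roots of `s³ log N / n` that occur. -/
structure AsymptoticScale (E : Experiment) (Q : Constants) (ε : ℝ) : Prop where
  m_pos : 1 ≤ E.m
  n_ge : 3 ≤ E.n
  s_pos : 1 ≤ E.pop.s
  inv_le : 1 / ε ≤ E.n
  log_le_log : Q.c * Real.log E.N ≤ Real.log E.n
  sparse : (E.pop.s : ℝ) ^ 3 * (Real.log E.N / E.n) ≤ ε ^ 6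
  le_b : Q.bLo * (E.pop.s * Real.log E.n / E.n) ^ (1 / 3 : ℝ) ≤ E.b
  b_le : E.b ≤ Q.bHi * (E.pop.s * Real.log E.n / E.n) ^ (1 / 3 : ℝ)
  dim : (E.p : ℝ) + 1 ≤ (E.N : ℝ) ^ (Q.ν + 1)
  log_le : (Q.ν + 3) * Real.log E.N ≤ 2 * expRate Q * (E.N : ℝ) ^ 2

end Experiment

namespace IsAdmissible

variable {Q : Constants} {E : ℕ → Experiment}

lemma tendsto_N (h : IsAdmissible Q E) : Tendsto (fun k => ((E k).N : ℝ)) atTop atTop :=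
  tendsto_natCast_atTop_atTop.comp h.N_tendsto

lemma tendsto_n (h : IsAdmissible Q E) : Tendsto (fun k => ((E k).n : ℝ)) atTop atTop :=
  tendsto_atTop_mono' _ h.local_size ((tendsto_rpow_atTop Q.c_pos).comp h.tendsto_N)

lemma log_le_log (h : IsAdmissible Q E) :
    ∀ᶠ k in atTop, Q.c * Real.log (E k).N ≤ Real.log (E k).n := by
  filter_upwards [h.local_size, h.tendsto_N.eventually_ge_atTop 1] with k h1 h2
  rw [← Real.log_rpow (by linarith)]
  exact Real.log_le_log (Real.rpow_pos_of_pos (by linarith) _) h1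

/-- For `s = 0` the upper bound for the positive local bandwidth would be zero. -/
lemma s_pos (h : IsAdmissible Q E) : ∀ᶠ k in atTop, 1 ≤ (E k).pop.s := by
  filter_upwards [h.local_bandwidth] with k hk
  by_contra! hs
  have h0 : (E k).pop.s = 0 := by omega
  have := hk.2
  rw [h0] at this
  norm_num at this
  linarith [(E k).b_pos]

/-- Since `r < 1/3`, powers of the logarithm do not matter in `s³ log N / n → 0`. -/
lemma tendsto_sparse (h : IsAdmissible Q E) :
    Tendsto (fun k => ((E k).pop.s : ℝ) ^ 3 * (Real.log (E k).N / (E k).n)) atTop (𝓝 0) := by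
  have hη : 0 < 1 - 3 * Q.r := by linarith [Q.r_lt]
  have h1 : Tendsto (fun x : ℝ => Q.Cs ^ 3 / Q.c * (Real.log x / x ^ (1 - 3 * Q.r))) atTop
      (𝓝 (Q.Cs ^ 3 / Q.c * 0)) :=
    ((isLittleO_log_rpow_atTop hη).tendsto_div_nhds_zero).const_mul _
  rw [mul_zero] at h1
  refine squeeze_zero' ?_ ?_ (h1.comp h.tendsto_n)
  · filter_upwards with k
    exact mul_nonneg (by positivity) (div_nonneg (Real.log_natCast_nonneg _) (by positivity))
  · filter_upwards [h.sparsity, h.log_le_log, h.tendsto_n.eventually_ge_atTop 1] with k h2 h3 h4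
    have hn : (0 : ℝ) < (E k).n := by linarith
    have hc := Q.c_pos
    have hlog : Real.log (E k).N ≤ Real.log (E k).n / Q.c := by
      rw [le_div_iff₀ hc]; linarith
    have hs3 : ((E k).pop.s : ℝ) ^ 3 ≤ Q.Cs ^ 3 * ((E k).n : ℝ) ^ (3 * Q.r) := by
      have := pow_le_pow_left₀ (by positivity) h2 3
      rwa [mul_pow, ← Real.rpow_natCast (((E k).n : ℝ) ^ Q.r) 3, ← Real.rpow_mul hn.le,
        mul_comm Q.r] at this
    have hpos : 0 ≤ Q.Cs ^ 3 * ((E k).n : ℝ) ^ (3 * Q.r) := le_trans (by positivity) hs3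
    have hlogn : 0 ≤ Real.log (E k).N / (E k).n :=
      div_nonneg (Real.log_natCast_nonneg _) hn.le
    calc ((E k).pop.s : ℝ) ^ 3 * (Real.log (E k).N / (E k).n)
        ≤ (Q.Cs ^ 3 * ((E k).n : ℝ) ^ (3 * Q.r)) * (Real.log (E k).n / Q.c / (E k).n) :=
          mul_le_mul hs3 (div_le_div_of_nonneg_right hlog hn.le) hlogn hpos
      _ = _ := by
          simp only [Function.comp_apply]
          rw [Real.rpow_sub hn, Real.rpow_one]
          have := (Real.rpow_pos_of_pos hn (3 * Q.r)).ne'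
          field_simp

lemma eventually_scale (h : IsAdmissible Q E) {ε : ℝ} (hε : 0 < ε) :
    ∀ᶠ k in atTop, (E k).AsymptoticScale Q ε := by
  filter_upwards [h.tendsto_N.eventually_ge_atTop
      (max 1 (max (|Q.Cp| + 1) ((Q.ν + 3) / (2 * expRate Q)))),
    h.tendsto_n.eventually_ge_atTop (max 3 (1 / ε)), h.s_pos, h.log_le_log,
    h.tendsto_sparse.eventually_le_const (by positivity : (0 : ℝ) < ε ^ 6),
    h.local_bandwidth, h.dim] with k hN hn hs hlog hsp hb hdim
  simp only [max_le_iff] at hN hn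
  obtain ⟨hN1, hN2, hN3⟩ := hN
  have hA := expRate_pos Q
  have hN0 : (0 : ℝ) < (E k).N := by linarith
  refine ⟨?_, by exact_mod_cast hn.1, hs, hn.2, hlog, hsp, hb.1, hb.2, ?_, ?_⟩
  · by_contra! hm
    have h0 : (E k).m = 0 := by omega
    have : (E k).N = 0 := by simp [Experiment.N, h0]
    rw [this] at hN0; simp at hN0
  · have hp : (1 : ℝ) ≤ ((E k).N : ℝ) ^ Q.ν := Real.one_le_rpow hN1 Q.ν_pos.le
    rw [Real.rpow_add hN0, Real.rpow_one]
    calc ((E k).p : ℝ) + 1 ≤ |Q.Cp| * ((E k).N : ℝ) ^ Q.ν + ((E k).N : ℝ) ^ Q.ν :=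
          add_le_add (hdim.trans (mul_le_mul_of_nonneg_right (le_abs_self _) (by linarith))) hp
      _ = ((E k).N : ℝ) ^ Q.ν * (|Q.Cp| + 1) := by ring
      _ ≤ _ := mul_le_mul_of_nonneg_left hN2 (by linarith)
  · have h1 : Real.log (E k).N ≤ (E k).N := (Real.log_le_sub_one_of_pos hN0).trans (by linarith)
    rw [div_le_iff₀ (by positivity)] at hN3
    calc (Q.ν + 3) * Real.log (E k).N ≤ ((E k).N * (2 * expRate Q)) * (E k).N :=
          mul_le_mul hN3 h1 (Real.log_natCast_nonneg _) (by positivity)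
      _ = _ := by ring

end IsAdmissible

namespace Experiment

/-- `((s log n / n)^{1/3})³ = s log n / n`. -/
lemma order_pow_three (E : Experiment) :
    ((E.pop.s * Real.log E.n / E.n) ^ (1 / 3 : ℝ)) ^ 3 = E.pop.s * Real.log E.n / E.n := by
  have := Real.log_natCast_nonneg E.n
  rw [← Real.rpow_natCast, ← Real.rpow_mul (by positivity)]
  norm_num

lemma aN_sq (E : Experiment) : E.aN ^ 2 = E.pop.s * (Real.log E.N / E.n) := by
  have := Real.log_natCast_nonneg E.N
  rw [aN, Real.sq_sqrt (by positivity), mul_div_assoc]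

lemma aN_nonneg (E : Experiment) : 0 ≤ E.aN := Real.sqrt_nonneg _

lemma rate_sq (E : Experiment) : E.rate ^ 2 = Real.log E.N / E.N := by
  have := Real.log_natCast_nonneg E.N
  rw [rate, Real.sq_sqrt (by positivity)]

lemma contraction_nonneg (E : Experiment) : 0 ≤ E.contraction := by
  have := Real.log_natCast_nonneg E.n
  unfold contraction; positivity

lemma contraction'_nonneg (E : Experiment) : 0 ≤ E.contraction' := by
  unfold contraction'; positivity

lemma contraction_pow_six (E : Experiment) :
    E.contraction ^ 6 = (E.pop.s : ℝ) ^ 5 * (Real.log E.n / E.n) ^ 2 := by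
  have := Real.log_natCast_nonneg E.n
  rw [contraction, mul_pow, ← Real.rpow_mul_natCast (by positivity),
    ← Real.rpow_mul_natCast (by positivity), ← Real.rpow_natCast (E.pop.s : ℝ) 5,
    ← Real.rpow_natCast (Real.log E.n / E.n) 2]
  norm_num

lemma contraction'_sq (E : Experiment) :
    E.contraction' ^ 2 = (E.pop.s : ℝ) ^ 2 * (Real.log E.N / E.n) := by
  have := Real.log_natCast_nonneg E.N
  rw [contraction', mul_pow, Real.sq_sqrt (by positivity)]

lemma sqrt_mul_order (E : Experiment) :
    √E.pop.s * (E.pop.s * Real.log E.n / E.n) ^ (1 / 3 : ℝ) = E.contraction := by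
  have := Real.log_natCast_nonneg E.n
  rcases Nat.eq_zero_or_pos E.pop.s with h0 | h0
  · simp [contraction, h0]
  have hs : (0 : ℝ) < E.pop.s := by exact_mod_cast h0
  rw [mul_div_assoc, Real.mul_rpow (by positivity) (by positivity), Real.sqrt_eq_rpow, ← mul_assoc,
    ← Real.rpow_add hs, contraction]
  norm_num

/-- Both terms of `κ` are geometric in the number of iterations. -/
lemma kappa_eq (E : Experiment) (g : ℕ) : E.kappa (5 * (g : ℝ) / 6) g g =
    max (√(Real.log E.n / E.n) * E.contraction ^ g)
      (√(Real.log E.N / E.n) * E.contraction' ^ g) := by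
  have h1 := Real.log_natCast_nonneg E.n
  have h2 := Real.log_natCast_nonneg E.N
  have h3 : (0 : ℝ) ≤ Real.log E.n / E.n := by positivity
  have h4 : (0 : ℝ) ≤ Real.log E.N / E.n := by positivity
  unfold kappa
  congr 1
  · rw [contraction, mul_pow, ← Real.rpow_natCast (_ ^ (5 / 6 : ℝ)),
      ← Real.rpow_mul (by positivity),
      ← Real.rpow_natCast (_ ^ (1 / 3 : ℝ)), ← Real.rpow_mul h3, mul_left_comm, Real.sqrt_eq_rpow,
      ← Real.rpow_add_of_nonneg h3 (by positivity) (by positivity)]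
    congr 2 <;> ring
  · rw [contraction', mul_pow, mul_left_comm, Real.rpow_natCast]
    congr 1
    rw [← Real.rpow_natCast, Real.sqrt_eq_rpow, ← Real.rpow_mul h4,
      ← Real.rpow_add_of_nonneg h4 (by positivity) (by positivity)]
    congr 1; ring

lemma kappa_nonneg (E : Experiment) (g : ℕ) : 0 ≤ E.kappa (5 * (g : ℝ) / 6) g g := by
  rw [kappa_eq]
  exact le_max_of_le_left (mul_nonneg (Real.sqrt_nonneg _) (pow_nonneg E.contraction_nonneg _))

lemma rate_le_rateIter (E : Experiment) (g : ℕ) : E.rate ≤ E.rateIter g := by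
  linarith [E.kappa_nonneg g, show E.rateIter g = E.rate + E.kappa (5 * (g : ℝ) / 6) g g from rfl]

lemma aN_le_sqrt_mul_rateIter (E : Experiment) : E.aN ≤ √E.pop.s * E.rateIter 0 := by
  rw [aN, mul_div_assoc, Real.sqrt_mul (by positivity)]
  refine mul_le_mul_of_nonneg_left ?_ (Real.sqrt_nonneg _)
  rw [rateIter, kappa_eq]
  have : (0 : ℝ) ≤ E.rate := Real.sqrt_nonneg _
  have := le_max_right (√(Real.log E.n / E.n) * E.contraction ^ 0)
    (√(Real.log E.N / E.n) * E.contraction' ^ 0)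
  rw [pow_zero, pow_zero, mul_one, mul_one] at this
  simp only [pow_zero, mul_one]
  linarith

end Experiment

namespace Experiment.AsymptoticScale

variable {E : Experiment} {Q : Constants} {ε : ℝ}

section

variable (h : E.AsymptoticScale Q ε)
include h

lemma n_pos : (0 : ℝ) < E.n := by exact_mod_cast (show 0 < E.n by have := h.n_ge; omega)

lemma one_le_s : (1 : ℝ) ≤ E.pop.s := by exact_mod_cast h.s_pos

lemma n_le_N : (E.n : ℝ) ≤ E.N := by
  exact_mod_cast (Nat.le_mul_of_pos_left E.n h.m_pos : E.n ≤ E.m * E.n)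

lemma three_le_n : (3 : ℝ) ≤ E.n := by exact_mod_cast h.n_ge

lemma one_le_log_n : 1 ≤ Real.log E.n := by
  rw [Real.le_log_iff_exp_le h.n_pos]
  linarith [Real.exp_one_lt_d9, h.three_le_n]

lemma log_n_le_log_N : Real.log E.n ≤ Real.log E.N := Real.log_le_log h.n_pos h.n_le_N

lemma one_le_log_N : 1 ≤ Real.log E.N := h.one_le_log_n.trans h.log_n_le_log_N

lemma localRate_pos : 0 < Real.log E.n / E.n := div_pos (by linarith [h.one_le_log_n]) h.n_pos

lemma localRate_le : Real.log E.n / E.n ≤ Real.log E.N / E.n :=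
  div_le_div_of_nonneg_right h.log_n_le_log_N h.n_pos.le

lemma globalRate_pos : 0 < Real.log E.N / E.n := h.localRate_pos.trans_le h.localRate_le

lemma c_mul_le : Q.c * (Real.log E.N / E.n) ≤ Real.log E.n / E.n := by
  rw [← mul_div_assoc]
  exact div_le_div_of_nonneg_right h.log_le_log h.n_pos.le

lemma bHi_pos : 0 < Q.bHi := by
  have h1 := E.b_pos.trans_le h.b_le
  exact pos_of_mul_pos_left h1 (by have := h.localRate_pos; positivity)

lemma s_mul_globalRate_le : E.pop.s * (Real.log E.N / E.n) ≤ ε ^ 6 := by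
  refine le_trans (mul_le_mul_of_nonneg_right ?_ h.globalRate_pos.le) h.sparse
  nlinarith [h.one_le_s, sq_nonneg ((E.pop.s : ℝ)), mul_self_nonneg ((E.pop.s : ℝ) - 1)]

lemma order_le (hε : 0 < ε) : (E.pop.s * Real.log E.n / E.n) ^ (1 / 3 : ℝ) ≤ ε ^ 2 := by
  refine le_of_pow_le_pow_left₀ three_ne_zero (by positivity) ?_
  rw [order_pow_three, mul_div_assoc, ← pow_mul]
  exact (mul_le_mul_of_nonneg_left h.localRate_le (by positivity)).trans h.s_mul_globalRate_le

lemma aN_le (hε : 0 < ε) : E.aN ≤ ε ^ 3 := by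
  refine le_of_pow_le_pow_left₀ two_ne_zero (by positivity) ?_
  rw [aN_sq, ← pow_mul]
  exact h.s_mul_globalRate_le

lemma s_mul_aN_le (hε : 0 < ε) : E.pop.s * E.aN ≤ ε ^ 3 := by
  refine le_of_pow_le_pow_left₀ two_ne_zero (by positivity) ?_
  rw [mul_pow, aN_sq, ← pow_mul]
  exact le_trans (le_of_eq (by ring)) h.sparse

lemma contraction'_le (hε : 0 < ε) : E.contraction' ≤ ε ^ 3 := by
  refine le_of_pow_le_pow_left₀ two_ne_zero (by positivity) ?_
  rw [contraction'_sq, ← pow_mul]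
  refine le_trans (mul_le_mul_of_nonneg_right ?_ h.globalRate_pos.le) h.sparse
  exact pow_le_pow_right₀ h.one_le_s (by norm_num)

lemma contraction_le (hε : 0 < ε) : E.contraction ≤ ε ^ 2 := by
  refine le_of_pow_le_pow_left₀ (n := 6) (by norm_num) (by positivity) ?_
  rw [contraction_pow_six]
  calc (E.pop.s : ℝ) ^ 5 * (Real.log E.n / E.n) ^ 2
      ≤ (E.pop.s : ℝ) ^ 6 * (Real.log E.N / E.n) ^ 2 :=
        mul_le_mul (pow_le_pow_right₀ h.one_le_s (by norm_num))
          (pow_le_pow_left₀ h.localRate_pos.le h.localRate_le 2) (by positivity) (by positivity)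
    _ = ((E.pop.s : ℝ) ^ 3 * (Real.log E.N / E.n)) ^ 2 := by ring
    _ ≤ (ε ^ 6) ^ 2 := pow_le_pow_left₀
        (mul_nonneg (by positivity) h.globalRate_pos.le) h.sparse 2
    _ = _ := by ring

lemma rate_le : E.rate ≤ √(Real.log E.N / E.n) :=
  Real.sqrt_le_sqrt (div_le_div_of_nonneg_left (by linarith [h.one_le_log_N]) h.n_pos h.n_le_N)

lemma sqrt_mul_b_le : √E.pop.s * E.b ≤ Q.bHi * E.contraction := by
  rw [← sqrt_mul_order]
  exact (mul_le_mul_of_nonneg_left h.b_le (Real.sqrt_nonneg _)).trans (le_of_eq (by ring))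

lemma le_b_pow_three : Q.bLo ^ 3 * (E.pop.s * (Real.log E.n / E.n)) ≤ E.b ^ 3 := by
  have := pow_le_pow_left₀ (mul_nonneg Q.bLo_pos.le
    (by have := h.localRate_pos; positivity)) h.le_b 3
  rwa [mul_pow, order_pow_three, mul_div_assoc] at this

lemma rateIter_le (hε : 0 < ε) (hε1 : ε ≤ 1) (g : ℕ) :
    E.rateIter g ≤ 2 * √(Real.log E.N / E.n) := by
  have hw := (h.contraction_le hε).trans (pow_le_one₀ hε.le hε1)
  have hz := (h.contraction'_le hε).trans (pow_le_one₀ hε.le hε1)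
  have h1 : E.kappa (5 * (g : ℝ) / 6) g g ≤ √(Real.log E.N / E.n) := by
    rw [kappa_eq]
    refine max_le ?_ ?_
    · exact (mul_le_of_le_one_right (Real.sqrt_nonneg _)
        (pow_le_one₀ E.contraction_nonneg hw)).trans (Real.sqrt_le_sqrt h.localRate_le)
    · exact mul_le_of_le_one_right (Real.sqrt_nonneg _) (pow_le_one₀ E.contraction'_nonneg hz)
  unfold rateIter
  linarith [h.rate_le]

lemma sqrt_mul_rateIter_le (hε : 0 < ε) (hε1 : ε ≤ 1) (g : ℕ) :
    √E.pop.s * E.rateIter g ≤ 2 * E.aN := by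
  have : E.aN = √E.pop.s * √(Real.log E.N / E.n) := by
    rw [aN, mul_div_assoc, Real.sqrt_mul (by positivity)]
  rw [this]
  linarith [mul_le_mul_of_nonneg_left (h.rateIter_le hε hε1 g) (Real.sqrt_nonneg E.pop.s)]

/-- One iteration improves the rate by the factor `√s b`. When `contraction' ≤ contraction` the
second term of `κ` at step `g` is absorbed by the first one at step `g + 1`, at the price
of replacing `log N` by `log n`; otherwise by the second one. -/
lemma contraction_mul_kappa_le (g : ℕ) : E.contraction * E.kappa (5 * (g : ℝ) / 6) g g ≤
    1 / √Q.c * E.kappa (5 * ((g + 1 : ℕ) : ℝ) / 6) (g + 1 : ℕ) (g + 1) := by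
  have hw := E.contraction_nonneg
  have hz := E.contraction'_nonneg
  have hc : 0 < √Q.c := Real.sqrt_pos.2 Q.c_pos
  have hc1 : √Q.c ≤ 1 := Real.sqrt_le_one.2 Q.c_lt.le
  have hL : √Q.c * √(Real.log E.N / E.n) ≤ √(Real.log E.n / E.n) := by
    rw [← Real.sqrt_mul Q.c_pos.le]; exact Real.sqrt_le_sqrt h.c_mul_le
  rw [kappa_eq, kappa_eq, div_mul_eq_mul_div, one_mul, le_div_iff₀ hc, mul_max_of_nonneg _ _ hw,
    max_mul_of_nonneg _ _ hc.le]
  refine max_le ?_ ?_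
  · refine le_trans ?_ (le_max_left _ _)
    calc _ = √Q.c * (√(Real.log E.n / E.n) * E.contraction ^ (g + 1)) := by ring
      _ ≤ _ := mul_le_of_le_one_left (by positivity) hc1
  · rcases le_total E.contraction' E.contraction with hle | hle
    · refine le_trans ?_ (le_max_left _ _)
      calc _ = (√Q.c * √(Real.log E.N / E.n)) * (E.contraction * E.contraction' ^ g) := by ring
        _ ≤ √(Real.log E.n / E.n) * (E.contraction * E.contraction ^ g) :=
          mul_le_mul hL (mul_le_mul_of_nonneg_left (pow_le_pow_left₀ hz hle g) hw)
            (by positivity) (by positivity)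
        _ = _ := by ring
    · refine le_trans ?_ (le_max_right _ _)
      calc _ = √Q.c * (√(Real.log E.N / E.n) * (E.contraction * E.contraction' ^ g)) := by ring
        _ ≤ √(Real.log E.N / E.n) * (E.contraction * E.contraction' ^ g) :=
          mul_le_of_le_one_left (by positivity) hc1
        _ ≤ √(Real.log E.N / E.n) * (E.contraction' * E.contraction' ^ g) :=
          mul_le_mul_of_nonneg_left (mul_le_mul_of_nonneg_right hle (by positivity))
            (by positivity)
        _ = _ := by ring

lemma rateIter_pos (g : ℕ) : 0 < E.rateIter g := by
  have h1 : 0 < E.rate := Real.sqrt_pos.2 (div_pos (by linarith [h.one_le_log_N])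
    (h.n_pos.trans_le h.n_le_N))
  linarith [E.kappa_nonneg g, show E.rateIter g = E.rate + E.kappa (5 * (g : ℝ) / 6) g g from rfl]

/-- One iteration takes an `ℓ₂` error of order `√s rateIter g` to an error in the linear coefficient
of the loss of order `rateIter (g + 1)`, with a constant that does not depend on `g`. -/
lemma b_mul_rateIter_le (hε : 0 < ε) (hε1 : ε ≤ 1) (g : ℕ) :
    E.b * (√E.pop.s * E.rateIter g) ≤ Q.bHi / √Q.c * E.rateIter (g + 1) := by
  have hw := (h.contraction_le hε).trans (pow_le_one₀ hε.le hε1)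
  have hc : 0 < √Q.c := Real.sqrt_pos.2 Q.c_pos
  have hc1 : √Q.c ≤ 1 := Real.sqrt_le_one.2 Q.c_lt.le
  have hr : 0 ≤ E.rate := Real.sqrt_nonneg _
  have h1 : E.contraction * E.rate ≤ 1 / √Q.c * E.rate :=
    mul_le_mul_of_nonneg_right (hw.trans (by rw [le_div_iff₀ hc]; linarith)) hr
  have h2 := h.contraction_mul_kappa_le g
  have h3 : E.contraction * E.rateIter g ≤ 1 / √Q.c * E.rateIter (g + 1) := by
    simp only [rateIter]
    push_cast at h2 ⊢
    linarith
  calc E.b * (√E.pop.s * E.rateIter g) = (√E.pop.s * E.b) * E.rateIter g := by ring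
    _ ≤ (Q.bHi * E.contraction) * E.rateIter g :=
      mul_le_mul_of_nonneg_right h.sqrt_mul_b_le (h.rateIter_pos g).le
    _ = Q.bHi * (E.contraction * E.rateIter g) := by ring
    _ ≤ Q.bHi * (1 / √Q.c * E.rateIter (g + 1)) := mul_le_mul_of_nonneg_left h3 h.bHi_pos.le
    _ = _ := by ring

end

end Experiment.AsymptoticScale

end DHSQR

namespace DHSQR

namespace Experiment.AsymptoticScale

variable {E : Experiment} {Q : Constants} {ε : ℝ}

/-- Neighbourhoods of radius `A a_N` of `β*` are in the range of the concentration bounds. -/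
lemma effectiveScale (h : E.AsymptoticScale Q ε) (hε : 0 < ε) (hε1 : ε ≤ 1) {A small : ℝ}
    (hA : 0 ≤ A) (hb : ε ≤ Q.bLo ^ 3) (hsm : ε * (|Q.bHi| + A + 3) ≤ small)
    (hR : ε * A ^ 3 ≤ Q.bLo ^ 3 * Q.c) :
    EffectiveScale E Q (A * E.aN) (Q.bLo ^ 3 * Q.c) small := by
  have hn := h.n_pos
  have hN : (0 : ℝ) < E.N := hn.trans_le h.n_le_N
  have hbl := Q.bLo_pos
  have hs := h.one_le_s
  have hsub : ε ^ 2 ≤ ε ∧ ε ^ 3 ≤ ε ∧ ε ^ 6 ≤ ε :=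
    ⟨pow_le_of_le_one hε.le hε1 (by norm_num), pow_le_of_le_one hε.le hε1 (by norm_num),
      pow_le_of_le_one hε.le hε1 (by norm_num)⟩
  have hεb := mul_nonneg hε.le (abs_nonneg Q.bHi)
  have hεA := mul_nonneg hε.le hA
  have hexp : ε * (|Q.bHi| + A + 3) = ε * |Q.bHi| + ε * A + 3 * ε := by ring
  have hsn : (E.pop.s : ℝ) ≤ ε ^ 6 * E.n := by
    have h1 := h.sparse
    rw [← mul_div_assoc, div_le_iff₀ hn] at h1
    refine le_trans ?_ h1
    calc (E.pop.s : ℝ) = E.pop.s * 1 := by ring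
      _ ≤ (E.pop.s : ℝ) ^ 3 * Real.log E.N :=
        mul_le_mul (le_self_pow₀ hs (by norm_num)) h.one_le_log_N (by norm_num) (by positivity)
  have hcube : Q.bLo ^ 3 * Q.c * (E.pop.s * (Real.log E.N / E.n)) ≤ E.b ^ 3 := by
    refine le_trans (le_of_eq ?_) ((mul_le_mul_of_nonneg_left (mul_le_mul_of_nonneg_left h.c_mul_le
      (by linarith : (0 : ℝ) ≤ E.pop.s)) (by positivity : (0 : ℝ) ≤ Q.bLo ^ 3)).trans
      h.le_b_pow_three)
    ring
  refine ⟨h.n_ge.trans (by exact_mod_cast h.n_le_N), h.s_pos, ?_, h.dim, ?_, ?_, ?_,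
    mul_nonneg hA E.aN_nonneg, ?_, ?_, ?_, h.log_le⟩
  · have : (E.pop.s : ℝ) ≤ E.N := hsn.trans ((mul_le_of_le_one_left hn.le
      (hsub.2.2.trans hε1)).trans h.n_le_N)
    exact_mod_cast this
  · calc E.b ≤ Q.bHi * ε ^ 2 := h.b_le.trans
          (mul_le_mul_of_nonneg_left (h.order_le hε) h.bHi_pos.le)
      _ ≤ |Q.bHi| * ε := mul_le_mul (le_abs_self _) hsub.1 (by positivity) (abs_nonneg _)
      _ ≤ small := by linarith
  · refine (one_div_le_one_div_of_le hn h.n_le_N).trans ?_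
    refine le_of_pow_le_pow_left₀ three_ne_zero E.b_pos.le (le_trans ?_ h.le_b_pow_three)
    have hn1 : 1 / (E.n : ℝ) ≤ ε := by
      have := h.inv_le
      rw [div_le_iff₀ hε] at this
      rw [div_le_iff₀ hn]; linarith
    have hn2 : 1 / (E.n : ℝ) ≤ 1 := hn1.trans hε1
    calc (1 / (E.n : ℝ)) ^ 3 = (1 / (E.n : ℝ)) * (1 / E.n) * (1 / E.n) := by ring
      _ ≤ Q.bLo ^ 3 * 1 * (1 / E.n) := by
        refine mul_le_mul_of_nonneg_right ?_ (by positivity)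
        exact mul_le_mul (hn1.trans hb) hn2 (by positivity) (by positivity)
      _ = Q.bLo ^ 3 * (1 * (1 / E.n)) := by ring
      _ ≤ _ := by
        refine mul_le_mul_of_nonneg_left ?_ (by positivity)
        exact mul_le_mul hs (div_le_div_of_nonneg_right h.one_le_log_n hn.le) (by positivity)
          (by linarith)
  · calc Q.bLo ^ 3 * Q.c * (E.pop.s * Real.log E.N)
        = E.n * (Q.bLo ^ 3 * Q.c * (E.pop.s * (Real.log E.N / E.n))) := by field_simp
      _ ≤ _ := mul_le_mul_of_nonneg_left hcube hn.le
  · refine le_of_pow_le_pow_left₀ three_ne_zero E.b_pos.le (le_trans ?_ hcube)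
    calc (A * E.aN) ^ 3 = (A ^ 3 * E.aN) * E.aN ^ 2 := by ring
      _ ≤ (Q.bLo ^ 3 * Q.c) * E.aN ^ 2 := by
        refine mul_le_mul_of_nonneg_right ?_ (by positivity)
        calc A ^ 3 * E.aN ≤ A ^ 3 * ε := mul_le_mul_of_nonneg_left
              ((h.aN_le hε).trans hsub.2.1) (by positivity)
          _ ≤ _ := by linarith
      _ = _ := by rw [aN_sq]
  · have h1 : A * (E.pop.s * E.aN) ≤ A * ε :=
      mul_le_mul_of_nonneg_left ((h.s_mul_aN_le hε).trans hsub.2.1) hA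
    have h2 : (E.pop.s : ℝ) / E.N ≤ ε := by
      rw [div_le_iff₀ hN]
      exact hsn.trans (mul_le_mul hsub.2.2 h.n_le_N hn.le hε.le)
    calc (A * E.aN + 2 / E.N) * E.pop.s = A * (E.pop.s * E.aN) + 2 * (E.pop.s / E.N) := by ring
      _ ≤ small := by linarith
  · calc E.pop.s * E.rate ≤ E.contraction' :=
          mul_le_mul_of_nonneg_left h.rate_le (by positivity)
      _ ≤ small := (h.contraction'_le hε).trans (by linarith)

section

variable (h : E.AsymptoticScale Q ε)
include h

lemma contraction_pos : 0 < E.contraction :=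
  mul_pos (Real.rpow_pos_of_pos (by linarith [h.one_le_s]) _)
    (Real.rpow_pos_of_pos h.localRate_pos _)

lemma contraction'_pos : 0 < E.contraction' :=
  mul_pos (by linarith [h.one_le_s]) (Real.sqrt_pos.2 h.globalRate_pos)

/-- The two lower bounds for the number of iterations, in terms of the contraction factors. -/
lemma enoughIterations_iff (hε : 0 < ε) (hε1 : ε < 1) (t : ℕ) : E.EnoughIterations t ↔
    Real.log (E.m * Real.log E.n / Real.log E.N) ≤ 2 * t * -Real.log E.contraction ∧
    Real.log E.m ≤ 2 * t * -Real.log E.contraction' := by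
  have hm : (E.m : ℝ) ≠ 0 := by have := h.m_pos; positivity
  have hN : (E.N : ℝ) = E.m * E.n := by simp [N]
  have hn := h.n_pos.ne'
  have hs : (E.pop.s : ℝ) ≠ 0 := by have := h.one_le_s; positivity
  have hl : Real.log E.n ≠ 0 := by have := h.one_le_log_n; positivity
  have hL : Real.log E.N ≠ 0 := by have := h.one_le_log_N; positivity
  have e1 : (E.N : ℝ) / E.m = E.n := by rw [hN]; field_simp
  have e2 : (E.N : ℝ) ^ 2 / ((E.m : ℝ) ^ 2 * (E.pop.s : ℝ) ^ 5 * Real.log E.n ^ 2) =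
      (E.contraction ^ 6)⁻¹ := by
    rw [contraction_pow_six, hN]; field_simp
  have e3 : (E.N : ℝ) / (E.m * (E.pop.s : ℝ) ^ 2 * Real.log E.N) = (E.contraction' ^ 2)⁻¹ := by
    have : (E.N : ℝ) / (E.m * (E.pop.s : ℝ) ^ 2 * Real.log E.N) =
        (E.N / E.m) * (1 / ((E.pop.s : ℝ) ^ 2 * Real.log E.N)) := by field_simp
    rw [contraction'_sq, this, e1]; field_simp
  have hw : 0 < -Real.log E.contraction := neg_pos.2 (Real.log_neg h.contraction_pos
    ((h.contraction_le hε).trans_lt (pow_lt_one₀ hε.le hε1 (by norm_num))))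
  have hz : 0 < -Real.log E.contraction' := neg_pos.2 (Real.log_neg h.contraction'_pos
    ((h.contraction'_le hε).trans_lt (pow_lt_one₀ hε.le hε1 (by norm_num))))
  unfold EnoughIterations
  rw [e1, e2, e3, Real.log_inv, Real.log_inv, Real.log_pow, Real.log_pow,
    div_le_iff₀ (by push_cast; linarith), div_le_iff₀ (by push_cast; linarith)]
  push_cast
  constructor <;> rintro ⟨a, b⟩ <;> constructor <;> linarith

/-- After enough iterations the remainder `κ` is dominated by the single-machine rate. -/
lemma rateIter_le_rate (hε : 0 < ε) (hε1 : ε < 1) {t : ℕ} (ht : E.EnoughIterations t) :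
    E.rateIter t ≤ 2 * E.rate := by
  rw [h.enoughIterations_iff hε hε1] at ht
  have hm : (0 : ℝ) < E.m := by have := h.m_pos; positivity
  have hN : (E.N : ℝ) = E.m * E.n := by simp [N]
  have hn := h.n_pos
  have hN0 : (0 : ℝ) < E.N := hn.trans_le h.n_le_N
  have hl : 0 < Real.log E.n := by linarith [h.one_le_log_n]
  have hL : 0 < Real.log E.N := by linarith [h.one_le_log_N]
  have hw := h.contraction_pos
  have hz := h.contraction'_pos
  have hlogN : Real.log E.N = Real.log E.m + Real.log E.n := by
    rw [hN, Real.log_mul (by positivity) (by positivity)]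
  suffices E.kappa (5 * (t : ℝ) / 6) t t ≤ E.rate by unfold rateIter; linarith
  rw [kappa_eq]
  refine max_le ?_ ?_ <;> refine le_of_pow_le_pow_left₀ two_ne_zero (Real.sqrt_nonneg _) ?_ <;>
    rw [rate_sq, mul_pow, Real.sq_sqrt (by positivity), ← pow_mul,
      ← Real.log_le_log_iff (by positivity) (by positivity),
      Real.log_mul (by positivity) (by positivity), Real.log_pow,
      Real.log_div (y := (E.N : ℝ)) (by positivity) (by positivity)]
  · have h1 := ht.1
    rw [Real.log_div (by positivity) (by positivity), Real.log_mul (by positivity) (by positivity)]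
      at h1
    rw [Real.log_div (by positivity) (by positivity)]
    push_cast
    linarith [hlogN]
  · rw [Real.log_div (by positivity) (by positivity)]
    push_cast
    linarith [ht.2, hlogN]

/-- Because `s³ ≤ n`, both contraction factors are at most `n^{-1/36}`, whereas `m ≤ n^{1/c}`.
Hence `18 / c` iterations are enough. -/
lemma enoughIterations (hε : 0 < ε) (hε1 : ε < 1)
    (hlog : (Real.log E.n / Q.c) ^ 12 ≤ E.n) {t : ℕ} (ht : 18 / Q.c ≤ t) :
    E.EnoughIterations t := by
  rw [h.enoughIterations_iff hε hε1]
  have hm : (1 : ℝ) ≤ E.m := by exact_mod_cast h.m_pos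
  have hN : (E.N : ℝ) = E.m * E.n := by simp [N]
  have hn := h.n_pos
  have hc := Q.c_pos
  have hs : (0 : ℝ) < E.pop.s := by linarith [h.one_le_s]
  have hl : 0 < Real.log E.n := by linarith [h.one_le_log_n]
  have hL : 0 < Real.log E.N := by linarith [h.one_le_log_N]
  have hL' : Real.log E.N ≤ Real.log E.n / Q.c := by
    rw [le_div_iff₀ hc]; linarith [h.log_le_log]
  have h1 : 3 * Real.log E.pop.s ≤ Real.log E.n := by
    have h2 := h.sparse.trans (pow_le_one₀ hε.le hε1.le)
    rw [← mul_div_assoc, div_le_iff₀ hn, one_mul] at h2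
    have h3 : (E.pop.s : ℝ) ^ 3 ≤ E.n :=
      (le_mul_of_one_le_right (by positivity) h.one_le_log_N).trans h2
    have := Real.log_le_log (by positivity) h3
    rw [Real.log_pow] at this
    exact_mod_cast this
  have h2 : 12 * Real.log (Real.log E.n / Q.c) ≤ Real.log E.n := by
    have := Real.log_le_log (by positivity) hlog
    rw [Real.log_pow] at this
    exact_mod_cast this
  have h3 : Real.log (Real.log E.N) ≤ Real.log (Real.log E.n / Q.c) := Real.log_le_log hL hL'
  have h4 : Real.log (Real.log E.n) ≤ Real.log (Real.log E.N) :=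
    Real.log_le_log hl h.log_n_le_log_N
  have hw : Real.log E.n / 36 ≤ -Real.log E.contraction := by
    have h5 := congrArg Real.log (contraction_pow_six E)
    rw [Real.log_pow, Real.log_mul (by positivity) (by positivity), Real.log_pow, Real.log_pow,
      Real.log_div (by positivity) (by positivity)] at h5
    push_cast at h5
    linarith
  have hz : Real.log E.n / 36 ≤ -Real.log E.contraction' := by
    have h5 := congrArg Real.log (contraction'_sq E)
    rw [Real.log_pow, Real.log_mul (by positivity) (by positivity), Real.log_pow,
      Real.log_div (by positivity) (by positivity)] at h5
    push_cast at h5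
    linarith
  have hm' : Real.log E.m ≤ Real.log E.n / Q.c := by
    refine le_trans (Real.log_le_log (by positivity) ?_) hL'
    rw [hN]; exact le_mul_of_one_le_right (by positivity) (by linarith [h.three_le_n])
  have hmm : Real.log (E.m * Real.log E.n / Real.log E.N) ≤ Real.log E.m := by
    refine Real.log_le_log (by positivity) ?_
    rw [div_le_iff₀ hL]
    exact mul_le_mul_of_nonneg_left h.log_n_le_log_N (by positivity)
  have key : Real.log E.n / Q.c ≤ 2 * t * (Real.log E.n / 36) := by
    calc Real.log E.n / Q.c = 2 * (18 / Q.c) * (Real.log E.n / 36) := by ring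
      _ ≤ _ := by gcongr
  exact ⟨hmm.trans (hm'.trans (key.trans (mul_le_mul_of_nonneg_left hw (by positivity)))),
    hm'.trans (key.trans (mul_le_mul_of_nonneg_left hz (by positivity)))⟩

end

end Experiment.AsymptoticScale

lemma IsAdmissible.eventually_enoughIterations {Q : Constants} {E : ℕ → Experiment}
    (h : IsAdmissible Q E) {t : ℕ} (ht : 18 / Q.c ≤ t) :
    ∀ᶠ k in atTop, (E k).EnoughIterations t := by
  have h1 : ∀ᶠ x : ℝ in atTop, (Real.log x / Q.c) ^ 12 ≤ x := by
    have h2 := (Real.isLittleO_pow_log_id_atTop (n := 12)).bound (pow_pos Q.c_pos 12)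
    filter_upwards [h2, eventually_ge_atTop 1] with x hx hx1
    rw [div_pow, div_le_iff₀ (pow_pos Q.c_pos 12)]
    have := (le_abs_self _).trans hx
    simp only [id, Real.norm_eq_abs, abs_of_nonneg (by linarith : (0 : ℝ) ≤ x)] at this
    linarith
  filter_upwards [h.eventually_scale (ε := 1 / 2) (by norm_num), h.tendsto_n.eventually h1]
    with k hk hk'
  exact hk.enoughIterations (by norm_num) (by norm_num) hk' ht

end DHSQR

namespace DHSQR

/-! ### The iterates on a good sample -/

lemma mem_slopeSupp {p : ℕ} {v : Vec p} {j : Fin (p + 1)} : j ∈ slopeSupp v ↔ j ≠ 0 ∧ v j ≠ 0 := by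
  rw [slopeSupp, Finset.mem_erase, mem_supp]

/-- Exact recovery of the slope support from the absence of false discoveries, a sup-norm bound and
a beta-min condition. The two bounds have the common factor `c`; if it vanishes, then so
does the error. -/
lemma slopeSupp_eq_of_close {p : ℕ} {β θ : Vec p} {c a a' : ℝ} (hc : 0 ≤ c)
    (haa : a < a') (hsub : supp θ ⊆ supp β) (hclose : ∀ j ∈ supp β, |θ j - β j| ≤ c * a)
    (hmin : ∀ j ∈ slopeSupp β, c * a' ≤ |β j|) : slopeSupp θ = slopeSupp β := by
  refine Finset.Subset.antisymm (Finset.erase_subset_erase _ hsub) fun j hj => ?_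
  obtain ⟨hj0, hjβ⟩ := mem_slopeSupp.1 hj
  refine mem_slopeSupp.2 ⟨hj0, fun h0 => hjβ ?_⟩
  have h1 := hclose j (mem_supp.2 hjβ)
  have h2 := hmin j hj
  rw [h0, zero_sub, abs_neg] at h1
  have h3 : c * (a' - a) ≤ 0 := by linarith
  have h4 : c = 0 := le_antisymm (nonpos_of_mul_nonpos_left h3 (by linarith)) hc
  rw [h4, zero_mul] at h1
  exact abs_nonpos_iff.1 h1

/-- How large the factor in the regularization parameter has to be, relative to the factor in
the error of the current iterate. -/
noncomputable def penaltyConst (Q : Constants) (A₁ A₂ : ℝ) : ℝ :=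
  8 / Q.α * ((A₁ + A₂) * (|Q.bHi| / √Q.c) + A₂ + 1)

lemma penaltyConst_pos (Q : Constants) {A₁ A₂ : ℝ} (h₁ : 0 ≤ A₁) (h₂ : 0 ≤ A₂) :
    0 < penaltyConst Q A₁ A₂ := by
  have := Q.α_pos
  unfold penaltyConst; positivity

/-- The factor of `√s (√(log N / N) + κ)` in the bound for the `ℓ₂` error of the `g`-th iterate. -/
noncomputable def errorConst (Q : Constants) (C : ℕ → ℝ) : ℕ → ℝ
  | 0 => |Q.M|
  | g + 1 => 4 / Q.lamLo * C (g + 1)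

section Iterates

variable {E : Experiment} {Q : Constants} {K : ℝ → ℝ} {A₁ A₂ R ε : ℝ} {ω : E.Ω}

open Experiment

/-- One iteration on a good sample: an `ℓ₂` error of order `√s rateIter g` becomes one of order
`√s rateIter (g + 1)`, and the support remains in `S`. -/
lemma Experiment.GoodSample.step (hK : ∀ u, 0 ≤ K u) (hD : E.pop.Regular Q)
    (h : E.AsymptoticScale Q ε) (hε : 0 < ε) (hε1 : ε ≤ 1) (hA₁ : 0 ≤ A₁) (hA₂ : 0 ≤ A₂)
    (hεA : ε * (A₁ * |Q.bHi|) ≤ Q.α * Q.lamLo / 32)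
    (hω : GoodSample E K Q.τ A₁ A₂ R ω) (hR : R ≤ E.b) {g : ℕ} {a C' : ℝ} {β θ : Vec E.p}
    (ha : 0 ≤ a) (haR : a * (√E.pop.s * E.rateIter g) ≤ R)
    (hβ : supp β ⊆ E.pop.S) (herr : l2 (β - E.pop.beta) ≤ a * (√E.pop.s * E.rateIter g))
    (hC' : penaltyConst Q A₁ A₂ * (1 + a) ≤ C')
    (hstep : IsStep K Q.τ E.n E.h E.b (C' * E.rateIter (g + 1)) (fun i => E.X i ω)
      (fun i => E.Y i ω) β θ) :
    supp θ ⊆ E.pop.S ∧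
      l2 (θ - E.pop.beta) ≤ 4 / Q.lamLo * C' * (√E.pop.s * E.rateIter (g + 1)) ∧
      ∀ j ∈ E.pop.S, |θ j - E.pop.beta j| ≤ E.invInfoNorm * (2 * C' * E.rateIter (g + 1)) := by
  have hlo := Q.lamLo_pos
  have hα := Q.α_pos
  have hb := E.b_pos
  have hr := h.rateIter_pos (g + 1)
  have hC'pos : 0 < C' := (mul_pos (penaltyConst_pos Q hA₁ hA₂) (by linarith)).trans_le hC'
  have hnn := l2_nonneg (β - E.pop.beta)
  rw [supp_subset_iff] at hβ
  obtain ⟨hgood₁, hgood₂⟩ := hω β hβ (herr.trans haR)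
  have hsb : √E.pop.s * (A₁ * E.b) ≤ Q.α * Q.lamLo / 32 := by
    calc √E.pop.s * (A₁ * E.b) = A₁ * (√E.pop.s * E.b) := by ring
      _ ≤ A₁ * (|Q.bHi| * ε) := by
        refine mul_le_mul_of_nonneg_left ?_ hA₁
        refine h.sqrt_mul_b_le.trans (mul_le_mul (le_abs_self _) ?_ E.contraction_nonneg
          (abs_nonneg _))
        exact (h.contraction_le hε).trans (pow_le_of_le_one hε.le hε1 (by norm_num))
      _ ≤ _ := by linarith
  have hprod : Q.α * Q.lamLo ≤ Q.lamLo := mul_le_of_le_one_left hlo.le Q.α_lt.le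
  have hbe : E.b * l2 (β - E.pop.beta) ≤ a * (|Q.bHi| / √Q.c) * E.rateIter (g + 1) := by
    calc E.b * l2 (β - E.pop.beta) ≤ E.b * (a * (√E.pop.s * E.rateIter g)) :=
          mul_le_mul_of_nonneg_left herr hb.le
      _ = a * (E.b * (√E.pop.s * E.rateIter g)) := by ring
      _ ≤ a * (Q.bHi / √Q.c * E.rateIter (g + 1)) :=
          mul_le_mul_of_nonneg_left (h.b_mul_rateIter_le hε hε1 g) ha
      _ = a * (|Q.bHi| / √Q.c) * E.rateIter (g + 1) := by rw [abs_of_pos h.bHi_pos]; ring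
  -- the error of the current iterate is at most `R ≤ b`, so that its square is absorbed
  have hsq : l2 (β - E.pop.beta) ^ 2 ≤ E.b * l2 (β - E.pop.beta) := by
    rw [sq]; exact mul_le_mul_of_nonneg_right (herr.trans (haR.trans hR)) hnn
  have hlam : A₁ * E.b * l2 (β - E.pop.beta) +
      A₂ * (E.rate + l2 (β - E.pop.beta) ^ 2) ≤ Q.α / 8 * (C' * E.rateIter (g + 1)) := by
    have hpos : 0 ≤ (A₁ + A₂) * (|Q.bHi| / √Q.c) := by positivity
    calc A₁ * E.b * l2 (β - E.pop.beta) + A₂ * (E.rate + l2 (β - E.pop.beta) ^ 2)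
        = A₁ * (E.b * l2 (β - E.pop.beta)) + A₂ * E.rate + A₂ * l2 (β - E.pop.beta) ^ 2 := by ring
      _ ≤ A₁ * (a * (|Q.bHi| / √Q.c) * E.rateIter (g + 1)) + A₂ * E.rateIter (g + 1) +
          A₂ * (a * (|Q.bHi| / √Q.c) * E.rateIter (g + 1)) :=
        add_le_add (add_le_add (mul_le_mul_of_nonneg_left hbe hA₁)
          (mul_le_mul_of_nonneg_left (E.rate_le_rateIter _) hA₂))
          (mul_le_mul_of_nonneg_left (hsq.trans hbe) hA₂)
      _ = ((A₁ + A₂) * (|Q.bHi| / √Q.c) * a + A₂) * E.rateIter (g + 1) := by ring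
      _ ≤ (((A₁ + A₂) * (|Q.bHi| / √Q.c) + A₂ + 1) * (1 + a)) * E.rateIter (g + 1) := by
        refine mul_le_mul_of_nonneg_right ?_ hr.le
        linarith [mul_nonneg hA₂ ha]
      _ = Q.α / 8 * ((penaltyConst Q A₁ A₂ * (1 + a)) * E.rateIter (g + 1)) := by
        unfold penaltyConst; field_simp
      _ ≤ _ := mul_le_mul_of_nonneg_left (mul_le_mul_of_nonneg_right hC' hr.le) (by positivity)
  have hs2 : √E.pop.S.card * (A₁ * E.b) * (4 / Q.lamLo) ≤ Q.α / 8 := by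
    calc √E.pop.S.card * (A₁ * E.b) * (4 / Q.lamLo)
        ≤ Q.α * Q.lamLo / 32 * (4 / Q.lamLo) := mul_le_mul_of_nonneg_right hsb (by positivity)
      _ = Q.α / 8 := by field_simp; norm_num
  obtain ⟨h1, h2, h3⟩ := step_bounds hK E.h_pos hstep (A := E.pop.Info) (S := E.pop.S)
    (βs := E.pop.beta) hlo hD.eigen_lower hα Q.α_lt hD.irrepresentable (mul_pos hC'pos hr)
    (by positivity : 0 ≤ A₁ * E.b) ((supp_subset_iff).1 (Finset.Subset.refl _)) hβ hgood₁
    (fun j => (hgood₂ j).trans le_rfl) hlam (hsb.trans (by linarith)) hs2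
  refine ⟨supp_subset_iff.2 h1, h2.trans (le_of_eq ?_), fun j hj => (h3 j hj).trans (le_of_eq ?_)⟩
  · change 4 / Q.lamLo * √(E.pop.s) * (C' * E.rateIter (g + 1)) = _
    ring
  · change E.invInfoNorm * _ = _
    ring

/-- The error and support bounds for all iterates on a good sample, by induction; the initial error
`M a_N` has the form required for `g = 0`. -/
lemma Experiment.GoodSample.iterates (hK : ∀ u, 0 ≤ K u) (hD : E.pop.Regular Q)
    (h : E.AsymptoticScale Q ε) (hε : 0 < ε) (hε1 : ε ≤ 1) (hA₁ : 0 ≤ A₁) (hA₂ : 0 ≤ A₂)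
    (hεA : ε * (A₁ * |Q.bHi|) ≤ Q.α * Q.lamLo / 32)
    (hω : GoodSample E K Q.τ A₁ A₂ R ω) (hR : R ≤ E.b) {t : ℕ} {C : ℕ → ℝ}
    (herr0 : ∀ g ≤ t, 0 ≤ errorConst Q C g)
    (hconst : ∀ g ≤ t, errorConst Q C g * (2 * E.aN) ≤ R)
    (hC : ∀ g < t, penaltyConst Q A₁ A₂ * (1 + errorConst Q C g) ≤ C (g + 1))
    {βhat : ℕ → E.Ω → Vec E.p}
    (hit : E.IsIterates K Q.τ (fun g => C g * E.rateIter g) t βhat)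
    (hstart : l2 (βhat 0 ω - E.pop.beta) ≤ Q.M * E.aN) (hsupp : supp (βhat 0 ω) ⊆ E.pop.S) :
    ∀ g ≤ t, supp (βhat g ω) ⊆ E.pop.S ∧
      l2 (βhat g ω - E.pop.beta) ≤ errorConst Q C g * (√E.pop.s * E.rateIter g) ∧
      (1 ≤ g → ∀ j ∈ E.pop.S,
        |βhat g ω j - E.pop.beta j| ≤ E.invInfoNorm * (2 * C g * E.rateIter g)) := by
  intro g
  induction g with
  | zero =>
    refine fun _ => ⟨hsupp, hstart.trans ?_, fun h0 => by omega⟩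
    exact mul_le_mul (le_abs_self _) E.aN_le_sqrt_mul_rateIter E.aN_nonneg (abs_nonneg _)
  | succ g ih =>
    intro hg
    obtain ⟨h1, h2, -⟩ := ih (by omega)
    obtain ⟨h3, h4, h5⟩ := hω.step hK hD h hε hε1 hA₁ hA₂ hεA hR (herr0 g (by omega))
      ((mul_le_mul_of_nonneg_left (h.sqrt_mul_rateIter_le hε hε1 g) (herr0 g (by omega))).trans
        (hconst g (by omega))) h1 h2 (hC g (by omega)) (hit.step g (by omega) ω)
    exact ⟨h3, h4, fun _ => h5⟩

end Iterates

/-! ### Passage to the limit -/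

/-- If events of probability tending to one (two of them measurable) eventually imply `T`, then the
probability of `T` tends to one. The events `A` and `T` need not be measurable. -/
lemma tendsto_prob_one {E : ℕ → Experiment} {A B C T : ∀ k, Set (E k).Ω}
    (hA : Tendsto (fun k => (E k).P (A k)ᶜ) atTop (𝓝 0))
    (hB : Tendsto (fun k => (E k).P (B k)) atTop (𝓝 1)) (hBm : ∀ k, MeasurableSet (B k))
    (hC : Tendsto (fun k => (E k).P (C k)) atTop (𝓝 1)) (hCm : ∀ k, MeasurableSet (C k))
    (hT : ∀ᶠ k in atTop, A k ∩ B k ∩ C k ⊆ T k) :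
    Tendsto (fun k => (E k).P (T k)) atTop (𝓝 1) := by
  have hcompl : ∀ {D : ∀ k, Set (E k).Ω}, Tendsto (fun k => (E k).P (D k)) atTop (𝓝 1) →
      (∀ k, MeasurableSet (D k)) → Tendsto (fun k => (E k).P (D k)ᶜ) atTop (𝓝 0) := by
    intro D hD hDm
    have h1 := ENNReal.Tendsto.sub (tendsto_const_nhds (x := (1 : ENNReal)) (f := atTop)) hD
      (Or.inl ENNReal.one_ne_top)
    rw [tsub_self] at h1
    exact h1.congr fun k => (prob_compl_eq_one_sub (hDm k)).symm
  have hsum := (hA.add (hcompl hB hBm)).add (hcompl hC hCm)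
  have h1 := ENNReal.Tendsto.sub (tendsto_const_nhds (x := (1 : ENNReal)) (f := atTop)) hsum
    (Or.inl ENNReal.one_ne_top)
  rw [add_zero, add_zero, tsub_zero] at h1
  refine tendsto_of_tendsto_of_tendsto_of_le_of_le' h1 tendsto_const_nhds ?_
    (Eventually.of_forall fun k => prob_le_one)
  filter_upwards [hT] with k hk
  rw [tsub_le_iff_right]
  have hcov : (Set.univ : Set (E k).Ω) ⊆ T k ∪ ((A k)ᶜ ∪ (B k)ᶜ ∪ (C k)ᶜ) := by
    intro ω _
    by_cases hω : ω ∈ A k ∩ B k ∩ C k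
    · exact Or.inl (hk hω)
    · refine Or.inr ?_
      rw [← Set.compl_inter, ← Set.compl_inter]; exact hω
  calc (1 : ENNReal) = (E k).P Set.univ := measure_univ.symm
    _ ≤ (E k).P (T k ∪ ((A k)ᶜ ∪ (B k)ᶜ ∪ (C k)ᶜ)) := measure_mono hcov
    _ ≤ (E k).P (T k) + ((E k).P (A k)ᶜ + (E k).P (B k)ᶜ + (E k).P (C k)ᶜ) :=
      (measure_union_le _ _).trans (add_le_add le_rfl ((measure_union_le _ _).trans
        (add_le_add (measure_union_le _ _) le_rfl)))

lemma measurableSet_error_le {E : Experiment} {β : E.Ω → Vec E.p} (hβ : Measurable β) (x : ℝ) :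
    MeasurableSet {ω | l2 (β ω - E.pop.beta) ≤ x} := by
  refine measurableSet_le ?_ measurable_const
  unfold l2
  refine (Finset.measurable_sum _ fun j _ => ?_).sqrt
  exact (((measurable_pi_apply j).comp hβ).sub_const _).pow_const 2

lemma measurableSet_supp_subset {E : Experiment} {β : E.Ω → Vec E.p} (hβ : Measurable β) :
    MeasurableSet {ω | supp (β ω) ⊆ E.pop.S} := by
  simp only [supp_subset_iff]
  exact measurableSet_setOfPred.2 <| Measurable.forall fun j => Measurable.forall fun _ =>
    measurableSet_setOfPred.1
      (measurableSet_eq_fun ((measurable_pi_apply j).comp hβ) measurable_const)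

end DHSQR

open DHSQR in
theorem theorem4 (K : ℝ → ℝ) (hK : IsSmoothingKernel K) (Q : Constants) :
    -- `T` bounds the number of iterations; `C₁` and `Φ` say what sufficiently large means
    ∃ (T : ℕ) (C₁ : ℝ) (Φ : ℝ → ℝ), ∀ t : ℕ, 1 ≤ t →
      ∀ C : ℕ → ℝ, C₁ ≤ C 1 → (∀ g, 1 ≤ g → g < t → Φ (C g) ≤ C (g + 1)) →
      ∃ Cmin : ℝ, 0 < Cmin ∧
        ∀ (E : ℕ → Experiment) (βhat : ∀ k, ℕ → (E k).Ω → Vec (E k).p),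
          IsAdmissible Q E →
          IsGoodStart Q E (fun k => βhat k 0) →
          (∀ k, (E k).IsIterates K Q.τ (fun g => C g * (E k).rateIter g) t (βhat k)) →
          -- no false discoveries
          Tendsto (fun k => (E k).P {ω | supp (βhat k t ω) ⊆ (E k).pop.S}) atTop (𝓝 1) ∧
          -- exact recovery under the beta-min condition
          ((∀ᶠ k in atTop, ∀ j ∈ slopeSupp (E k).pop.beta,
              Cmin * (E k).invInfoNorm * (E k).rateIter t ≤ |(E k).pop.beta j|) →
            Tendsto (fun k => (E k).P {ω | slopeSupp (βhat k t ω) = slopeSupp (E k).pop.beta})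
              atTop (𝓝 1)) ∧
          -- exact recovery under the single-machine beta-min condition, after enough iterations
          ((∀ᶠ k in atTop, (E k).EnoughIterations t) →
            (∀ᶠ k in atTop, ∀ j ∈ slopeSupp (E k).pop.beta,
              Cmin * (E k).invInfoNorm * (E k).rate ≤ |(E k).pop.beta j|) →
            Tendsto (fun k => (E k).P {ω | slopeSupp (βhat k t ω) = slopeSupp (E k).pop.beta})
              atTop (𝓝 1)) ∧
          -- a constant number of iterations is enough
          (T ≤ t → ∀ᶠ k in atTop, (E k).EnoughIterations t) := by
  have hcκ : 0 < Q.bLo ^ 3 * Q.c := mul_pos (pow_pos Q.bLo_pos 3) Q.c_pos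
  obtain ⟨A₁, A₂, small, hA₁, hA₂, hsmall, hprob⟩ := Experiment.goodSample_prob hK Q hcκ
  have hP := penaltyConst_pos Q hA₁ hA₂
  have hlo := Q.lamLo_pos
  have hα := Q.α_pos
  refine ⟨⌈18 / Q.c⌉₊, penaltyConst Q A₁ A₂ * (1 + |Q.M|),
    fun x => penaltyConst Q A₁ A₂ * (1 + 4 / Q.lamLo * |x|), fun t ht C hC1 hC => ?_⟩
  have hCpos : ∀ g < t, 0 < C (g + 1) := by
    rintro (_ | g) hg
    · exact lt_of_lt_of_le (mul_pos hP (by positivity)) hC1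
    · exact lt_of_lt_of_le (mul_pos hP (by positivity)) (hC (g + 1) (by omega) hg)
  have herr0 : ∀ g ≤ t, 0 ≤ errorConst Q C g := by
    rintro (_ | g) hg
    · exact abs_nonneg _
    · exact mul_nonneg (by positivity) (hCpos g hg).le
  have hCstep : ∀ g < t, penaltyConst Q A₁ A₂ * (1 + errorConst Q C g) ≤ C (g + 1) := by
    rintro (_ | g) hg
    · exact hC1
    · have := hC (g + 1) (by omega) hg
      simp only [abs_of_pos (hCpos g (by omega))] at this
      exact this
  obtain ⟨t', rfl⟩ : ∃ t', t = t' + 1 := ⟨t - 1, by omega⟩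
  have hCt : 0 < C (t' + 1) := hCpos t' (by omega)
  refine ⟨5 * C (t' + 1), by positivity, fun E βhat hE hstart hit => ?_⟩
  -- the radius of the neighbourhood of `β*` that contains all the iterates is a multiple of `a_N`
  set A : ℝ := ∑ g ∈ Finset.range (t' + 2), 2 * errorConst Q C g with hA
  have hAle : ∀ g ≤ t' + 1, 2 * errorConst Q C g ≤ A := fun g hg =>
    Finset.single_le_sum (f := fun g => 2 * errorConst Q C g)
      (fun i hi => mul_nonneg zero_le_two
        (herr0 i (by have := Finset.mem_range.1 hi; omega))) (Finset.mem_range.2 (by omega))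
  have hA0 : 0 ≤ A := (mul_nonneg zero_le_two (herr0 0 (by omega))).trans (hAle 0 (by omega))
  obtain ⟨ε, hε, hε1, hεb, hεs, hεR, hεA⟩ : ∃ ε : ℝ, 0 < ε ∧ ε < 1 ∧ ε ≤ Q.bLo ^ 3 ∧
      ε * (|Q.bHi| + A + 3) ≤ small ∧ ε * A ^ 3 ≤ Q.bLo ^ 3 * Q.c ∧
      ε * (A₁ * |Q.bHi|) ≤ Q.α * Q.lamLo / 32 := by
    have hlin : ∀ c d : ℝ, 0 < d → ∀ᶠ ε in 𝓝[>] (0 : ℝ), ε * c ≤ d := by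
      intro c d hd
      have h1 : Tendsto (fun ε : ℝ => ε * c) (𝓝[>] 0) (𝓝 (0 * c)) :=
        (tendsto_id.mono_left nhdsWithin_le_nhds).mul_const c
      rw [zero_mul] at h1
      exact h1.eventually_le_const hd
    have hpos : ∀ᶠ ε in 𝓝[>] (0 : ℝ), 0 < ε := self_mem_nhdsWithin
    have hev := hpos.and ((hlin 2 1 one_pos).and ((hlin 1 _ (pow_pos Q.bLo_pos 3)).and
      ((hlin (|Q.bHi| + A + 3) _ hsmall).and
        ((hlin (A ^ 3) _ hcκ).and
          (hlin (A₁ * |Q.bHi|) _ (by positivity : 0 < Q.α * Q.lamLo / 32))))))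
    obtain ⟨ε, h0, h1, h2, h3, h4, h5⟩ := hev.exists
    exact ⟨ε, h0, by linarith, by linarith, h3, h4, h5⟩
  have hscale := hE.eventually_scale hε
  -- the events `GoodSample`, and the two events about the initial estimator
  have hgood : Tendsto (fun k => (E k).P
      {ω | Experiment.GoodSample (E k) K Q.τ A₁ A₂ (A * (E k).aN) ω}ᶜ) atTop (𝓝 0) := by
    have h1 : Tendsto (fun k => ENNReal.ofReal (10 / ((E k).N : ℝ))) atTop (𝓝 0) := by
      have := ENNReal.tendsto_ofReal (hE.tendsto_N.const_div_atTop 10)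
      rwa [ENNReal.ofReal_zero] at this
    refine tendsto_of_tendsto_of_tendsto_of_le_of_le' tendsto_const_nhds h1
      (Eventually.of_forall fun _ => zero_le) ?_
    filter_upwards [hscale] with k hk
    have h2 := hprob (E k) (A * (E k).aN) (hE.regular k)
      (hk.effectiveScale hε hε1.le hA0 hεb hεs hεR)
    exact (ENNReal.le_ofReal_iff_toReal_le (measure_ne_top _ _) (by positivity)).2 h2
  have hlim : ∀ T : ∀ k, Set (E k).Ω,
      (∀ᶠ k in atTop, ∀ ω, supp (βhat k (t' + 1) ω) ⊆ (E k).pop.S →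
        (∀ j ∈ (E k).pop.S, |βhat k (t' + 1) ω j - (E k).pop.beta j| ≤
          (E k).invInfoNorm * (2 * C (t' + 1) * (E k).rateIter (t' + 1))) → ω ∈ T k) →
      Tendsto (fun k => (E k).P (T k)) atTop (𝓝 1) := by
    intro T hT
    refine tendsto_prob_one hgood hstart.error
      (fun k => measurableSet_error_le ((hit k).measurable 0 (by omega)) _) hstart.support
      (fun k => measurableSet_supp_subset ((hit k).measurable 0 (by omega))) ?_
    filter_upwards [hscale, hT] with k hk hTk
    rintro ω ⟨⟨h1, h2⟩, h3⟩
    have hR := (hk.effectiveScale hε hε1.le hA0 hεb hεs hεR).R_le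
    obtain ⟨h4, -, h5⟩ := Experiment.GoodSample.iterates hK.nonneg (hE.regular k) hk hε hε1.le
      hA₁ hA₂ hεA h1 hR herr0
      (fun g hg => le_trans (le_of_eq (by ring))
        (mul_le_mul_of_nonneg_right (hAle g hg) (E k).aN_nonneg)) hCstep (hit k) h2 h3
      (t' + 1) le_rfl
    exact hTk ω h4 (h5 (by omega))
  refine ⟨hlim _ (Eventually.of_forall fun k ω h _ => h), fun hmin => hlim _ ?_,
    fun hen hmin => hlim _ ?_, fun hT => hE.eventually_enoughIterations (Nat.ceil_le.1 hT)⟩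
  · filter_upwards [hmin, hscale] with k hk hsc ω h1 h2
    have hr := hsc.rateIter_pos (t' + 1)
    refine slopeSupp_eq_of_close (maxRowSum_nonneg _) (mul_lt_mul_of_pos_right
      (by linarith : 2 * C (t' + 1) < 5 * C (t' + 1)) hr) h1 h2 fun j hj => ?_
    exact le_trans (le_of_eq (by unfold Experiment.invInfoNorm; ring)) (hk j hj)
  · filter_upwards [hmin, hen, hscale] with k hk henk hsc ω h1 h2
    have hr := hsc.rateIter_pos (t' + 1)
    have hr2 := hsc.rateIter_le_rate hε hε1 henk
    refine slopeSupp_eq_of_close (maxRowSum_nonneg _) (a' := 5 * C (t' + 1) * (E k).rate)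
      ?_ h1 h2 fun j hj => ?_
    · calc 2 * C (t' + 1) * (E k).rateIter (t' + 1) ≤ 2 * C (t' + 1) * (2 * (E k).rate) :=
            mul_le_mul_of_nonneg_left hr2 (by positivity)
        _ = 4 * C (t' + 1) * (E k).rate := by ring
        _ < 5 * C (t' + 1) * (E k).rate :=
          mul_lt_mul_of_pos_right (by linarith) (by linarith)
    · exact le_trans (le_of_eq (by unfold Experiment.invInfoNorm; ring)) (hk j hj)
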